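/- **Theorem (Higman's criterion).** Let $p$ be a prime and $R$ a commutative ring with $1$. Let $\mathcal F$ be a saturated fusion system over a finite $p$-group $S$, and let $\mathcal G$ be a saturated fusion system (over a finite $p$-group containing $S$) with $\mathcal F\subseteq\mathcal G$. For a saturated fusion system $\mathcal E$ over $S_{\mathcal E}$, let $\mu_R(\mathcal E)$ be its Mackey algebra, that is, the $R$-algebra generated by $I_A^B$, $R_A^B$ ($A\le B\le S_{\mathcal E}$) and $c_\varphi$ ($\varphi$ an isomorphism in $\mathcal E$) subject to: $I_A^A=R_A^A=c_{c_a}$ for $a\in A$ (where $c_a$ is conjugation by $a$); $I_B^CI_A^B=I_A^C$, $R_A^BR_B^C=R_A^C$ and $c_\psi c_\varphi=c_{\psi\varphi}$; $c_\varphi I_A^B=I_{\varphi(A)}^{\varphi(B)}c_{\varphi|_A}$ and $c_{\varphi|_A}R_A^B=R_{\varphi(A)}^{\varphi(B)}c_\varphi$ for $\varphi$ defined on $B\ge A$; the Mackey formula $R_B^CI_A^C=\sum_{x\in[B\backslash C/A]}I_{B\cap{}^xA}^B\,c_{c_x}\,R_{B^x\cap A}^A$; and the $I_A^A$ are orthogonal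 idempotents with sum $1$. A *Mackey functor over $\mathcal E$* is a finitely generated left $\mu_R(\mathcal E)$-module. For $\mathcal E\subseteq\mathcal G$, $\operatorname{Mack}^{\mathcal G}_R(\mathcal E)$ denotes the Mackey functors $M$ over $\mathcal E$ that are *$\mathcal G$-centric*, i.e. $I_K^KM=0$ for every $K\le S_{\mathcal E}$ that is not $\mathcal G$-centric. Let $H\le S$ be $\mathcal F$-centric and let $\mathcal F_H(H)$ be the fusion system over $H$ whose morphisms are the conjugations by elements of $H$. Write $1_H=\sum_{K\le H}I_K^K\in\mu_R(\mathcal F)$ for the image of $1\in\mu_R(\mathcal F_H(H))$. Put $M{\downarrow}=1_HM$ for a $\mu_R(\mathcal F)$-module $M$, $N{\uparrow}=\mu_R(\mathcal F)1_H\otimes_{\mu_R(\mathcal F_H(H))}N$ for a $\mu_R(\mathcal F_H(H))$-module $N$, and $M_H=M{\downarrow}{\uparrow}$. Let $\theta_H\colon M_H\to M$ be the morphism $y\otimes x\mapsto yx$. For an $\mathcal F$-centric $K\le S$ consider the pairs $(A,\varphi)$ with $A\le H$ $\mathcal F$-centric and $\varphi\colon A\to K$ in $\mathcal F$, taken modulo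 inner automorphisms of $K$, with the preorder $(A,\varphi)\precsim(B,\psi)$ if there is $h\in H$ such that $A^h=h^{-1}Ah\le B$ and $\varphi\circ c_h=\psi|_{A^h}$ up to an inner automorphism of $K$. Let $[H\times_{\mathcal F}K]$ be a set of representatives of the maximal pairs modulo the equivalence relation given by $\precsim$. For $M\in\operatorname{Mack}^{\mathcal F}_R(\mathcal F)$ let $\theta^H\colon M\to M_H$ be the additive map with $$\theta^H(x)=\sum_{(A,\varphi)\in[H\times_{\mathcal F}K]}I_{\varphi(A)}^K\,c_\varphi\otimes c_{\varphi^{-1}}R_{\varphi(A)}^K\,x\qquad(x\in I_K^KM,\ K\ \mathcal F\text{-centric}).$$ Let $M\in\operatorname{Mack}^{\mathcal G}_R(\mathcal F)$ be indecomposable. Then $\theta^H$ is a morphism of Mackey functors. Define $\operatorname{tr}_H^{\mathcal F}\colon\operatorname{End}(M{\downarrow})\to\operatorname{End}(M)$ by $f\mapsto\theta_H\circ f{\uparrow}\circ\theta^H$, with image $\operatorname{Tr}_H^{\mathcal F}$. The following are equivalent. 1. There is $N\in\operatorname{Mack}^{\mathcal G}_R(\mathcal F_H(H))$ such that $M$ is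 a direct summand of $N{\uparrow}$. 2. There is $N\in\operatorname{Mack}^{\mathcal F}_R(\mathcal F_H(H))$ such that $M$ is a direct summand of $N{\uparrow}$. 3. $\operatorname{Id}_M\in\operatorname{Tr}_H^{\mathcal F}$. 4. $\operatorname{End}(M)=\operatorname{Tr}_H^{\mathcal F}$. 5. $\theta_H$ is surjective and, for all $N,L\in\operatorname{Mack}^{\mathcal F}_R(\mathcal F)$ and all morphisms $\varphi\colon N\to L$ and $\psi\colon M\to L$ with $\varphi$ surjective: if there is a morphism $\gamma\colon M{\downarrow}\to N{\downarrow}$ with $\varphi{\downarrow}\,\gamma=\psi{\downarrow}$, then there is a morphism $\hat\gamma\colon M\to N$ with $\varphi\hat\gamma=\psi$. 6. $\theta^H$ is injective and, for all $N,L\in\operatorname{Mack}^{\mathcal F}_R(\mathcal F)$ and all morphisms $\varphi\colon L\to N$ and $\psi\colon L\to M$ with $\varphi$ injective: if there is a morphism $\gamma\colon N{\downarrow}\to M{\downarrow}$ with $\gamma\,\varphi{\downarrow}=\psi{\downarrow}$, then there is a morphism $\hat\gamma\colon N\to M$ with $\hat\gamma\varphi=\psi$. 7. $\theta_H$ is surjective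 and, for every $N\in\operatorname{Mack}^{\mathcal F}_R(\mathcal F)$ and every surjective morphism $\varphi\colon N\to M$: if $\varphi{\downarrow}$ splits, then $\varphi$ splits. 8. $\theta^H$ is injective and, for every $N\in\operatorname{Mack}^{\mathcal F}_R(\mathcal F)$ and every injective morphism $\varphi\colon M\to N$: if $\varphi{\downarrow}$ splits, then $\varphi$ splits. 9. $\theta_H$ is split surjective (that is, $M$ is $H$-projective). 10. $\theta^H$ is split injective. 11. $M$ is a direct summand of $M_H$. -/

import Mathlib

open scoped Pointwise TensorProduct

universe u

/-! ### Fusion systems -/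

/-- A (not necessarily saturated) fusion system over a subgroup `S` of an ambient group `T`
(in the applications `T` is a finite `p`-group, so that `S` is one too).
The objects are the subgroups of `S`; `Hom P Q` is the set of morphisms from `P` to `Q`. -/
structure FusionSystem (T : Type u) [Group T] where
  /-- the group over which the fusion system lives -/
  S : Subgroup T
  /-- the morphisms `P → Q` -/
  Hom : ∀ P Q : Subgroup T, Set (P →* Q)
  le_of_mem : ∀ {P Q : Subgroup T} {φ : P →* Q}, φ ∈ Hom P Q → P ≤ S ∧ Q ≤ S
  injective_of_mem : ∀ {P Q : Subgroup T} {φ : P →* Q}, φ ∈ Hom P Q → Function.Injective φ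
  comp_mem : ∀ {P Q W : Subgroup T} {φ : P →* Q} {ψ : Q →* W},
    φ ∈ Hom P Q → ψ ∈ Hom Q W → ψ.comp φ ∈ Hom P W
  conj_mem : ∀ {P Q : Subgroup T} {φ : P →* Q} {s : T}, P ≤ S → Q ≤ S → s ∈ S →
    (∀ x : P, (φ x : T) = s * x * s⁻¹) → φ ∈ Hom P Q
  /-- `φ` seen as an isomorphism `ψ` onto its image, and the inverse of the latter,
  are morphisms -/
  iso_mem : ∀ {P Q : Subgroup T} {φ : P →* Q}, φ ∈ Hom P Q →
    ∀ (P' : Subgroup T) (ψ : P ≃* P'), (∀ x : P, (ψ x : T) = φ x) →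
      ψ.toMonoidHom ∈ Hom P P' ∧ ψ.symm.toMonoidHom ∈ Hom P' P

namespace FusionSystem

variable {T : Type u} [Group T]

/-- `E ≤ F`: the fusion system `E` is contained in `F` (that is, `E` is a subcategory of `F`;
the group of `E` is then a subgroup of that of `F`). -/
instance : LE (FusionSystem T) := ⟨fun E F => ∀ P Q : Subgroup T, E.Hom P Q ⊆ F.Hom P Q⟩

variable (F : FusionSystem T)

/-- The isomorphism of groups `φ` is an isomorphism in `F`. -/
def IsIso {P Q : Subgroup T} (φ : P ≃* Q) : Prop := φ.toMonoidHom ∈ F.Hom P Q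

/-- `P` and `Q` are isomorphic in `F`. -/
def Conj (P Q : Subgroup T) : Prop := ∃ φ : P ≃* Q, F.IsIso φ

/-- `P` is `F`-centric: `C_S(Q) ≤ Q` for every `Q` isomorphic to `P` in `F`. -/
def IsCentric (P : Subgroup T) : Prop :=
  P ≤ F.S ∧ ∀ Q : Subgroup T, F.Conj P Q → F.S ⊓ Subgroup.centralizer (Q : Set T) ≤ Q

/-- `N_S(P)`. -/
def normalizerIn (P : Subgroup T) : Subgroup T := F.S ⊓ Subgroup.normalizer (P : Set T)

/-- `P` is fully `F`-normalized. -/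
def FullyNormalized (P : Subgroup T) : Prop :=
  P ≤ F.S ∧ ∀ Q : Subgroup T, F.Conj P Q → Nat.card (F.normalizerIn Q) ≤ Nat.card (F.normalizerIn P)

/-- The image of `φ : P → Q` as a subgroup of `T`. -/
def image {P Q : Subgroup T} (φ : P →* Q) : Subgroup T := φ.range.map Q.subtype

/-- The `φ`-normalizer `N_φ`: all `x ∈ N_S(P)` such that there is `z ∈ N_S(φ(P))` with
`φ(x y x⁻¹) = z φ(y) z⁻¹` for all `y ∈ P`. -/
def phiNormalizer {P Q : Subgroup T} (φ : P →* Q) : Subgroup T where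
  carrier := {x | x ∈ F.normalizerIn P ∧ ∃ z ∈ F.normalizerIn (image φ),
    ∀ y y' : P, (y' : T) = x * y * x⁻¹ → (φ y' : T) = z * φ y * z⁻¹}
  one_mem' := ⟨one_mem _, 1, one_mem _, fun y y' h => by
    have : y' = y := Subtype.ext (by simpa using h)
    simp [this]⟩
  mul_mem' := by
    rintro a b ⟨ha, z, hz, h⟩ ⟨hb, w, hw, h'⟩
    refine ⟨mul_mem ha hb, z * w, mul_mem hz hw, fun y y' e => ?_⟩
    have hm : b * y * b⁻¹ ∈ P := (Subgroup.mem_normalizer_iff.1 hb.2 y).1 y.2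
    rw [h ⟨_, hm⟩ y' (by rw [e]; group), h' y ⟨_, hm⟩ rfl]
    group
  inv_mem' := by
    rintro a ⟨ha, z, hz, h⟩
    refine ⟨inv_mem ha, z⁻¹, inv_mem hz, fun y y' e => ?_⟩
    rw [h y' y (by rw [e]; group)]
    group

/-- `Aut_F(S)`. -/
def autS : Subgroup (MulAut F.S) where
  carrier := {φ | F.IsIso φ}
  one_mem' := F.conj_mem (s := 1) le_rfl le_rfl (one_mem _) (fun x => by simp)
  mul_mem' := fun {a b} ha hb => F.comp_mem (φ := b.toMonoidHom) (ψ := a.toMonoidHom) hb ha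
  inv_mem' := fun {a} ha => (F.iso_mem ha F.S a (fun _ => rfl)).2

/-- `F` is saturated (with respect to the prime `p`): `Aut_S(S)` is a Sylow `p`-subgroup of
`Aut_F(S)`, and every morphism `φ : P → S` with fully normalized image extends to `N_φ`. -/
def IsSaturated (p : ℕ) : Prop :=
  (∃ Q : Sylow p F.autS,
    (Q : Subgroup F.autS) = (MulAut.conj : F.S →* MulAut F.S).range.subgroupOf F.autS) ∧
  ∀ (P : Subgroup T) (φ : P →* F.S), φ ∈ F.Hom P F.S → F.FullyNormalized (image φ) →
    ∃ ψ ∈ F.Hom (F.phiNormalizer φ) F.S,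
      ∀ (y : P) (x : F.phiNormalizer φ), (x : T) = y → ψ x = φ y

/-- The fusion system `F_H(H)` over `H`, whose morphisms are the conjugations by elements
of `H`. -/
def inner (H : Subgroup T) : FusionSystem T where
  S := H
  Hom P Q := {φ | P ≤ H ∧ Q ≤ H ∧ ∃ h ∈ H, ∀ x : P, (φ x : T) = h * x * h⁻¹}
  le_of_mem h := ⟨h.1, h.2.1⟩
  injective_of_mem := by
    rintro P Q φ ⟨-, -, h, -, e⟩ x y hxy
    have : h * x * h⁻¹ = h * y * h⁻¹ := by rw [← e, ← e, hxy]
    exact Subtype.ext (by simpa using this)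
  comp_mem := by
    rintro P Q W φ ψ ⟨hP, -, h, hh, e⟩ ⟨-, hW, k, hk, e'⟩
    refine ⟨hP, hW, k * h, mul_mem hk hh, fun x => ?_⟩
    rw [MonoidHom.comp_apply, e', e]
    group
  conj_mem hP hQ hs e := ⟨hP, hQ, _, hs, e⟩
  iso_mem := by
    rintro P Q φ ⟨hP, hQ, h, hh, e⟩ P' ψ hψ
    have hP' : P' ≤ H := fun x hx => by
      have := hψ (ψ.symm ⟨x, hx⟩)
      rw [MulEquiv.apply_symm_apply] at this
      exact (show x = _ from this) ▸ hQ (φ _).2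
    refine ⟨⟨hP, hP', h, hh, fun x => (hψ x).trans (e x)⟩, ⟨hP', hP, h⁻¹, inv_mem hh, fun x => ?_⟩⟩
    have := (hψ (ψ.symm x)).trans (e _)
    rw [MulEquiv.apply_symm_apply] at this
    change ((ψ.symm x : P) : T) = _
    rw [this]
    group

variable {F}

theorem S_le_of_le {E : FusionSystem T} (h : E ≤ F) : E.S ≤ F.S :=
  (F.le_of_mem (h _ _ (E.conj_mem (φ := MonoidHom.id E.S) (s := 1) le_rfl le_rfl (one_mem _)
    (fun x => by simp)))).1

theorem inner_le {H : Subgroup T} (hH : H ≤ F.S) : inner H ≤ F := by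
  rintro P Q φ ⟨hP, hQ, h, hh, e⟩
  exact F.conj_mem (hP.trans hH) (hQ.trans hH) (hH hh) e

theorem isIso_symm {P Q : Subgroup T} {φ : P ≃* Q} (h : F.IsIso φ) : F.IsIso φ.symm :=
  (F.iso_mem h Q φ (fun _ => rfl)).2

theorem isIso_trans {P Q W : Subgroup T} {φ : P ≃* Q} {ψ : Q ≃* W} (h : F.IsIso φ)
    (h' : F.IsIso ψ) : F.IsIso (φ.trans ψ) :=
  F.comp_mem (φ := φ.toMonoidHom) (ψ := ψ.toMonoidHom) h h'

theorem isIso_refl {P : Subgroup T} (h : P ≤ F.S) : F.IsIso (MulEquiv.refl P) :=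
  F.conj_mem (s := 1) h h (one_mem _) (fun x => by simp)

/-- A homomorphism `φ`, injective, as an isomorphism onto its image. -/
noncomputable def imageIso {P Q : Subgroup T} (φ : P →* Q) (h : Function.Injective φ) :
    P ≃* image φ :=
  (MonoidHom.ofInjective h).trans (φ.range.equivMapOfInjective Q.subtype Q.subtype_injective)

theorem isIso_imageIso {P Q : Subgroup T} {φ : P →* Q} (h : φ ∈ F.Hom P Q) :
    F.IsIso (imageIso φ (F.injective_of_mem h)) :=
  (F.iso_mem h _ _ (fun _ => rfl)).1

theorem image_le {P Q : Subgroup T} (φ : P →* Q) : image φ ≤ Q := Subgroup.map_subtype_le _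

/-- Conjugation `c_x : A → ˣA`, `a ↦ x a x⁻¹`. -/
def conjIso (x : T) (A : Subgroup T) : A ≃* (MulAut.conj x • A : Subgroup T) :=
  Subgroup.equivSMul (MulAut.conj x) A

theorem conj_smul_le {x : T} {A J : Subgroup T} (hx : x ∈ J) (hA : A ≤ J) :
    (MulAut.conj x • A : Subgroup T) ≤ J := by
  rintro _ ⟨a, ha, rfl⟩
  exact J.mul_mem (J.mul_mem hx (hA ha)) (J.inv_mem hx)

theorem isIso_conjIso {x : T} {A : Subgroup T} (hx : x ∈ F.S) (hA : A ≤ F.S) :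
    F.IsIso (conjIso x A) :=
  F.conj_mem hA (conj_smul_le hx hA) hx (fun _ => rfl)

/-! ### The Mackey algebra -/

variable (F)

/-- The generators `I_H^K`, `R_H^K` (for `H ≤ K ≤ S`) and `c_φ` (for `φ` an isomorphism in `F`)
of the Mackey algebra. -/
inductive Gen : Type u
  | ind (H K : Subgroup T) (hHK : H ≤ K) (hK : K ≤ F.S) : Gen
  | res (H K : Subgroup T) (hHK : H ≤ K) (hK : K ≤ F.S) : Gen
  | conj (P Q : Subgroup T) (φ : P ≃* Q) (hφ : F.IsIso φ) : Gen

variable {F}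

/-- `K^x ∩ H`, where `K^x = x⁻¹ K x`. -/
def interConj (K H : Subgroup T) (x : T) : Subgroup T := (MulAut.conj x⁻¹ • K) ⊓ H

theorem conj_interConj_le (K H : Subgroup T) (x : T) :
    (MulAut.conj x • interConj K H x : Subgroup T) ≤ K := by
  rintro _ ⟨a, ⟨⟨k, hk, rfl⟩, -⟩, rfl⟩
  have : x * (x⁻¹ * k * x⁻¹⁻¹) * x⁻¹ = k := by group
  change x * (x⁻¹ * k * x⁻¹⁻¹) * x⁻¹ ∈ K
  rwa [this]

theorem interConj_le (K H : Subgroup T) (x : T) : interConj K H x ≤ H := inf_le_right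

variable (F) (R : Type u) [CommRing R]

/-- The defining relations of the Mackey algebra. In `mackey` the sum runs over representatives
`x` of the double cosets `K \ J / H`, and the `x`-th summand is
`I_{K ∩ ˣH}^K c_{c_x} R_{K^x ∩ H}^H`; note that `ˣ(K^x ∩ H) = K ∩ ˣH`.
The last two relations say that the `I_H^H` are orthogonal (hence all products of generators that
are not composable vanish) and add up to `1`. -/
inductive Rel : FreeAlgebra R F.Gen → FreeAlgebra R F.Gen → Prop
  | res_self (H : Subgroup T) (hH : H ≤ F.S) :
      Rel (FreeAlgebra.ι R (Gen.res H H le_rfl hH)) (FreeAlgebra.ι R (Gen.ind H H le_rfl hH))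
  | conj_self (H : Subgroup T) (hH : H ≤ F.S) (φ : H ≃* H) (hφ : F.IsIso φ) (h : T) (hh : h ∈ H)
      (e : ∀ y : H, (φ y : T) = h * y * h⁻¹) :
      Rel (FreeAlgebra.ι R (Gen.conj H H φ hφ)) (FreeAlgebra.ι R (Gen.ind H H le_rfl hH))
  | res_res (H K J : Subgroup T) (hHK : H ≤ K) (hKJ : K ≤ J) (hJ : J ≤ F.S) :
      Rel (FreeAlgebra.ι R (Gen.res H K hHK (hKJ.trans hJ)) * FreeAlgebra.ι R (Gen.res K J hKJ hJ))
        (FreeAlgebra.ι R (Gen.res H J (hHK.trans hKJ) hJ))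
  | ind_ind (H K J : Subgroup T) (hHK : H ≤ K) (hKJ : K ≤ J) (hJ : J ≤ F.S) :
      Rel (FreeAlgebra.ι R (Gen.ind K J hKJ hJ) * FreeAlgebra.ι R (Gen.ind H K hHK (hKJ.trans hJ)))
        (FreeAlgebra.ι R (Gen.ind H J (hHK.trans hKJ) hJ))
  | conj_conj (P Q W : Subgroup T) (φ : P ≃* Q) (ψ : Q ≃* W) (hφ : F.IsIso φ) (hψ : F.IsIso ψ) :
      Rel (FreeAlgebra.ι R (Gen.conj Q W ψ hψ) * FreeAlgebra.ι R (Gen.conj P Q φ hφ))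
        (FreeAlgebra.ι R (Gen.conj P W (φ.trans ψ) (isIso_trans hφ hψ)))
  | conj_ind (H K H' K' : Subgroup T) (hHK : H ≤ K) (hK : K ≤ F.S) (hHK' : H' ≤ K')
      (hK' : K' ≤ F.S) (θ : K ≃* K') (hθ : F.IsIso θ) (θ' : H ≃* H') (hθ' : F.IsIso θ')
      (e : ∀ y : H, (θ' y : T) = θ (Subgroup.inclusion hHK y)) :
      Rel (FreeAlgebra.ι R (Gen.conj K K' θ hθ) * FreeAlgebra.ι R (Gen.ind H K hHK hK))
        (FreeAlgebra.ι R (Gen.ind H' K' hHK' hK') * FreeAlgebra.ι R (Gen.conj H H' θ' hθ'))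
  | conj_res (H K H' K' : Subgroup T) (hHK : H ≤ K) (hK : K ≤ F.S) (hHK' : H' ≤ K')
      (hK' : K' ≤ F.S) (θ : K ≃* K') (hθ : F.IsIso θ) (θ' : H ≃* H') (hθ' : F.IsIso θ')
      (e : ∀ y : H, (θ' y : T) = θ (Subgroup.inclusion hHK y)) :
      Rel (FreeAlgebra.ι R (Gen.conj H H' θ' hθ') * FreeAlgebra.ι R (Gen.res H K hHK hK))
        (FreeAlgebra.ι R (Gen.res H' K' hHK' hK') * FreeAlgebra.ι R (Gen.conj K K' θ hθ))
  | mackey (H K J : Subgroup T) (hH : H ≤ J) (hK : K ≤ J) (hJ : J ≤ F.S) :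
      Rel (FreeAlgebra.ι R (Gen.res K J hK hJ) * FreeAlgebra.ι R (Gen.ind H J hH hJ))
        (∑ᶠ q : DoubleCoset.Quotient (K.subgroupOf J : Set J) (H.subgroupOf J : Set J),
          FreeAlgebra.ι R (Gen.ind (MulAut.conj (q.out : T) • interConj K H (q.out : T)) K
              (conj_interConj_le K H _) (hK.trans hJ)) *
            FreeAlgebra.ι R (Gen.conj (interConj K H (q.out : T)) _
              (conjIso (q.out : T) (interConj K H (q.out : T)))
              (isIso_conjIso (hJ q.out.2) ((interConj_le K H _).trans (hH.trans hJ)))) *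
            FreeAlgebra.ι R (Gen.res (interConj K H (q.out : T)) H (interConj_le K H _)
              (hH.trans hJ)))
  | orthogonal (H K : Subgroup T) (hH : H ≤ F.S) (hK : K ≤ F.S) (hne : H ≠ K) :
      Rel (FreeAlgebra.ι R (Gen.ind H H le_rfl hH) * FreeAlgebra.ι R (Gen.ind K K le_rfl hK)) 0
  | one : Rel (∑ᶠ K : {K : Subgroup T // K ≤ F.S}, FreeAlgebra.ι R (Gen.ind K.1 K.1 le_rfl K.2)) 1

end FusionSystem

open FusionSystem

section MackeyAlgebra

variable {T : Type u} [Group T] (R : Type u) [CommRing R] (F : FusionSystem T)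

/-- The Mackey algebra `μ_R(F)`. -/
def MackeyAlgebra : Type u := RingQuot (F.Rel R)

noncomputable instance : Ring (MackeyAlgebra R F) := inferInstanceAs (Ring (RingQuot (F.Rel R)))

noncomputable instance : Algebra R (MackeyAlgebra R F) :=
  inferInstanceAs (Algebra R (RingQuot (F.Rel R)))

namespace MackeyAlgebra

/-- The quotient map from the free algebra on the generators. -/
noncomputable def mk : FreeAlgebra R F.Gen →ₐ[R] MackeyAlgebra R F := RingQuot.mkAlgHom R (F.Rel R)

variable {F}

theorem mk_rel {a b : FreeAlgebra R F.Gen} (h : F.Rel R a b) : mk R F a = mk R F b :=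
  RingQuot.mkAlgHom_rel R h

/-- `I_H^K` -/
noncomputable def ind {H K : Subgroup T} (hHK : H ≤ K) (hK : K ≤ F.S) : MackeyAlgebra R F :=
  mk R F (FreeAlgebra.ι R (Gen.ind H K hHK hK))

/-- `R_H^K` -/
noncomputable def res {H K : Subgroup T} (hHK : H ≤ K) (hK : K ≤ F.S) : MackeyAlgebra R F :=
  mk R F (FreeAlgebra.ι R (Gen.res H K hHK hK))

/-- `c_φ` -/
noncomputable def conj {P Q : Subgroup T} {φ : P ≃* Q} (hφ : F.IsIso φ) : MackeyAlgebra R F :=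
  mk R F (FreeAlgebra.ι R (Gen.conj P Q φ hφ))

/-- The idempotent `∑_{K ≤ H} I_K^K`. -/
noncomputable def idem {H : Subgroup T} (hH : H ≤ F.S) : MackeyAlgebra R F :=
  ∑ᶠ K : {K : Subgroup T // K ≤ H}, ind R (F := F) (le_refl K.1) (K.2.trans hH)

theorem ind_mul_self {H K : Subgroup T} (hHK : H ≤ K) (hK : K ≤ F.S) :
    ind R (F := F) le_rfl hK * ind R hHK hK = ind R hHK hK := by
  simpa [ind] using mk_rel R (Rel.ind_ind (F := F) (R := R) H K K hHK le_rfl hK)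

theorem ind_self_mul {H K : Subgroup T} (hHK : H ≤ K) (hK : K ≤ F.S) :
    ind R (F := F) hHK hK * ind R le_rfl (hHK.trans hK) = ind R hHK hK := by
  simpa [ind] using mk_rel R (Rel.ind_ind (F := F) (R := R) H H K le_rfl hHK hK)

theorem res_self {H : Subgroup T} (hH : H ≤ F.S) :
    res R (F := F) (le_refl H) hH = ind R (le_refl H) hH := mk_rel R (Rel.res_self H hH)

theorem mul_res {H K : Subgroup T} (hHK : H ≤ K) (hK : K ≤ F.S) :
    ind R (F := F) le_rfl (hHK.trans hK) * res R hHK hK = res R hHK hK := by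
  rw [← res_self]
  simpa [res] using mk_rel R (Rel.res_res (F := F) (R := R) H H K le_rfl hHK hK)

theorem res_mul {H K : Subgroup T} (hHK : H ≤ K) (hK : K ≤ F.S) :
    res R (F := F) hHK hK * ind R le_rfl hK = res R hHK hK := by
  rw [← res_self]
  simpa [res] using mk_rel R (Rel.res_res (F := F) (R := R) H K K hHK le_rfl hK)

theorem conj_refl {H : Subgroup T} (hH : H ≤ F.S) :
    conj R (isIso_refl (F := F) hH) = ind R le_rfl hH :=
  mk_rel R (Rel.conj_self H hH _ _ 1 (one_mem _) (fun y => by simp))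

theorem mul_conj {P Q : Subgroup T} {φ : P ≃* Q} (hφ : F.IsIso φ) (hQ : Q ≤ F.S) :
    ind R (F := F) le_rfl hQ * conj R hφ = conj R hφ := by
  rw [← conj_refl]
  have := mk_rel R (Rel.conj_conj (F := F) (R := R) P Q Q φ _ hφ (isIso_refl hQ))
  rw [map_mul] at this
  exact this

theorem conj_mul {P Q : Subgroup T} {φ : P ≃* Q} (hφ : F.IsIso φ) (hP : P ≤ F.S) :
    conj R hφ * ind R (F := F) le_rfl hP = conj R hφ := by
  rw [← conj_refl]
  have := mk_rel R (Rel.conj_conj (F := F) (R := R) P P Q _ φ (isIso_refl hP) hφ)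
  rw [map_mul] at this
  exact this

theorem ind_orthogonal {H K : Subgroup T} (hH : H ≤ F.S) (hK : K ≤ F.S) (hne : H ≠ K) :
    ind R (F := F) le_rfl hH * ind R le_rfl hK = 0 := by
  simpa [ind] using mk_rel R (Rel.orthogonal (F := F) (R := R) H K hH hK hne)

/-- The universal property: an algebra homomorphism on the free algebra which respects the
relations factors through the Mackey algebra. -/
noncomputable def lift {B : Type*} [Ring B] [Algebra R B] (f : FreeAlgebra R F.Gen →ₐ[R] B)
    (hf : ∀ ⦃a b⦄, F.Rel R a b → f a = f b) : MackeyAlgebra R F →ₐ[R] B :=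
  RingQuot.liftAlgHom R ⟨f, hf⟩

theorem lift_mk {B : Type*} [Ring B] [Algebra R B] (f : FreeAlgebra R F.Gen →ₐ[R] B)
    (hf : ∀ ⦃a b⦄, F.Rel R a b → f a = f b) (a : FreeAlgebra R F.Gen) :
    lift R f hf (mk R F a) = f a :=
  RingQuot.liftAlgHom_mkAlgHom_apply R f hf a

variable [Finite T]

theorem idem_mul_ind {H K : Subgroup T} (hH : H ≤ F.S) (hK : K ≤ H) :
    idem R hH * ind R (F := F) le_rfl (hK.trans hH) = ind R le_rfl (hK.trans hH) := by
  classical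
  have := Fintype.ofFinite {K : Subgroup T // K ≤ H}
  rw [idem, finsum_eq_sum_of_fintype, Finset.sum_mul, Finset.sum_eq_single ⟨K, hK⟩]
  · exact ind_mul_self R _ _
  · intro b _ hb
    exact ind_orthogonal R _ _ (fun e => hb (Subtype.ext e))
  · simp

theorem ind_mul_idem {H K : Subgroup T} (hH : H ≤ F.S) (hK : K ≤ H) :
    ind R (F := F) le_rfl (hK.trans hH) * idem R hH = ind R le_rfl (hK.trans hH) := by
  classical
  have := Fintype.ofFinite {K : Subgroup T // K ≤ H}
  rw [idem, finsum_eq_sum_of_fintype, Finset.mul_sum, Finset.sum_eq_single ⟨K, hK⟩]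
  · exact ind_mul_self R _ _
  · intro b _ hb
    exact ind_orthogonal R _ _ (fun e => hb (Subtype.ext e.symm))
  · simp

theorem idem_idem {H : Subgroup T} (hH : H ≤ F.S) : IsIdempotentElem (idem R (F := F) hH) := by
  classical
  have := Fintype.ofFinite {K : Subgroup T // K ≤ H}
  have e : idem R (F := F) hH = ∑ K : {K : Subgroup T // K ≤ H}, ind R le_rfl (K.2.trans hH) := by
    rw [idem, finsum_eq_sum_of_fintype]
  change idem R hH * idem R hH = _
  nth_rewrite 1 [e]
  rw [Finset.sum_mul, e, ← e]
  conv_rhs => rw [e]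
  exact Finset.sum_congr rfl (fun K _ => ind_mul_idem R hH K.2)

/-! #### The inclusion `μ_R(E) → μ_R(F)` for `E ≤ F`, a non-unital homomorphism -/

/-- The corner `e μ_R(F) e` as an `R`-algebra with unit `e`. -/
noncomputable instance cornerAlgebra {e : MackeyAlgebra R F} (he : IsIdempotentElem e) :
    Algebra R he.Corner where
  smul r x := ⟨r • x.1, by
    obtain ⟨y, hy⟩ := x.2
    exact ⟨r • y, by rw [← hy]; simp⟩⟩
  algebraMap :=
    { toFun := fun r => ⟨r • e, ⟨r • e, by simp [he.eq]⟩⟩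
      map_one' := Subtype.ext (one_smul _ _)
      map_zero' := Subtype.ext (zero_smul _ _)
      map_add' := fun a b => Subtype.ext (add_smul _ _ _)
      map_mul' := fun a b => Subtype.ext (by
        change (a * b) • e = (a • e) * (b • e)
        rw [smul_mul_smul_comm, he.eq]) }
  commutes' r x := Subtype.ext (by
    have h := (Subsemigroup.mem_corner_iff he).1 x.2
    change (r • e) * x.1 = x.1 * (r • e)
    rw [smul_mul_assoc, mul_smul_comm, h.1, h.2])
  smul_def' r x := Subtype.ext (by
    have h := (Subsemigroup.mem_corner_iff he).1 x.2
    change r • x.1 = (r • e) * x.1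
    rw [smul_mul_assoc, h.1])

variable {E : FusionSystem T}

/-- The image in `μ_R(F)` of a generator of `μ_R(E)`. -/
noncomputable def inclGen (h : E ≤ F) : E.Gen → MackeyAlgebra R F
  | .ind _ _ hHK hK => ind R hHK (hK.trans (S_le_of_le h))
  | .res _ _ hHK hK => res R hHK (hK.trans (S_le_of_le h))
  | .conj _ _ _ hφ => conj R (h _ _ hφ)

theorem idem_mul_inclGen (h : E ≤ F) (g : E.Gen) :
    idem R (S_le_of_le h) * inclGen R h g = inclGen R h g := by
  cases g with
  | ind H K hHK hK =>
    simp only [inclGen]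
    rw [← ind_mul_self, ← mul_assoc, idem_mul_ind R _ hK]
  | res H K hHK hK =>
    simp only [inclGen]
    rw [← mul_res, ← mul_assoc, idem_mul_ind R _ (hHK.trans hK)]
  | conj P Q φ hφ =>
    simp only [inclGen]
    rw [← mul_conj R (h _ _ hφ) (((E.le_of_mem hφ).2).trans (S_le_of_le h)), ← mul_assoc,
      idem_mul_ind R _ (E.le_of_mem hφ).2]

theorem inclGen_mul_idem (h : E ≤ F) (g : E.Gen) :
    inclGen R h g * idem R (S_le_of_le h) = inclGen R h g := by
  cases g with
  | ind H K hHK hK =>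
    simp only [inclGen]
    rw [← ind_self_mul, mul_assoc, ind_mul_idem R _ (hHK.trans hK)]
  | res H K hHK hK =>
    simp only [inclGen]
    rw [← res_mul, mul_assoc, ind_mul_idem R _ hK]
  | conj P Q φ hφ =>
    simp only [inclGen]
    rw [← conj_mul R (h _ _ hφ) (((E.le_of_mem hφ).1).trans (S_le_of_le h)), mul_assoc,
      ind_mul_idem R _ (E.le_of_mem hφ).1]

/-- The image of a generator, as an element of the corner of `μ_R(F)` with unit
`∑_{K ≤ E.S} I_K^K`. -/
noncomputable def cornerGen (h : E ≤ F) (g : E.Gen) :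
    (idem_idem R (F := F) (S_le_of_le h)).Corner :=
  ⟨inclGen R h g, inclGen R h g, by
    change idem R _ * inclGen R h g * idem R _ = _
    rw [idem_mul_inclGen, inclGen_mul_idem]⟩

/-- The unital homomorphism from the free algebra on the generators of `μ_R(E)` to the corner
of `μ_R(F)` with unit `∑_{K ≤ E.S} I_K^K`. -/
noncomputable def inclFree (h : E ≤ F) :
    FreeAlgebra R E.Gen →ₐ[R] (idem_idem R (F := F) (S_le_of_le h)).Corner :=
  FreeAlgebra.lift R (cornerGen R h)

theorem inclFree_ι (h : E ≤ F) (g : E.Gen) :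
    (inclFree R h (FreeAlgebra.ι R g)).1 = inclGen R h g := by
  rw [inclFree, FreeAlgebra.lift_ι_apply]
  rfl

/-- The inclusion of the corner. -/
noncomputable def cornerVal {e : MackeyAlgebra R F} (he : IsIdempotentElem e) :
    he.Corner →+ MackeyAlgebra R F where
  toFun x := x.1
  map_zero' := rfl
  map_add' _ _ := rfl

theorem inclFree_rel (h : E ≤ F) {a b : FreeAlgebra R E.Gen} (hab : E.Rel R a b) :
    inclFree R h a = inclFree R h b := by
  have hmul : ∀ x y : (idem_idem R (F := F) (S_le_of_le h)).Corner, (x * y).1 = x.1 * y.1 :=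
    fun _ _ => rfl
  apply Subtype.ext
  cases hab with
  | res_self H hH =>
    simp only [inclFree_ι]
    exact mk_rel R (Rel.res_self H _)
  | conj_self H hH φ hφ x hx e =>
    simp only [inclFree_ι]
    exact mk_rel R (Rel.conj_self H (hH.trans (S_le_of_le h)) φ _ x hx e)
  | res_res H K J hHK hKJ hJ =>
    have := mk_rel R (Rel.res_res (R := R) H K J hHK hKJ (hJ.trans (S_le_of_le h)))
    rw [map_mul] at this
    rw [map_mul, hmul]
    simp only [inclFree_ι]
    exact this
  | ind_ind H K J hHK hKJ hJ =>
    have := mk_rel R (Rel.ind_ind (R := R) H K J hHK hKJ (hJ.trans (S_le_of_le h)))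
    rw [map_mul] at this
    rw [map_mul, hmul]
    simp only [inclFree_ι]
    exact this
  | conj_conj P Q W φ ψ hφ hψ =>
    have := mk_rel R (Rel.conj_conj (R := R) P Q W φ ψ (h _ _ hφ) (h _ _ hψ))
    rw [map_mul] at this
    rw [map_mul, hmul]
    simp only [inclFree_ι]
    exact this
  | conj_ind H K H' K' hHK hK hHK' hK' θ hθ θ' hθ' e =>
    have := mk_rel R (Rel.conj_ind (R := R) H K H' K' hHK (hK.trans (S_le_of_le h)) hHK'
      (hK'.trans (S_le_of_le h)) θ (h _ _ hθ) θ' (h _ _ hθ') e)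
    rw [map_mul, map_mul] at this
    rw [map_mul, hmul, map_mul, hmul]
    simp only [inclFree_ι]
    exact this
  | conj_res H K H' K' hHK hK hHK' hK' θ hθ θ' hθ' e =>
    have := mk_rel R (Rel.conj_res (R := R) H K H' K' hHK (hK.trans (S_le_of_le h)) hHK'
      (hK'.trans (S_le_of_le h)) θ (h _ _ hθ) θ' (h _ _ hθ') e)
    rw [map_mul, map_mul] at this
    rw [map_mul, hmul, map_mul, hmul]
    simp only [inclFree_ι]
    exact this
  | mackey H K J hH hK hJ =>
    have := mk_rel R (Rel.mackey (R := R) H K J hH hK (hJ.trans (S_le_of_le h)))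
    have hfin : Finite (DoubleCoset.Quotient (K.subgroupOf J : Set J) (H.subgroupOf J : Set J)) :=
      inferInstanceAs (Finite (_root_.Quotient _))
    have hfin' := Fintype.ofFinite
      (DoubleCoset.Quotient (K.subgroupOf J : Set J) (H.subgroupOf J : Set J))
    rw [map_mul, finsum_eq_sum_of_fintype, map_sum] at this
    change _ = cornerVal R _ _
    rw [map_mul, hmul, finsum_eq_sum_of_fintype, map_sum, map_sum]
    simp only [map_mul] at this ⊢
    have hval : ∀ x y : (idem_idem R (F := F) (S_le_of_le h)).Corner,
        cornerVal R (idem_idem R (S_le_of_le h)) (x * y) =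
          cornerVal R (idem_idem R (S_le_of_le h)) x * cornerVal R (idem_idem R (S_le_of_le h)) y :=
      fun _ _ => rfl
    have hι : ∀ g, cornerVal R (idem_idem R (S_le_of_le h)) (inclFree R h (FreeAlgebra.ι R g)) =
        inclGen R h g := inclFree_ι R h
    simp only [hval, hι, inclFree_ι]
    exact this
  | orthogonal H K hH hK hne =>
    rw [map_mul, hmul, inclFree_ι, inclFree_ι, map_zero]
    exact ind_orthogonal R _ _ hne
  | one =>
    have := Fintype.ofFinite {K : Subgroup T // K ≤ E.S}
    change cornerVal R (idem_idem R (S_le_of_le h)) _ = _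
    have hι : ∀ g, cornerVal R (idem_idem R (S_le_of_le h)) (inclFree R h (FreeAlgebra.ι R g)) =
        inclGen R h g := inclFree_ι R h
    rw [finsum_eq_sum_of_fintype, map_sum, map_sum, map_one]
    simp only [hι]
    change _ = idem R (S_le_of_le h)
    rw [idem, finsum_eq_sum_of_fintype]
    rfl

/-- The natural homomorphism `μ_R(E) → μ_R(F)` for `E ≤ F`; it maps each generator to the
generator of the same name, and `1` to the idempotent `∑_{K ≤ E.S} I_K^K`. -/
noncomputable def incl (h : E ≤ F) : MackeyAlgebra R E →ₙ+* MackeyAlgebra R F where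
  toFun a := (lift R (inclFree R h) (fun _ _ => inclFree_rel R h) a).1
  map_mul' a b := by rw [map_mul]; rfl
  map_zero' := by rw [map_zero]; rfl
  map_add' a b := by rw [map_add]; rfl

theorem incl_mk (h : E ≤ F) (a : FreeAlgebra R E.Gen) :
    incl R h (mk R E a) = (inclFree R h a).1 :=
  congrArg Subtype.val (lift_mk R (inclFree R h) _ a)

theorem incl_ind (h : E ≤ F) {H K : Subgroup T} (hHK : H ≤ K) (hK : K ≤ E.S) :
    incl R h (ind R hHK hK) = ind R hHK (hK.trans (S_le_of_le h)) := by
  rw [ind, incl_mk, inclFree_ι, inclGen]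

theorem incl_res (h : E ≤ F) {H K : Subgroup T} (hHK : H ≤ K) (hK : K ≤ E.S) :
    incl R h (res R hHK hK) = res R hHK (hK.trans (S_le_of_le h)) := by
  rw [res, incl_mk, inclFree_ι, inclGen]

theorem incl_conj (h : E ≤ F) {P Q : Subgroup T} {φ : P ≃* Q} (hφ : E.IsIso φ) :
    incl R h (conj R hφ) = conj R (h _ _ hφ) := by
  rw [conj, incl_mk, inclFree_ι, inclGen]

theorem incl_one (h : E ≤ F) : incl R h 1 = idem R (S_le_of_le h) := by
  have := incl_mk R h 1
  rwa [map_one, map_one (inclFree R h)] at this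

theorem incl_smul (h : E ≤ F) (r : R) (a : MackeyAlgebra R E) :
    incl R h (r • a) = r • incl R h a :=
  congrArg Subtype.val (map_smul (lift R (inclFree R h) (fun _ _ => inclFree_rel R h)) r a)

end MackeyAlgebra

end MackeyAlgebra

/-! ### Mackey functors, restriction and induction -/

section MackeyFunctors

open MackeyAlgebra

variable {T : Type u} [Group T] [Finite T] (R : Type u) [CommRing R]

/-- The module `M` over `μ_R(E)` is an object of `Mack^G_R(E)`: a Mackey functor over `E` on `R`
(a finitely generated left `μ_R(E)`-module) that is `G`-centric, that is, `I_K^K M = 0` for all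
`K` in `E` which are not `G`-centric. For `G = E` these are the centric Mackey functors over `E`. -/
def IsCentricMackey (G E : FusionSystem T) (M : Type u) [AddCommGroup M]
    [Module (MackeyAlgebra R E) M] : Prop :=
  Module.Finite (MackeyAlgebra R E) M ∧
    ∀ (K : Subgroup T) (hK : K ≤ E.S), ¬ G.IsCentric K →
      ∀ x : M, ind R (F := E) (le_refl K) hK • x = 0

variable {E F : FusionSystem T} (h : E ≤ F)

section Restriction

variable (M N : Type u) [AddCommGroup M] [Module (MackeyAlgebra R F) M]
  [AddCommGroup N] [Module (MackeyAlgebra R F) N]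

/-- The subgroup `1_{μ_R(E)} M` of `M`. -/
noncomputable def restrictionSubgroup : AddSubgroup M where
  carrier := {x | incl R h 1 • x = x}
  zero_mem' := smul_zero _
  add_mem' {a b} ha hb := by
    change incl R h 1 • (a + b) = a + b
    rw [smul_add, show incl R h 1 • a = a from ha, show incl R h 1 • b = b from hb]
  neg_mem' {a} ha := by
    change incl R h 1 • (-a) = -a
    rw [smul_neg, show incl R h 1 • a = a from ha]

/-- The restriction `M↓_E^F = 1_{μ_R(E)} M`. -/
noncomputable def Restriction : Type u := restrictionSubgroup R h M

noncomputable instance : AddCommGroup (Restriction R h M) :=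
  inferInstanceAs (AddCommGroup (restrictionSubgroup R h M))

variable {M}

theorem smul_mem_restriction (a : MackeyAlgebra R E) (x : M) :
    incl R h a • x ∈ restrictionSubgroup R h M := by
  change incl R h 1 • incl R h a • x = incl R h a • x
  rw [← mul_smul, ← map_mul, one_mul]

variable (M)

noncomputable instance : Module (MackeyAlgebra R E) (Restriction R h M) where
  smul a x := ⟨incl R h a • x.1, smul_mem_restriction R h a x.1⟩
  one_smul x := Subtype.ext x.2
  mul_smul a b x := Subtype.ext (by
    change incl R h (a * b) • x.1 = incl R h a • incl R h b • x.1
    rw [map_mul, mul_smul])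
  smul_zero a := Subtype.ext (smul_zero _)
  smul_add a x y := Subtype.ext (smul_add _ _ _)
  add_smul a b x := Subtype.ext (by
    change incl R h (a + b) • x.1 = incl R h a • x.1 + incl R h b • x.1
    rw [map_add, add_smul])
  zero_smul x := Subtype.ext (by
    change incl R h 0 • x.1 = 0
    rw [map_zero, zero_smul])

/-- The inclusion `M↓_E^F ⊆ M`. -/
noncomputable def Restriction.val : Restriction R h M →+ M := (restrictionSubgroup R h M).subtype

variable {M N}

/-- The restriction `f↓_E^F` of a morphism. -/
noncomputable def Restriction.map (f : M →ₗ[MackeyAlgebra R F] N) :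
    Restriction R h M →ₗ[MackeyAlgebra R E] Restriction R h N where
  toFun x := ⟨f x.1, by
    change incl R h 1 • f x.1 = f x.1
    rw [← map_smul, show incl R h 1 • x.1 = x.1 from x.2]⟩
  map_add' x y := Subtype.ext (map_add f x.1 y.1)
  map_smul' a x := Subtype.ext (map_smul f (incl R h a) x.1)

end Restriction

section Induction

variable (N N' : Type u) [AddCommGroup N] [Module (MackeyAlgebra R E) N]
  [AddCommGroup N'] [Module (MackeyAlgebra R E) N']

/-- The relations `y a ⊗ n = y ⊗ a n` for `a` in `μ_R(E)`. -/
noncomputable def inductionRel : Submodule (MackeyAlgebra R F) (MackeyAlgebra R F ⊗[ℤ] N) :=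
  Submodule.span (MackeyAlgebra R F)
    {t | ∃ (y : MackeyAlgebra R F) (a : MackeyAlgebra R E) (n : N),
      t = (y * incl R h a) ⊗ₜ[ℤ] n - y ⊗ₜ[ℤ] (a • n)}

/-- The induction `N↑_E^F = μ_R(F) 1_{μ_R(E)} ⊗_{μ_R(E)} N`, as the quotient of
`μ_R(F) ⊗_ℤ N` by the relations `y a ⊗ n = y ⊗ a n` (the case `a = 1` identifies `y ⊗ n` with
`y 1_{μ_R(E)} ⊗ n`). -/
noncomputable def Induction : Type u := (MackeyAlgebra R F ⊗[ℤ] N) ⧸ inductionRel R h N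

noncomputable instance : AddCommGroup (Induction R h N) :=
  inferInstanceAs (AddCommGroup ((MackeyAlgebra R F ⊗[ℤ] N) ⧸ inductionRel R h N))

noncomputable instance : Module (MackeyAlgebra R F) (Induction R h N) :=
  inferInstanceAs
    (Module (MackeyAlgebra R F) ((MackeyAlgebra R F ⊗[ℤ] N) ⧸ inductionRel R h N))

variable {N N'}

/-- The element `y ⊗ n` of `N↑_E^F`. -/
noncomputable def Induction.tmul (y : MackeyAlgebra R F) (n : N) : Induction R h N :=
  (inductionRel R h N).mkQ (y ⊗ₜ[ℤ] n)

/-- The induction `f↑_E^F` of a morphism: `y ⊗ n ↦ y ⊗ f n`. -/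
noncomputable def Induction.map (f : N →ₗ[MackeyAlgebra R E] N') :
    Induction R h N →ₗ[MackeyAlgebra R F] Induction R h N' :=
  Submodule.mapQ (inductionRel R h N) (inductionRel R h N')
    (TensorProduct.AlgebraTensorModule.map LinearMap.id f.toAddMonoidHom.toIntLinearMap) (by
      rw [inductionRel, Submodule.span_le]
      rintro _ ⟨y, a, n, rfl⟩
      refine Submodule.subset_span ⟨y, a, f n, ?_⟩
      simp)

end Induction

/-! ### The morphisms `θ_H` and `θ^H`, transfer -/

section Theta

variable (M : Type u) [AddCommGroup M] [Module (MackeyAlgebra R F) M]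

/-- The morphism `M↓_E^F↑_E^F → M`, `y ⊗ x ↦ y x`; for `E = F_H(H)` this is `θ_H`. -/
noncomputable def thetaDown :
    Induction R h (Restriction R h M) →ₗ[MackeyAlgebra R F] M :=
  Submodule.liftQ (inductionRel R h (Restriction R h M))
    (TensorProduct.AlgebraTensorModule.lift
      (LinearMap.toSpanSingleton (MackeyAlgebra R F) (Restriction R h M →ₗ[ℤ] M)
        (Restriction.val R h M).toIntLinearMap)) (by
      rw [inductionRel, Submodule.span_le]
      rintro _ ⟨y, a, n, rfl⟩
      change _ = _
      rw [map_sub, sub_eq_zero]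
      change (y * incl R h a) • n.1 = y • (incl R h a • n.1)
      rw [mul_smul])

theorem thetaDown_tmul (y : MackeyAlgebra R F) (x : Restriction R h M) :
    thetaDown R h M (Induction.tmul R h y x) = y • Restriction.val R h M x := rfl

end Theta

end MackeyFunctors

namespace FusionSystem

variable {T : Type u} [Group T] (F : FusionSystem T) (H K : Subgroup T)

/-- A pair `(A, φ)` with `A ≤ H` an `F`-centric subgroup and `φ : A → K` a morphism in `F`,
standing for the pair consisting of `A` and the class of `φ` modulo inner automorphisms of `K`
(a morphism `A → K` in the orbit category). -/
structure ProdPair where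
  A : Subgroup T
  φ : A →* K
  le : A ≤ H
  centric : F.IsCentric A
  mem : φ ∈ F.Hom A K

variable {F H K}

/-- The preorder `(A, φ) ≾ (B, ψ)`: there is `h ∈ H` with `A^h ≤ B` (where `A^h = h⁻¹ A h`) such
that `φ c_h` and `ψ|_{A^h}` are equal, as maps `A^h → K`, up to an inner automorphism of `K`. -/
def ProdPair.Precedes (P Q : ProdPair F H K) : Prop :=
  ∃ h ∈ H, ∃ k ∈ K, ∀ a : P.A, ∃ b : Q.A,
    (b : T) = h⁻¹ * a * h ∧ (P.φ a : T) = k * Q.φ b * k⁻¹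

theorem ProdPair.Precedes.rfl' (P : ProdPair F H K) : P.Precedes P :=
  ⟨1, one_mem _, 1, one_mem _, fun a => ⟨a, by simp⟩⟩

theorem ProdPair.Precedes.trans' {P Q W : ProdPair F H K} (h : P.Precedes Q)
    (h' : Q.Precedes W) : P.Precedes W := by
  obtain ⟨x, hx, k, hk, e⟩ := h
  obtain ⟨y, hy, l, hl, e'⟩ := h'
  refine ⟨x * y, mul_mem hx hy, k * l, mul_mem hk hl, fun a => ?_⟩
  obtain ⟨b, hb, hb'⟩ := e a
  obtain ⟨c, hc, hc'⟩ := e' b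
  refine ⟨c, ?_, ?_⟩
  · rw [hc, hb]; group
  · rw [hb', hc']; group

variable (F H K)

/-- The pairs that are maximal with respect to `≾`. -/
def MaxPair : Type u := {P : ProdPair F H K // ∀ Q : ProdPair F H K, P.Precedes Q → Q.Precedes P}

/-- `(A, φ) ∼ (B, ψ)` if `(A, φ) ≾ (B, ψ)` and `(B, ψ) ≾ (A, φ)`. -/
instance MaxPair.setoid : Setoid (MaxPair F H K) where
  r P Q := P.1.Precedes Q.1 ∧ Q.1.Precedes P.1
  iseqv := ⟨fun _ => ⟨.rfl' _, .rfl' _⟩, fun h => ⟨h.2, h.1⟩,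
    fun h h' => ⟨h.1.trans' h'.1, h'.2.trans' h.2⟩⟩

/-- The index set `[H ×_F K]`: equivalence classes of maximal pairs. The representative of the
class `q` is `q.out`. -/
def ProdIndex : Type u := Quotient (MaxPair.setoid F H K)

variable {F H K} in
/-- The chosen representative of a class. -/
noncomputable def ProdIndex.rep (q : ProdIndex F H K) : ProdPair F H K := (Quotient.out q).1

instance [Finite T] : Finite (ProdIndex F H K) := by
  have : Finite (ProdPair F H K) := by
    have : ∀ A : Subgroup T, Finite (A →* K) := fun A => DFunLike.finite _
    refine Finite.of_injective
      (fun P => (⟨P.A, P.φ⟩ : Σ A : Subgroup T, A →* K)) ?_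
    rintro ⟨A, φ, _, _, _⟩ ⟨B, ψ, _, _, _⟩ h
    cases h
    rfl
  have : Finite (MaxPair F H K) := inferInstanceAs (Finite {P : ProdPair F H K // _})
  exact inferInstanceAs (Finite (Quotient (MaxPair.setoid F H K)))

end FusionSystem

section Transfer

open MackeyAlgebra

variable {T : Type u} [Group T] [Finite T] (R : Type u) [CommRing R] {F : FusionSystem T}
  {H : Subgroup T} (hH : H ≤ F.S)
  (M : Type u) [AddCommGroup M] [Module (MackeyAlgebra R F) M]

/-- `M_H = M↓_{F_H(H)}^F↑_{F_H(H)}^F`. -/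
abbrev ResInd : Type u := Induction R (inner_le hH) (Restriction R (inner_le hH) M)

variable {M} in
/-- For a pair `(A, φ)` as above and `x ∈ M`, the element `c_{φ⁻¹} R_{φ(A)}^K x` of
`M↓_{F_H(H)}^F`, where `φ` is seen as an isomorphism `A → φ(A)`. -/
noncomputable def pairRes {K : Subgroup T} (P : ProdPair F H K) (x : M) :
    Restriction R (inner_le hH) M :=
  ⟨(conj R (isIso_symm (isIso_imageIso P.mem)) *
      res R (image_le P.φ) (F.le_of_mem P.mem).2) • x, by
    have := smul_mem_restriction R (inner_le hH) (ind R (F := inner H) (le_refl P.A) P.le)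
      ((conj R (isIso_symm (isIso_imageIso P.mem)) *
        res R (image_le P.φ) (F.le_of_mem P.mem).2) • x)
    rwa [incl_ind R (inner_le hH) (le_refl P.A) P.le, ← mul_smul, ← mul_assoc, mul_conj] at this⟩

variable {M} in
/-- The map `θ^H : M → M_H` given, for `x ∈ I_K^K M` with `K` an `F`-centric subgroup, by
`θ^H(x) = ∑_{(A, φ) ∈ [H ×_F K]} I_{φ(A)}^K c_φ ⊗ c_{φ⁻¹} R_{φ(A)}^K x`, and extended
additively to `M = ⨁_K I_K^K M`. -/
noncomputable def thetaUp (x : M) : ResInd R hH M :=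
  ∑ᶠ K : {K : Subgroup T // F.IsCentric K}, ∑ᶠ q : ProdIndex F H K.1,
    Induction.tmul R (inner_le hH)
      (ind R (image_le q.rep.φ) K.2.1 * conj R (isIso_imageIso q.rep.mem))
      (pairRes R hH q.rep (ind R (F := F) (le_refl K.1) K.2.1 • x))

variable {M} in
/-- The transfer map `tr_H^F : End(M↓_{F_H(H)}^F) → End(M)`, `f ↦ θ_H ∘ f↑_{F_H(H)}^F ∘ θ^H`,
where `θ` is the morphism `θ^H`. -/
noncomputable def transfer (θ : M →ₗ[MackeyAlgebra R F] ResInd R hH M)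
    (f : Module.End (MackeyAlgebra R (inner H)) (Restriction R (inner_le hH) M)) :
    Module.End (MackeyAlgebra R F) M :=
  thetaDown R (inner_le hH) M ∘ₗ Induction.map R (inner_le hH) f ∘ₗ θ

end Transfer

/-- The nonzero module `M` is indecomposable: it is not the direct sum of two nonzero
submodules. -/
def IsIndecomposable (A : Type u) [Ring A] (M : Type u) [AddCommGroup M] [Module A M] : Prop :=
  Nontrivial M ∧ ∀ P Q : Submodule A M, IsCompl P Q → P = ⊥ ∨ Q = ⊥

/-- `M` is (isomorphic to) a direct summand of `X`. -/
def IsSummand (A : Type u) [Ring A] (M X : Type u) [AddCommGroup M] [Module A M]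
    [AddCommGroup X] [Module A X] : Prop :=
  ∃ P Q : Submodule A X, IsCompl P Q ∧ Nonempty (M ≃ₗ[A] P)

/-! ### Conjugation of subgroups and normalizers -/

section Groups

variable {Γ : Type*} [Group Γ]

/-! Restriction to `inner H` has two adjoints: induction, with counit θ_H, and coinduction, with a
unit `Coind.unit` from M to the coinduced functor of M↓. The heart of the proof is that the two
agree on modules killed by I_A^A for every A that is not F-centric (`Coind.equivInduction`), and
that θ^H is the unit of coinduction followed by the inverse of this isomorphism
(`thetaUp_eq_toInduction`). Hence θ^H is a morphism of Mackey functors. Since θ^H and θ_H are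
natural, Higman's criterion becomes a formal argument about adjoint functors.

The formal part runs as follows. If the identity of M is a transfer, naturality of θ_H and θ^H turns
morphisms between restrictions into the required lifts and extensions. The triangle identities show
that θ_H and θ^H split after restriction, so the splitting conditions can be applied to these two
maps themselves. They also show that the identity of any induced functor is a transfer
(`exists_thetaDown_map_thetaUp_eq`), a property that direct summands inherit.

Coinduction is modelled by families n_D in N, indexed by the graphs D ≤ T × T of morphisms from
subgroups of H to K. Such a family is determined by its values at representatives of the maximal
graphs with centric source, which are indexed by [H ×_F K] (`Coind.ext_rep`). The module N embeds in
its coinduced functor by `Coind.zeta`. The elements I c_φ attached to these representatives act on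
the image of N by an identity matrix (`Coind.lam_smul_zeta_self`, `Coind.lam_smul_zeta_of_ne`), and
this makes induction and coinduction isomorphic.

The input about fusion systems is uniqueness: above a graph with centric source, the maximal graph
inside H × K is unique up to conjugation by an element of the center of the image
(`IsSaturated.exists_conj_of_isMaxGr`). It follows from extension to normalizers, from the Sylow
property of Aut_S(Q) for fully normalized Q (`IsSaturated.exists_conj_autIn`), and from the growth
of normalizers in p-groups. -/

theorem mem_conj_smul {g x : Γ} {D : Subgroup Γ} :
    x ∈ MulAut.conj g • D ↔ g⁻¹ * x * g ∈ D := by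
  rw [Subgroup.mem_pointwise_smul_iff_inv_smul_mem, ← map_inv, MulAut.smul_def,
    MulAut.conj_apply, inv_inv]

theorem conj_smul_mem_conj_smul {g x : Γ} {D : Subgroup Γ} (hx : x ∈ D) :
    g * x * g⁻¹ ∈ MulAut.conj g • D := by
  rw [mem_conj_smul]
  convert hx using 1
  group

theorem conj_smul_smul (g h : Γ) (D : Subgroup Γ) :
    MulAut.conj g • MulAut.conj h • D = MulAut.conj (g * h) • D := by
  rw [smul_smul, map_mul]

theorem conj_one_smul (D : Subgroup Γ) : MulAut.conj (1 : Γ) • D = D := by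
  rw [map_one, one_smul]

theorem conj_smul_mono {D E : Subgroup Γ} (g : Γ) (h : D ≤ E) :
    MulAut.conj g • D ≤ MulAut.conj g • E :=
  Subgroup.pointwise_smul_le_pointwise_smul_iff.2 h

theorem card_conj_smul (g : Γ) (D : Subgroup Γ) :
    Nat.card (MulAut.conj g • D : Subgroup Γ) = Nat.card D :=
  (Nat.card_congr (Subgroup.equivSMul (MulAut.conj g) D).toEquiv).symm

theorem Subgroup.eq_of_le_of_card_le [Finite Γ] {D E : Subgroup Γ} (h : D ≤ E)
    (hc : Nat.card E ≤ Nat.card D) : D = E :=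
  SetLike.coe_injective (Set.eq_of_subset_of_ncard_le h
    (by rw [← Nat.card_coe_set_eq, ← Nat.card_coe_set_eq]; exact hc) (Set.toFinite _))

theorem Subgroup.card_lt_of_lt [Finite Γ] {D E : Subgroup Γ} (h : D < E) :
    Nat.card D < Nat.card E :=
  lt_of_not_ge fun hc => h.ne (Subgroup.eq_of_le_of_card_le h.le hc)

theorem conj_smul_eq_of_mem_normalizer {g : Γ} {D : Subgroup Γ}
    (hg : g ∈ Subgroup.normalizer (D : Set Γ)) : MulAut.conj g • D = D := by
  ext x
  rw [mem_conj_smul]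
  have := Subgroup.mem_normalizer_iff.1 (inv_mem hg) x
  rw [inv_inv] at this
  exact this.symm

theorem mem_normalizer_of_conj_smul_eq {g : Γ} {D : Subgroup Γ}
    (hg : MulAut.conj g • D = D) : g ∈ Subgroup.normalizer (D : Set Γ) := by
  rw [Subgroup.mem_normalizer_iff]
  intro x
  conv_rhs => rw [← hg, mem_conj_smul]
  exact iff_of_eq (congrArg (· ∈ D) (by group))

/-- In a finite group the inclusion of a conjugate of `D` in `D` is an equality by counting, so only
one direction has to be checked. -/
theorem mem_normalizer_of_forall [Finite Γ] {g : Γ} {D : Subgroup Γ}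
    (hg : ∀ d ∈ D, g * d * g⁻¹ ∈ D) : g ∈ Subgroup.normalizer (D : Set Γ) := by
  apply mem_normalizer_of_conj_smul_eq
  refine Subgroup.eq_of_le_of_card_le ?_ (card_conj_smul g D).ge
  intro x hx
  have := hg _ (mem_conj_smul.1 hx)
  convert this using 1
  group

theorem conj_mem_of_mem_normalizer {g d : Γ} {D : Subgroup Γ}
    (hg : g ∈ Subgroup.normalizer (D : Set Γ)) (hd : d ∈ D) : g * d * g⁻¹ ∈ D :=
  (Subgroup.mem_normalizer_iff.1 hg d).1 hd

/-- A finite p-group is nilpotent, so normalizers of proper subgroups grow. This drives all the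
inductions on graphs below. -/
theorem IsPGroup.exists_mem_normalizer [Finite Γ] {p : ℕ} [Fact p.Prime] {E D : Subgroup Γ}
    (hE : IsPGroup p E) (h : D < E) :
    ∃ g ∈ E, g ∉ D ∧ g ∈ Subgroup.normalizer (D : Set Γ) := by
  have := hE.isNilpotent
  have hlt : D.subgroupOf E < ⊤ := by
    rw [lt_top_iff_ne_top]
    intro he
    exact h.not_ge (Subgroup.subgroupOf_eq_top.1 he)
  have := Group.normalizerCondition_of_isNilpotent (G := E) _ hlt
  obtain ⟨g, hg, hg'⟩ := SetLike.exists_of_lt this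
  refine ⟨g, g.2, fun hd => hg' (Subgroup.mem_subgroupOf.2 hd), mem_normalizer_of_forall ?_⟩
  intro d hd
  have := conj_mem_of_mem_normalizer hg (d := ⟨d, h.le hd⟩) (Subgroup.mem_subgroupOf.2 hd)
  exact Subgroup.mem_subgroupOf.1 this

/-- A `p`-subgroup which contains all the `p`-elements normalizing it contains, up to conjugation,
all `p`-subgroups. -/
theorem IsPGroup.exists_conj_le [Finite Γ] {p : ℕ} [Fact p.Prime] {B P : Subgroup Γ}
    (hB : IsPGroup p B) (hP : IsPGroup p P)
    (h : ∀ g ∈ Subgroup.normalizer (B : Set Γ), (∃ n : ℕ, g ^ p ^ n = 1) → g ∈ B) :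
    ∃ a : Γ, ∀ g ∈ P, a * g * a⁻¹ ∈ B := by
  obtain ⟨Q, hQ⟩ := hB.exists_le_sylow
  -- If `B` were proper in the Sylow subgroup `Q`, normalizers in `Q` would grow and give a
  -- p-element that normalizes `B` without lying in it.
  have hBQ : B = Q := by
    by_contra hne
    obtain ⟨g, hg, hg', hn⟩ := Q.isPGroup'.exists_mem_normalizer (lt_of_le_of_ne hQ hne)
    obtain ⟨n, e⟩ := Q.isPGroup' ⟨g, hg⟩
    exact hg' (h g hn ⟨n, congrArg Subtype.val e⟩)
  obtain ⟨Q', hQ'⟩ := hP.exists_le_sylow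
  obtain ⟨a, ha⟩ := MulAction.exists_smul_eq Γ Q' Q
  refine ⟨a, fun g hg => ?_⟩
  rw [hBQ, ← ha]
  exact conj_smul_mem_conj_smul (hQ' hg)

/-- The part of `p`-power order of an automorphism: if `x ^ m` is taken with suitable `m`, then
`x ^ m` is a `p`-element and `m` acts trivially as an exponent on elements of order `p ^ n`. -/
theorem exists_pPart [Finite Γ] {p : ℕ} [hp : Fact p.Prime] (x : Γ) (n : ℕ) :
    ∃ m : ℕ, (∃ k : ℕ, (x ^ m) ^ p ^ k = 1) ∧ m ≡ 1 [MOD p ^ n] := by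
  obtain ⟨k, c, hc, e⟩ := Nat.exists_eq_pow_mul_and_not_dvd (n := orderOf x)
    (orderOf_pos x).ne' p hp.out.ne_one
  have hcop : Nat.Coprime c (p ^ n) :=
    (((Nat.Prime.coprime_iff_not_dvd hp.out).2 hc).symm).pow_right n
  -- `c` is the part of the order of `x` prime to p: `m` is a multiple of `c`, which leaves a
  -- p-element, and is 1 modulo `p ^ n`.
  obtain ⟨m, h0, h1⟩ := Nat.chineseRemainder hcop 0 1
  refine ⟨m, ⟨k, ?_⟩, h1⟩
  rw [← pow_mul]
  apply orderOf_dvd_iff_pow_eq_one.1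
  rw [e, mul_comm]
  exact Nat.mul_dvd_mul ((Nat.modEq_zero_iff_dvd).1 h0) dvd_rfl

end Groups

/-! ### Graphs of morphisms -/

namespace FusionSystem

variable {T : Type u} [Group T]

/-- The graph `{(x, φ(x))}` of a homomorphism between subgroups of `T`. -/
def gr {P Q : Subgroup T} (φ : P →* Q) : Subgroup (T × T) :=
  (P.subtype.prod (Q.subtype.comp φ)).range

/-- The first projection of a subgroup of `T × T`. -/
def p1 (D : Subgroup (T × T)) : Subgroup T := D.map (MonoidHom.fst T T)

/-- The second projection of a subgroup of `T × T`. -/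
def p2 (D : Subgroup (T × T)) : Subgroup T := D.map (MonoidHom.snd T T)

/-- The opposite `{(b, a) | (a, b) ∈ D}` of a relation. -/
def swap (D : Subgroup (T × T)) : Subgroup (T × T) where
  carrier := {d | (d.2, d.1) ∈ D}
  one_mem' := one_mem D
  mul_mem' := fun ha hb => D.mul_mem ha hb
  inv_mem' := fun ha => D.inv_mem ha

/-- The composition `{(a, c) | ∃ b, (a, b) ∈ D ∧ (b, c) ∈ E}` of relations. -/
def relComp (D E : Subgroup (T × T)) : Subgroup (T × T) where
  carrier := {d | ∃ b, (d.1, b) ∈ D ∧ (b, d.2) ∈ E}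
  one_mem' := ⟨1, one_mem D, one_mem E⟩
  mul_mem' := by
    rintro a a' ⟨b, h, k⟩ ⟨b', h', k'⟩
    exact ⟨b * b', mul_mem h h', mul_mem k k'⟩
  inv_mem' := by
    rintro a ⟨b, h, k⟩
    exact ⟨b⁻¹, inv_mem h, inv_mem k⟩

/-- The diagonal of `A`. -/
def diag (A : Subgroup T) : Subgroup (T × T) := gr (MonoidHom.id A)

theorem mem_gr {P Q : Subgroup T} {φ : P →* Q} {d : T × T} :
    d ∈ gr φ ↔ ∃ x : P, (x : T) = d.1 ∧ (φ x : T) = d.2 := by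
  constructor
  · rintro ⟨x, rfl⟩
    exact ⟨x, rfl, rfl⟩
  · rintro ⟨x, h1, h2⟩
    exact ⟨x, Prod.ext h1 h2⟩

theorem mem_p1 {D : Subgroup (T × T)} {a : T} : a ∈ p1 D ↔ ∃ b, (a, b) ∈ D := by
  constructor
  · rintro ⟨⟨x, y⟩, h, rfl⟩
    exact ⟨y, h⟩
  · rintro ⟨b, h⟩
    exact ⟨_, h, rfl⟩

theorem mem_p2 {D : Subgroup (T × T)} {b : T} : b ∈ p2 D ↔ ∃ a, (a, b) ∈ D := by
  constructor
  · rintro ⟨⟨x, y⟩, h, rfl⟩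
    exact ⟨x, h⟩
  · rintro ⟨a, h⟩
    exact ⟨_, h, rfl⟩

theorem mem_swap {D : Subgroup (T × T)} {d : T × T} : d ∈ swap D ↔ (d.2, d.1) ∈ D := Iff.rfl

theorem mem_relComp {D E : Subgroup (T × T)} {d : T × T} :
    d ∈ relComp D E ↔ ∃ b, (d.1, b) ∈ D ∧ (b, d.2) ∈ E := Iff.rfl

theorem mem_diag {A : Subgroup T} {d : T × T} : d ∈ diag A ↔ d.1 ∈ A ∧ d.1 = d.2 := by
  rw [diag, mem_gr]
  constructor
  · rintro ⟨x, h, h'⟩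
    exact ⟨h ▸ x.2, h.symm.trans h'⟩
  · rintro ⟨h, h'⟩
    exact ⟨⟨_, h⟩, rfl, h'⟩

theorem fst_mem_p1 {D : Subgroup (T × T)} {d : T × T} (h : d ∈ D) : d.1 ∈ p1 D :=
  mem_p1.2 ⟨d.2, h⟩

theorem snd_mem_p2 {D : Subgroup (T × T)} {d : T × T} (h : d ∈ D) : d.2 ∈ p2 D :=
  mem_p2.2 ⟨d.1, h⟩

theorem p1_mono {D E : Subgroup (T × T)} (h : D ≤ E) : p1 D ≤ p1 E := Subgroup.map_mono h

theorem p2_mono {D E : Subgroup (T × T)} (h : D ≤ E) : p2 D ≤ p2 E := Subgroup.map_mono h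

theorem p1_swap (D : Subgroup (T × T)) : p1 (swap D) = p2 D := by
  ext x
  simp only [mem_p1, mem_p2, mem_swap]

theorem p2_swap (D : Subgroup (T × T)) : p2 (swap D) = p1 D := by
  ext x
  simp only [mem_p1, mem_p2, mem_swap]

theorem p1_diag (A : Subgroup T) : p1 (diag A) = A := by
  ext x
  simp [mem_p1, mem_diag]

theorem p2_diag (A : Subgroup T) : p2 (diag A) = A := by
  ext x
  rw [mem_p2]
  constructor
  · rintro ⟨a, h⟩
    obtain ⟨h1, h2⟩ := mem_diag.1 h
    have h2 : a = x := h2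
    exact h2 ▸ h1
  · exact fun h => ⟨x, mem_diag.2 ⟨h, rfl⟩⟩

theorem p1_gr {P Q : Subgroup T} (φ : P →* Q) : p1 (gr φ) = P := by
  ext x
  rw [mem_p1]
  constructor
  · rintro ⟨b, h⟩
    obtain ⟨y, rfl, -⟩ := mem_gr.1 h
    exact y.2
  · exact fun h => ⟨_, mem_gr.2 ⟨⟨x, h⟩, rfl, rfl⟩⟩

theorem p2_gr {P Q : Subgroup T} (φ : P →* Q) : p2 (gr φ) = image φ := by
  ext x
  rw [mem_p2]
  constructor
  · rintro ⟨b, h⟩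
    obtain ⟨y, -, h⟩ := mem_gr.1 h
    exact ⟨φ y, ⟨y, rfl⟩, h⟩
  · rintro ⟨_, ⟨y, rfl⟩, rfl⟩
    exact ⟨y, mem_gr.2 ⟨y, rfl, rfl⟩⟩

theorem p2_gr_equiv {P Q : Subgroup T} (φ : P ≃* Q) : p2 (gr φ.toMonoidHom) = Q := by
  ext x
  rw [mem_p2]
  constructor
  · rintro ⟨b, h⟩
    obtain ⟨y, -, rfl⟩ := mem_gr.1 h
    exact (φ y).2
  · exact fun h => ⟨_, mem_gr.2 ⟨φ.symm ⟨x, h⟩, rfl, by simp⟩⟩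

theorem gr_imageIso {P Q : Subgroup T} (φ : P →* Q) (h : Function.Injective φ) :
    gr (imageIso φ h).toMonoidHom = gr φ := by
  ext d
  rw [mem_gr, mem_gr]
  rfl

theorem p1_conj_smul (g : T × T) (D : Subgroup (T × T)) :
    p1 (MulAut.conj g • D) = MulAut.conj g.1 • p1 D := by
  ext x
  rw [mem_p1, mem_conj_smul, mem_p1]
  constructor
  · rintro ⟨b, h⟩
    exact ⟨_, mem_conj_smul.1 h⟩
  · rintro ⟨b, h⟩
    refine ⟨g.2 * b * g.2⁻¹, mem_conj_smul.2 ?_⟩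
    convert h using 1
    exact Prod.ext rfl (by simp only [Prod.snd_mul, Prod.snd_inv]; group)

theorem p2_conj_smul (g : T × T) (D : Subgroup (T × T)) :
    p2 (MulAut.conj g • D) = MulAut.conj g.2 • p2 D := by
  ext x
  rw [mem_p2, mem_conj_smul, mem_p2]
  constructor
  · rintro ⟨b, h⟩
    exact ⟨_, mem_conj_smul.1 h⟩
  · rintro ⟨b, h⟩
    refine ⟨g.1 * b * g.1⁻¹, mem_conj_smul.2 ?_⟩
    convert h using 1
    exact Prod.ext (by simp only [Prod.fst_mul, Prod.fst_inv]; group) rfl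

variable (F : FusionSystem T)

/-- `D` is the graph of a morphism in `F`. -/
def IsGr (D : Subgroup (T × T)) : Prop :=
  ∃ (P Q : Subgroup T) (φ : P →* Q), φ ∈ F.Hom P Q ∧ D = gr φ

variable {F} {D E : Subgroup (T × T)}

theorem isGr_gr {P Q : Subgroup T} {φ : P →* Q} (h : φ ∈ F.Hom P Q) : F.IsGr (gr φ) :=
  ⟨P, Q, φ, h, rfl⟩

/-- A graph is the graph of an isomorphism between its projections. -/
theorem IsGr.exists_iso (h : F.IsGr D) :
    ∃ φ : p1 D ≃* p2 D, F.IsIso φ ∧ D = gr φ.toMonoidHom := by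
  obtain ⟨P, Q, φ, hφ, rfl⟩ := h
  have key : ∀ P' Q' : Subgroup T, P = P' → image φ = Q' →
      ∃ ψ : P' ≃* Q', F.IsIso ψ ∧ gr φ = gr ψ.toMonoidHom := by
    rintro _ _ rfl rfl
    exact ⟨_, isIso_imageIso hφ, (gr_imageIso _ _).symm⟩
  exact key _ _ (p1_gr φ).symm (p2_gr φ).symm

theorem IsGr.exists_iso' {P Q : Subgroup T} (h : F.IsGr D) (hP : p1 D = P) (hQ : p2 D = Q) :
    ∃ φ : P ≃* Q, F.IsIso φ ∧ D = gr φ.toMonoidHom := by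
  subst hP hQ
  exact h.exists_iso

theorem IsGr.p1_le (h : F.IsGr D) : p1 D ≤ F.S := by
  obtain ⟨φ, hφ, -⟩ := h.exists_iso
  exact (F.le_of_mem hφ).1

theorem IsGr.p2_le (h : F.IsGr D) : p2 D ≤ F.S := by
  obtain ⟨φ, hφ, -⟩ := h.exists_iso
  exact (F.le_of_mem hφ).2

theorem IsGr.conj (h : F.IsGr D) : F.Conj (p1 D) (p2 D) := by
  obtain ⟨φ, hφ, -⟩ := h.exists_iso
  exact ⟨φ, hφ⟩

theorem IsGr.snd_eq (h : F.IsGr D) {a b b' : T} (h1 : (a, b) ∈ D) (h2 : (a, b') ∈ D) :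
    b = b' := by
  obtain ⟨P, Q, φ, hφ, rfl⟩ := h
  obtain ⟨x, h, h'⟩ := mem_gr.1 h1
  obtain ⟨y, k, k'⟩ := mem_gr.1 h2
  have : x = y := Subtype.ext (h.trans k.symm)
  subst this
  exact h'.symm.trans k'

theorem IsGr.fst_eq (h : F.IsGr D) {a a' b : T} (h1 : (a, b) ∈ D) (h2 : (a', b) ∈ D) :
    a = a' := by
  obtain ⟨P, Q, φ, hφ, rfl⟩ := h
  obtain ⟨x, h, h'⟩ := mem_gr.1 h1
  obtain ⟨y, k, k'⟩ := mem_gr.1 h2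
  have : x = y := F.injective_of_mem hφ (Subtype.ext (h'.trans k'.symm))
  subst this
  exact h.symm.trans k

/-- A subgroup of a graph is the graph of the restriction to its first projection. Restrictions can
thus be cut out by intersecting with a preimage under a projection. -/
theorem IsGr.mono (h : F.IsGr E) (hD : D ≤ E) : F.IsGr D := by
  obtain ⟨P, Q, φ, hφ, rfl⟩ := h
  have hP : p1 D ≤ P := (p1_mono hD).trans (p1_gr φ).le
  refine ⟨p1 D, Q, φ.comp (Subgroup.inclusion hP), F.comp_mem (F.conj_mem (s := 1)
    (hP.trans (F.le_of_mem hφ).1) (F.le_of_mem hφ).1 (one_mem _) fun x => by simp) hφ, ?_⟩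
  ext d
  rw [mem_gr]
  constructor
  · intro hd
    obtain ⟨x, h1, h2⟩ := mem_gr.1 (hD hd)
    refine ⟨⟨d.1, fst_mem_p1 hd⟩, rfl, ?_⟩
    rw [← h2]
    exact congrArg (fun z => (φ z : T)) (Subtype.ext h1.symm)
  · rintro ⟨⟨x, hx⟩, h1, h2⟩
    obtain ⟨b, hb⟩ := mem_p1.1 hx
    obtain ⟨y, k1, k2⟩ := mem_gr.1 (hD hb)
    have e : d = (x, b) := by
      refine Prod.ext h1.symm (h2.symm.trans (Eq.trans ?_ k2))
      exact congrArg (fun z => (φ z : T)) (Subtype.ext k1.symm)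
    rwa [e]

theorem IsGr.swap (h : F.IsGr D) : F.IsGr (swap D) := by
  obtain ⟨φ, hφ, e⟩ := h.exists_iso
  refine ⟨_, _, φ.symm.toMonoidHom, isIso_symm hφ, ?_⟩
  ext d
  rw [mem_swap, mem_gr]
  conv_lhs => rw [e, mem_gr]
  constructor
  · rintro ⟨x, h1, h2⟩
    exact ⟨φ x, h2, by simpa using h1⟩
  · rintro ⟨x, h1, h2⟩
    exact ⟨φ.symm x, h2, by simpa using h1⟩

theorem IsGr.relComp (hD : F.IsGr D) (hE : F.IsGr E) : F.IsGr (relComp D E) := by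
  -- The composite is only defined at the points that `D` sends into the source of `E`, so `D` is
  -- first cut down to these.
  obtain ⟨P, Q, φ, hφ, hP⟩ := hD.mono (D := D ⊓ Subgroup.comap (MonoidHom.snd T T) (p1 E)) inf_le_left
  obtain ⟨ψ, hψ, hE'⟩ := hE.exists_iso
  have hQ : image φ ≤ p1 E := by
    rintro _ ⟨_, ⟨x, rfl⟩, rfl⟩
    have : ((x : T), (φ x : T)) ∈ gr φ := mem_gr.2 ⟨x, rfl, rfl⟩
    rw [← hP] at this
    exact this.2
  refine ⟨_, _, ((ψ.toMonoidHom.comp (Subgroup.inclusion hQ)).comp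
    (imageIso φ (F.injective_of_mem hφ)).toMonoidHom), F.comp_mem (isIso_imageIso hφ)
      (F.comp_mem (F.conj_mem (s := 1) (hQ.trans hE.p1_le) hE.p1_le (one_mem _) fun x => by simp)
        hψ), ?_⟩
  ext d
  rw [mem_gr, mem_relComp]
  constructor
  · rintro ⟨b, h1, h2⟩
    have : (d.1, b) ∈ D ⊓ Subgroup.comap (MonoidHom.snd T T) (p1 E) := ⟨h1, fst_mem_p1 h2⟩
    rw [hP] at this
    obtain ⟨x, k1, k2⟩ := mem_gr.1 this
    rw [hE'] at h2
    obtain ⟨y, l1, l2⟩ := mem_gr.1 h2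
    refine ⟨x, k1, ?_⟩
    rw [← l2]
    exact congrArg (fun z => (ψ z : T)) (Subtype.ext (k2.trans l1.symm))
  · rintro ⟨x, k1, k2⟩
    have : (d.1, (φ x : T)) ∈ D ⊓ Subgroup.comap (MonoidHom.snd T T) (p1 E) := by
      rw [hP]
      exact mem_gr.2 ⟨x, k1, rfl⟩
    refine ⟨φ x, this.1, ?_⟩
    rw [hE']
    exact mem_gr.2 ⟨⟨φ x, this.2⟩, rfl, k2⟩

theorem isGr_diag {A : Subgroup T} (h : A ≤ F.S) : F.IsGr (diag A) :=
  isGr_gr (isIso_refl h)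

/-- The graph of conjugation by `x` on `A`. -/
def conjGr (x : T) (A : Subgroup T) : Subgroup (T × T) := gr (conjIso x A).toMonoidHom

theorem mem_conjGr {x : T} {A : Subgroup T} {d : T × T} :
    d ∈ conjGr x A ↔ d.1 ∈ A ∧ d.2 = x * d.1 * x⁻¹ := by
  rw [conjGr, mem_gr]
  constructor
  · rintro ⟨y, h1, h2⟩
    exact ⟨h1 ▸ y.2, by rw [← h2, ← h1]; rfl⟩
  · rintro ⟨h1, h2⟩
    exact ⟨⟨_, h1⟩, rfl, h2.symm⟩

theorem isGr_conjGr {x : T} {A : Subgroup T} (hx : x ∈ F.S) (hA : A ≤ F.S) :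
    F.IsGr (conjGr x A) :=
  isGr_gr (isIso_conjIso hx hA)

theorem p1_conjGr (x : T) (A : Subgroup T) : p1 (conjGr x A) = A := p1_gr _

theorem p2_conjGr (x : T) (A : Subgroup T) : p2 (conjGr x A) = MulAut.conj x • A :=
  p2_gr_equiv _

/-- Conjugating by a pair amounts to composing with conjugation maps on both sides, so the conjugate
of a graph by elements of S is a graph. -/
theorem conj_smul_eq_relComp (g : T × T) (D : Subgroup (T × T)) :
    MulAut.conj g • D =
      relComp (relComp (swap (conjGr g.1 (p1 D))) D) (conjGr g.2 (p2 D)) := by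
  ext d
  simp only [mem_conj_smul, mem_relComp, mem_swap, mem_conjGr]
  constructor
  · intro h
    refine ⟨(g⁻¹ * d * g).2, ⟨(g⁻¹ * d * g).1, ⟨fst_mem_p1 h, ?_⟩, h⟩, snd_mem_p2 h, ?_⟩ <;>
    simp only [Prod.fst_mul, Prod.fst_inv, Prod.snd_mul, Prod.snd_inv] <;> group
  · rintro ⟨b, ⟨c, ⟨-, e⟩, h⟩, -, e'⟩
    convert h using 1
    refine Prod.ext ?_ ?_
    · simp only [Prod.fst_mul, Prod.fst_inv, e]; group
    · simp only [Prod.snd_mul, Prod.snd_inv, e']; group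

theorem IsGr.conj_smul (h : F.IsGr D) {g : T × T} (h1 : g.1 ∈ F.S) (h2 : g.2 ∈ F.S) :
    F.IsGr (MulAut.conj g • D) := by
  rw [conj_smul_eq_relComp]
  exact ((isGr_conjGr h1 h.p1_le).swap.relComp h).relComp (isGr_conjGr h2 h.p2_le)

/-- Inside a fixed graph, a subgroup is determined by its first projection. -/
theorem IsGr.eq_of_le (h : F.IsGr E) (hD : D ≤ E) (h1 : p1 E ≤ p1 D) : D = E := by
  refine le_antisymm hD fun d hd => ?_
  obtain ⟨b, hb⟩ := mem_p1.1 (h1 (fst_mem_p1 hd))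
  have := h.snd_eq (hD hb) (show (d.1, d.2) ∈ E from hd)
  rw [this] at hb
  exact hb

theorem IsGr.card_p1 (h : F.IsGr D) : Nat.card (p1 D) = Nat.card D := by
  symm
  refine Nat.card_congr (Equiv.ofBijective (fun d : D => (⟨d.1.1, fst_mem_p1 d.2⟩ : p1 D)) ⟨?_, ?_⟩)
  · rintro ⟨⟨a, b⟩, hd⟩ ⟨⟨a', b'⟩, hd'⟩ e
    have : a = a' := congrArg Subtype.val e
    subst this
    exact Subtype.ext (Prod.ext rfl (h.snd_eq hd hd'))
  · rintro ⟨a, ha⟩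
    obtain ⟨b, hb⟩ := mem_p1.1 ha
    exact ⟨⟨_, hb⟩, rfl⟩

theorem IsGr.card_p2 (h : F.IsGr D) : Nat.card (p2 D) = Nat.card D := by
  obtain ⟨φ, -, -⟩ := h.exists_iso
  rw [← h.card_p1]
  exact (Nat.card_congr φ.toEquiv).symm

/-- An element of a graph normalizes a smaller graph as soon as its first component normalizes the
first projection. -/
theorem IsGr.mem_normalizer [Finite T] (h : F.IsGr E) (hD : D ≤ E) {g : T × T} (hg : g ∈ E)
    (h1 : g.1 ∈ Subgroup.normalizer (p1 D : Set T)) :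
    g ∈ Subgroup.normalizer (D : Set (T × T)) := by
  refine mem_normalizer_of_forall fun d hd => ?_
  have h2 : g * d * g⁻¹ ∈ E := mul_mem (mul_mem hg (hD hd)) (inv_mem hg)
  obtain ⟨b, hb⟩ := mem_p1.1 (conj_mem_of_mem_normalizer h1 (fst_mem_p1 hd))
  have := h.snd_eq (hD hb) (show ((g.1 * d.1 * g.1⁻¹), (g * d * g⁻¹).2) ∈ E from h2)
  rw [this] at hb
  exact hb

theorem fst_mem_normalizer [Finite T] {g : T × T}
    (hg : g ∈ Subgroup.normalizer (D : Set (T × T))) :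
    g.1 ∈ Subgroup.normalizer (p1 D : Set T) := by
  refine mem_normalizer_of_forall fun a ha => ?_
  obtain ⟨b, hb⟩ := mem_p1.1 ha
  exact fst_mem_p1 (conj_mem_of_mem_normalizer hg hb)

theorem snd_mem_normalizer [Finite T] {g : T × T}
    (hg : g ∈ Subgroup.normalizer (D : Set (T × T))) :
    g.2 ∈ Subgroup.normalizer (p2 D : Set T) := by
  refine mem_normalizer_of_forall fun a ha => ?_
  obtain ⟨b, hb⟩ := mem_p2.1 ha
  exact snd_mem_p2 (conj_mem_of_mem_normalizer hg hb)

/-! ### Centric subgroups -/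

theorem Conj.trans {P Q W : Subgroup T} (h : F.Conj P Q) (h' : F.Conj Q W) : F.Conj P W :=
  ⟨_, isIso_trans h.choose_spec h'.choose_spec⟩

theorem Conj.le {P Q : Subgroup T} (h : F.Conj P Q) : Q ≤ F.S :=
  (F.le_of_mem h.choose_spec).2

theorem conj_refl {P : Subgroup T} (h : P ≤ F.S) : F.Conj P P := ⟨_, isIso_refl h⟩

theorem IsCentric.of_conj {P Q : Subgroup T} (hP : F.IsCentric P) (h : F.Conj P Q) :
    F.IsCentric Q :=
  ⟨h.le, fun W hW => hP.2 W (h.trans hW)⟩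

/-- The form in which centricity enters the extension arguments: two elements of S inducing the same
map on a centric subgroup differ by an element of it. -/
theorem IsCentric.mem {P : Subgroup T} (hP : F.IsCentric P) {z : T} (hz : z ∈ F.S)
    (h : ∀ x ∈ P, z * x * z⁻¹ = x) : z ∈ P := by
  refine hP.2 P (conj_refl hP.1) ⟨hz, ?_⟩
  refine Subgroup.mem_centralizer_iff.2 fun x hx => ?_
  exact (mul_inv_eq_iff_eq_mul.1 (h x hx)).symm

theorem IsGr.image_mem {P Q : Subgroup T} {φ : P →* Q} {P' : Subgroup T} (hφ : φ ∈ F.Hom P Q)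
    (h : P' ≤ P) : ∃ D, F.IsGr D ∧ p1 D = P' ∧ D ≤ gr φ := by
  refine ⟨gr φ ⊓ Subgroup.comap (MonoidHom.fst T T) P', (isGr_gr hφ).mono inf_le_left, ?_,
    inf_le_left⟩
  ext x
  rw [mem_p1]
  constructor
  · rintro ⟨b, -, h⟩
    exact h
  · intro hx
    exact ⟨_, mem_gr.2 ⟨⟨x, h hx⟩, rfl, rfl⟩, hx⟩

/-- If `W` is isomorphic to `Q`, the image of `P` in `W` is centric. An element centralizing `W`
centralizes this image, so it lies in it and hence in `W`. -/
theorem IsCentric.mono {P Q : Subgroup T} (hP : F.IsCentric P) (h : P ≤ Q) (hQ : Q ≤ F.S) :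
    F.IsCentric Q := by
  refine ⟨hQ, fun W ⟨φ, hφ⟩ => ?_⟩
  obtain ⟨D, hD, h1, h2⟩ := IsGr.image_mem hφ h
  have hW : p2 D ≤ W := (p2_mono h2).trans (p2_gr_equiv φ).le
  rw [← h1] at hP
  rintro x ⟨hx, hx'⟩
  refine hW ((hP.of_conj hD.conj).mem hx fun y hy => ?_)
  rw [mul_inv_eq_iff_eq_mul]
  exact (Subgroup.mem_centralizer_iff.1 hx' y (hW hy)).symm

/-- `G` has more conjugates of `P`, and their centralizers are taken in a larger group, so the
condition for `G` is the stronger one. -/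
theorem IsCentric.of_le {G : FusionSystem T} (h : F ≤ G) {P : Subgroup T} (hP : P ≤ F.S)
    (hG : G.IsCentric P) : F.IsCentric P :=
  ⟨hP, fun W ⟨φ, hφ⟩ => (inf_le_inf_right _ (S_le_of_le h)).trans (hG.2 W ⟨φ, h _ _ hφ⟩)⟩

end FusionSystem

/-! ### Saturated fusion systems -/

namespace FusionSystem

variable {T : Type u} [Group T] {F : FusionSystem T}

/-- `Aut_F(Q)` -/
def autF (F : FusionSystem T) {Q : Subgroup T} (hQ : Q ≤ F.S) : Subgroup (MulAut Q) where
  carrier := {φ | F.IsIso φ}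
  one_mem' := isIso_refl hQ
  mul_mem' := fun {a b} ha hb => F.comp_mem (φ := b.toMonoidHom) (ψ := a.toMonoidHom) hb ha
  inv_mem' := fun {a} ha => (F.iso_mem ha Q a (fun _ => rfl)).2

/-- `Aut_S(Q)` -/
def autIn (F : FusionSystem T) (Q : Subgroup T) : Subgroup (MulAut Q) where
  carrier := {φ | ∃ g ∈ F.S, ∀ x : Q, (φ x : T) = g * x * g⁻¹}
  one_mem' := ⟨1, one_mem _, fun x => by simp⟩
  mul_mem' := by
    rintro a b ⟨g, hg, h⟩ ⟨k, hk, h'⟩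
    refine ⟨g * k, mul_mem hg hk, fun x => ?_⟩
    rw [MulAut.mul_apply, h, h']
    group
  inv_mem' := by
    rintro a ⟨g, hg, h⟩
    refine ⟨g⁻¹, inv_mem hg, fun x => ?_⟩
    have := h (a⁻¹ x)
    rw [MulAut.apply_inv_self] at this
    rw [this]
    group

theorem autIn_le {Q : Subgroup T} (hQ : Q ≤ F.S) : F.autIn Q ≤ F.autF hQ := by
  rintro φ ⟨g, hg, h⟩
  exact F.conj_mem hQ hQ hg h

theorem exists_mem_autIn {Q : Subgroup T} {y : T} (hy : y ∈ F.S)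
    (h : y ∈ Subgroup.normalizer (Q : Set T)) :
    ∃ β ∈ F.autIn Q, ∀ x : Q, (β x : T) = y * x * y⁻¹ :=
  ⟨(conjIso y Q).trans (MulEquiv.subgroupCongr (conj_smul_eq_of_mem_normalizer h)),
    ⟨y, hy, fun _ => rfl⟩, fun _ => rfl⟩

theorem isPGroup_autIn {p : ℕ} (hT : IsPGroup p T) (Q : Subgroup T) :
    IsPGroup p (F.autIn Q) := by
  rintro ⟨φ, g, hg, h⟩
  obtain ⟨k, hk⟩ := hT g
  have key : ∀ (n : ℕ) (x : Q), ((φ ^ n) x : T) = g ^ n * x * (g ^ n)⁻¹ := by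
    intro n
    induction n with
    | zero => intro x; simp
    | succ n ih =>
      intro x
      rw [pow_succ, MulAut.mul_apply, ih, h, pow_succ]
      group
  refine ⟨k, Subtype.ext (MulEquiv.ext fun x => Subtype.ext ?_)⟩
  change ((φ ^ p ^ k) x : T) = x
  rw [key, hk]
  simp

theorem exists_fullyNormalized [Finite T] {P : Subgroup T} (hP : P ≤ F.S) :
    ∃ N, F.Conj P N ∧ F.FullyNormalized N := by
  have : Nonempty {N // F.Conj P N} := ⟨⟨P, conj_refl hP⟩⟩
  obtain ⟨⟨N, hN⟩, h⟩ := Finite.exists_max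
    (fun N : {N // F.Conj P N} => Nat.card (F.normalizerIn N.1))
  exact ⟨N, hN, hN.le, fun Q hQ => h ⟨Q, hN.trans hQ⟩⟩

/-- The extension axiom in terms of graphs. -/
theorem IsSaturated.extend [Finite T] {p : ℕ} (hF : F.IsSaturated p) {D : Subgroup (T × T)}
    (hD : F.IsGr D) (hn : F.FullyNormalized (p2 D)) :
    ∃ E, F.IsGr E ∧ D ≤ E ∧ ∀ g ∈ Subgroup.normalizer (D : Set (T × T)),
      g.1 ∈ F.S → g.2 ∈ F.S → g.1 ∈ p1 E := by
  obtain ⟨P, Q, φ, hφ, rfl⟩ := hD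
  have hQ := (F.le_of_mem hφ).2
  have hP := (F.le_of_mem hφ).1
  let φ' : P →* F.S := (Subgroup.inclusion hQ).comp φ
  have hφ' : φ' ∈ F.Hom P F.S :=
    F.comp_mem hφ (F.conj_mem (s := 1) hQ le_rfl (one_mem _) fun x => by simp)
  have hgr : gr φ' = gr φ := by
    ext d
    rw [mem_gr, mem_gr]
    rfl
  rw [← hgr] at hn ⊢
  have him : image φ' = p2 (gr φ') := (p2_gr φ').symm
  obtain ⟨ψ, hψ, e⟩ := hF.2 P φ' hφ' (him ▸ hn)
  -- A pair `g` that normalizes the graph gives an element `g.1` of the φ-normalizer, with `g.2` as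
  -- the witness required there.
  have key : ∀ g ∈ Subgroup.normalizer (gr φ' : Set (T × T)), g.1 ∈ F.S → g.2 ∈ F.S →
      g.1 ∈ F.phiNormalizer φ' := by
    intro g hg h1 h2
    have hg1 := fst_mem_normalizer hg
    have hg2 := snd_mem_normalizer hg
    rw [p1_gr] at hg1
    rw [p2_gr] at hg2
    refine ⟨⟨h1, hg1⟩, g.2, ⟨h2, hg2⟩, fun y y' hy => ?_⟩
    have : g * ((y : T), (φ' y : T)) * g⁻¹ ∈ gr φ' :=
      conj_mem_of_mem_normalizer hg (mem_gr.2 ⟨y, rfl, rfl⟩)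
    obtain ⟨x, k1, k2⟩ := mem_gr.1 this
    have : x = y' := Subtype.ext (k1.trans hy.symm)
    subst this
    exact k2
  refine ⟨gr ψ, isGr_gr hψ, fun d hd => ?_, fun g hg h1 h2 => ?_⟩
  -- A graph normalizes itself, so its source lies in the φ-normalizer and the extension really
  -- contains the graph.
  · have hn := key d (Subgroup.le_normalizer hd)
    obtain ⟨x, k1, k2⟩ := mem_gr.1 hd
    have hx := hn (k1 ▸ hP x.2) (k2 ▸ (φ' x).2)
    refine mem_gr.2 ⟨⟨d.1, hx⟩, rfl, ?_⟩
    rw [e x _ k1.symm]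
    exact k2
  · rw [p1_gr]
    exact key g hg h1 h2

theorem isPGroup_zpowers {Γ : Type*} [Group Γ] {p : ℕ} {x : Γ} {k : ℕ} (h : x ^ p ^ k = 1) :
    IsPGroup p (Subgroup.zpowers x) := by
  rintro ⟨y, n, rfl⟩
  refine ⟨k, Subtype.ext ?_⟩
  change (x ^ n) ^ p ^ k = 1
  rw [← zpow_natCast, ← zpow_mul, mul_comm, zpow_mul, zpow_natCast, h, one_zpow]

/-- If every `p`-subgroup of `Aut_F(N)` is conjugate to one of `Aut_S(N)`, for all fully normalized
`N` larger than `Q`, then the `p`-elements which normalize `Aut_S(Q)` are in `Aut_S(Q)`. -/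
theorem IsSaturated.mem_autIn_of_lt [Finite T] {p : ℕ} [Fact p.Prime] (hT : IsPGroup p T)
    (hF : F.IsSaturated p) {Q : Subgroup T} (hQ : F.FullyNormalized Q) (hlt : Q < F.S)
    (ih : ∀ (N : Subgroup T) (hN : F.FullyNormalized N), Nat.card Q < Nat.card N →
      ∀ P ≤ F.autF hN.1, IsPGroup p P → ∃ a ∈ F.autF hN.1, ∀ g ∈ P, a * g * a⁻¹ ∈ F.autIn N)
    {φ : MulAut Q} (hφ : F.IsIso φ) {n : ℕ} (hn : φ ^ p ^ n = 1)
    (h : ∀ β ∈ F.autIn Q, φ * β * φ⁻¹ ∈ F.autIn Q) : φ ∈ F.autIn Q := by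
  obtain ⟨N, hNdef⟩ : ∃ N, N = F.normalizerIn Q := ⟨_, rfl⟩
  have hNS : N ≤ F.S := hNdef.le.trans inf_le_left
  have hQN : Q ≤ N := by rw [hNdef]; exact le_inf hlt.le Subgroup.le_normalizer
  have hcard : Nat.card Q < Nat.card N := by
    obtain ⟨g, hg, hg', hgn⟩ := (hT.to_subgroup F.S).exists_mem_normalizer hlt
    refine Subgroup.card_lt_of_lt (lt_of_le_of_ne hQN fun e => hg' ?_)
    rw [e, hNdef]
    exact ⟨hg, hgn⟩
  have hD := isGr_gr (F := F) hφ
  obtain ⟨E, hE, hDE, hext⟩ := hF.extend hD (by rw [p2_gr_equiv]; exact hQ)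
  -- An element of `E` over N_S(Q) normalizes the graph of `φ`, so its second component normalizes
  -- `Q` too.
  have hmem : ∀ a b, (a, b) ∈ E → a ∈ N → b ∈ N := by
    intro a b hab ha
    rw [hNdef] at ha ⊢
    have := hE.mem_normalizer hDE hab (by rw [p1_gr]; exact ha.2)
    have := snd_mem_normalizer this
    rw [p2_gr_equiv] at this
    exact ⟨hE.p2_le (snd_mem_p2 hab), this⟩
  have hE1 : F.IsGr (E ⊓ Subgroup.comap (MonoidHom.fst T T) N) := hE.mono inf_le_left
  -- Because `φ` normalizes Aut_S(Q), conjugation by `y` in N_S(Q), transported by `φ`, is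
  -- conjugation by some `z` in S. The pair `(y, z)` normalizes the graph, so `y` is in the source
  -- of the extension.
  have hp1 : p1 (E ⊓ Subgroup.comap (MonoidHom.fst T T) N) = N := by
    ext y
    rw [mem_p1]
    constructor
    · rintro ⟨b, -, h⟩
      exact h
    · intro hy
      have hy' := hy
      rw [hNdef] at hy'
      obtain ⟨β, hβ, hβ'⟩ := exists_mem_autIn hy'.1 hy'.2
      obtain ⟨z, hz, hz'⟩ := h β hβ
      have hyz : (y, z) ∈ Subgroup.normalizer (gr φ.toMonoidHom : Set (T × T)) := by
        refine mem_normalizer_of_forall fun d hd => ?_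
        obtain ⟨x, k1, k2⟩ := mem_gr.1 hd
        refine mem_gr.2 ⟨β x, (hβ' x).trans (by rw [k1]; rfl), ?_⟩
        have := hz' (φ x)
        rw [MulAut.mul_apply, MulAut.mul_apply, MulAut.inv_apply_self] at this
        refine this.trans ?_
        change (φ x : T) = d.2 at k2
        rw [k2]
        rfl
      obtain ⟨b, hb⟩ := mem_p1.1 (hext _ hyz hy'.1 hz)
      exact ⟨b, hb, hy⟩
  have hp2 : p2 (E ⊓ Subgroup.comap (MonoidHom.fst T T) N) = N := by
    refine Subgroup.eq_of_le_of_card_le ?_ ?_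
    · intro b hb
      obtain ⟨a, hab, ha⟩ := mem_p2.1 hb
      exact hmem a b hab ha
    · rw [hE1.card_p2, ← hE1.card_p1, hp1]
  obtain ⟨ψ, hψ, hψE⟩ := hE1.exists_iso' hp1 hp2
  have hres : ∀ x : Q, (ψ (Subgroup.inclusion hQN x) : T) = φ x := by
    intro x
    have : ((x : T), (φ x : T)) ∈ E ⊓ Subgroup.comap (MonoidHom.fst T T) N :=
      ⟨hDE (mem_gr.2 ⟨x, rfl, rfl⟩), hQN x.2⟩
    refine hE1.snd_eq ?_ this
    rw [hψE]
    exact mem_gr.2 ⟨_, rfl, rfl⟩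
  -- The extension `ψ` of `φ` to N_S(Q) need not be a p-element. Its power `ψ ^ m` is one, and still
  -- extends `φ` because `m` is 1 modulo the order of `φ`.
  obtain ⟨m, ⟨k, hk⟩, hm⟩ := exists_pPart (p := p) (Γ := MulAut N) ψ n
  have hφm : φ ^ m = φ := by
    have := pow_eq_pow_iff_modEq.2 (hm.of_dvd (orderOf_dvd_of_pow_eq_one hn))
    rwa [pow_one] at this
  have hpow : ∀ (j : ℕ) (x : Q),
      (((ψ : MulAut N) ^ j) (Subgroup.inclusion hQN x) : T) = (φ ^ j) x := by
    intro j
    induction j with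
    | zero => intro x; rfl
    | succ j ih =>
      intro x
      rw [pow_succ, MulAut.mul_apply, pow_succ, MulAut.mul_apply, ← ih]
      congr 2
      exact Subtype.ext (hres x)
  have hψm : F.IsIso (ψ ^ m : MulAut N) := (F.autF hNS).pow_mem (x := ψ) hψ m
  -- The induction hypothesis needs a fully normalized subgroup, so N_S(Q) is moved to one. There `ψ
  -- ^ m` becomes conjugation by an element `y` of S.
  obtain ⟨N1, ⟨τ, hτ⟩, hN1⟩ := exists_fullyNormalized hNS
  have hcN : Nat.card N = Nat.card N1 := Nat.card_congr τ.toEquiv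
  have hχ : (MulAut.congr τ (ψ ^ m)) ∈ F.autF hN1.1 :=
    isIso_trans (isIso_symm hτ) (isIso_trans hψm hτ)
  obtain ⟨a, ha, ha'⟩ := ih N1 hN1 (hcN ▸ hcard) (Subgroup.zpowers (MulAut.congr τ (ψ ^ m)))
    (by rwa [Subgroup.zpowers_le]) (isPGroup_zpowers (k := k) (by rw [← map_pow, hk, map_one]))
  obtain ⟨y, hy, hy'⟩ := ha' _ (Subgroup.mem_zpowers _)
  obtain ⟨σ, hσdef⟩ : ∃ σ : N ≃* N1, σ = τ.trans a := ⟨_, rfl⟩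
  have hσ : F.IsIso σ := hσdef ▸ isIso_trans hτ ha
  have hσy : ∀ x : N, (σ ((ψ ^ m : MulAut N) x) : T) = y * σ x * y⁻¹ := by
    intro x
    have := hy' (σ x)
    rw [MulAut.mul_apply, MulAut.mul_apply, hσdef] at this
    rw [hσdef, ← this]
    change (a (τ _) : T) = a (τ ((ψ ^ m : MulAut N) (τ.symm (a.symm (a (τ x))))))
    rw [MulEquiv.symm_apply_apply, MulEquiv.symm_apply_apply]
  have hσφ : ∀ x : Q, (σ (Subgroup.inclusion hQN (φ x)) : T) =
      y * σ (Subgroup.inclusion hQN x) * y⁻¹ := by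
    intro x
    rw [← hσy]
    congr 2
    refine Subtype.ext ?_
    rw [hpow, hφm]
    rfl
  obtain ⟨D2, hD2, h1, h2⟩ := IsGr.image_mem hσ hQN
  have hQ1 : F.Conj Q (p2 D2) := h1 ▸ hD2.conj
  have hmem1 : ∀ x : Q, (σ (Subgroup.inclusion hQN x) : T) ∈ p2 D2 := by
    intro x
    obtain ⟨b, hb⟩ := mem_p1.1 (h1.ge x.2)
    obtain ⟨w, k1, k2⟩ := mem_gr.1 (h2 hb)
    have : w = Subgroup.inclusion hQN x := Subtype.ext k1
    rw [this] at k2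
    exact mem_p2.2 ⟨x, by rw [show (σ (Subgroup.inclusion hQN x) : T) = b from k2]; exact hb⟩
  have hmem2 : ∀ b ∈ p2 D2, ∃ x : Q, (σ (Subgroup.inclusion hQN x) : T) = b := by
    intro b hb
    obtain ⟨a, hab⟩ := mem_p2.1 hb
    obtain ⟨w, k1, k2⟩ := mem_gr.1 (h2 hab)
    refine ⟨⟨a, h1.le (fst_mem_p1 hab)⟩, ?_⟩
    refine Eq.trans ?_ (show (σ w : T) = b from k2)
    congr 2
    exact Subtype.ext k1.symm
  have hyn : y ∈ F.normalizerIn (p2 D2) := by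
    refine ⟨hy, mem_normalizer_of_forall fun b hb => ?_⟩
    obtain ⟨x, rfl⟩ := hmem2 b hb
    rw [← hσφ]
    exact hmem1 _
  -- `Q` being fully normalized, no conjugate of it has a larger normalizer. So `N1` is the whole
  -- normalizer of the image of `Q`, it contains `y`, and `y` can be pulled back to N_S(Q).
  have hN1n : N1 = F.normalizerIn (p2 D2) := by
    refine Subgroup.eq_of_le_of_card_le ?_ ?_
    · intro b hb
      refine ⟨hN1.1 hb, mem_normalizer_of_forall fun c hc => ?_⟩
      obtain ⟨x, rfl⟩ := hmem2 c hc
      obtain ⟨w, hw⟩ := σ.surjective ⟨b, hb⟩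
      have hw' : (w : T) ∈ F.normalizerIn Q := hNdef ▸ w.2
      have := hmem1 ⟨_, conj_mem_of_mem_normalizer hw'.2 x.2⟩
      convert this using 1
      rw [show b = (σ w : T) by rw [hw], ← Subgroup.coe_mul, ← Subgroup.coe_inv,
        ← Subgroup.coe_mul, ← map_mul, ← map_inv, ← map_mul]
      rfl
    · rw [← hcN, hNdef]
      exact hQ.2 _ hQ1
  obtain ⟨w, hw⟩ := σ.surjective ⟨y, hN1n ▸ hyn⟩
  refine ⟨w, hNS w.2, fun x => ?_⟩
  have := hσφ x
  rw [show y = (σ w : T) by rw [hw], ← Subgroup.coe_mul, ← Subgroup.coe_inv,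
    ← Subgroup.coe_mul, ← map_mul, ← map_inv, ← map_mul] at this
  exact congrArg Subtype.val (σ.injective (Subtype.ext this))

/-- The start of the induction, where the Sylow axiom enters: a p-subgroup normalizing a Sylow
p-subgroup is contained in it. -/
theorem IsSaturated.mem_autIn_S [Finite T] {p : ℕ} [Fact p.Prime]
    (hF : F.IsSaturated p) {φ : MulAut F.S} (hφ : F.IsIso φ) {n : ℕ} (hn : φ ^ p ^ n = 1)
    (h : ∀ β ∈ F.autIn F.S, φ * β * φ⁻¹ ∈ F.autIn F.S) : φ ∈ F.autIn F.S := by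
  obtain ⟨Q, hQ⟩ := hF.1
  have hmem : ∀ β : F.autS, β ∈ (Q : Subgroup F.autS) ↔ (β : MulAut F.S) ∈ F.autIn F.S := by
    intro β
    rw [hQ, Subgroup.mem_subgroupOf]
    constructor
    · rintro ⟨g, hg⟩
      exact ⟨g, g.2, fun x => by rw [← hg]; rfl⟩
    · rintro ⟨g, hg, e⟩
      exact ⟨⟨g, hg⟩, MulEquiv.ext fun x => Subtype.ext (e x).symm⟩
  have hp : IsPGroup p (Subgroup.zpowers (⟨φ, hφ⟩ : F.autS)) :=
    isPGroup_zpowers (k := n) (Subtype.ext hn)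
  have hnorm : (⟨φ, hφ⟩ : F.autS) ∈ Subgroup.normalizer ((Q : Subgroup F.autS) : Set F.autS) := by
    refine mem_normalizer_of_forall fun β hβ => ?_
    rw [hmem] at hβ ⊢
    exact h _ hβ
  have := (hp.inf_normalizer_sylow Q).le ⟨Subgroup.mem_zpowers _, hnorm⟩
  exact (hmem _).1 this.2

/-- If `Q` is fully normalized, then `Aut_S(Q)` contains every `p`-subgroup of `Aut_F(Q)` up to
conjugation. -/
theorem IsSaturated.exists_conj_autIn [Finite T] {p : ℕ} [Fact p.Prime] (hT : IsPGroup p T)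
    (hF : F.IsSaturated p) {Q : Subgroup T} (hQ : F.FullyNormalized Q) {P : Subgroup (MulAut Q)}
    (hPle : P ≤ F.autF hQ.1) (hP : IsPGroup p P) :
    ∃ a ∈ F.autF hQ.1, ∀ g ∈ P, a * g * a⁻¹ ∈ F.autIn Q := by
  -- Downward induction on the order of `Q`: the automorphisms are extended to N_S(Q), which is
  -- larger.
  induction hd : Nat.card T - Nat.card Q using Nat.strong_induction_on generalizing Q with
  | _ d ih =>
  have hcT : ∀ N : Subgroup T, Nat.card N ≤ Nat.card T := fun N => Subgroup.card_le_card_group N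
  have key : ∀ φ : MulAut Q, F.IsIso φ → ∀ n : ℕ, φ ^ p ^ n = 1 →
      (∀ β ∈ F.autIn Q, φ * β * φ⁻¹ ∈ F.autIn Q) → φ ∈ F.autIn Q := by
    intro φ hφ n hn h
    rcases hQ.1.lt_or_eq with hlt | heq
    · refine hF.mem_autIn_of_lt hT hQ hlt (fun N hN hc P hP hP' => ?_) hφ hn h
      have := hcT N
      exact ih _ (by omega) hN hP hP' rfl
    · subst heq
      exact hF.mem_autIn_S hφ hn h
  -- It suffices that Aut_S(Q) contains every p-element of Aut_F(Q) normalizing it.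
  obtain ⟨a, ha⟩ := IsPGroup.exists_conj_le (Γ := F.autF hQ.1)
    (B := (F.autIn Q).subgroupOf (F.autF hQ.1)) (P := P.subgroupOf (F.autF hQ.1)) (p := p)
    ((isPGroup_autIn hT Q).comap_subtype) hP.comap_subtype (by
      rintro ⟨φ, hφ⟩ hg ⟨n, hn⟩
      refine key φ hφ n (congrArg Subtype.val hn) fun β hβ => ?_
      exact conj_mem_of_mem_normalizer hg (d := ⟨β, autIn_le hQ.1 hβ⟩) hβ)
  exact ⟨a, a.2, fun g hg => ha ⟨g, hPle hg⟩ hg⟩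

/-- Up to isomorphism in `F`, a `p`-group of automorphisms is a group of conjugations. -/
theorem IsSaturated.exists_iso_autIn [Finite T] {p : ℕ} [Fact p.Prime] (hT : IsPGroup p T)
    (hF : F.IsSaturated p) {N : Subgroup T} (hN : N ≤ F.S) {P : Subgroup (MulAut N)}
    (hPle : P ≤ F.autF hN) (hP : IsPGroup p P) :
    ∃ (N1 : Subgroup T) (τ : N ≃* N1), F.FullyNormalized N1 ∧ F.IsIso τ ∧
      ∀ φ ∈ P, ∃ y ∈ F.S, ∀ x : N, (τ (φ x) : T) = y * τ x * y⁻¹ := by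
  obtain ⟨N1, ⟨τ, hτ⟩, hN1⟩ := exists_fullyNormalized hN
  obtain ⟨a, ha, ha'⟩ := hF.exists_conj_autIn hT hN1
    (P := P.map (MulAut.congr τ).toMonoidHom) (by
      rintro _ ⟨φ, hφ, rfl⟩
      exact isIso_trans (isIso_symm hτ) (isIso_trans (hPle hφ) hτ)) (hP.map _)
  refine ⟨N1, τ.trans a, hN1, isIso_trans hτ ha, fun φ hφ => ?_⟩
  obtain ⟨y, hy, e⟩ := ha' _ ⟨φ, hφ, rfl⟩
  refine ⟨y, hy, fun x => ?_⟩
  rw [← e]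
  change (a (τ _) : T) = a (τ (φ (τ.symm (a.symm (a (τ x))))))
  rw [MulEquiv.symm_apply_apply, MulEquiv.symm_apply_apply]

end FusionSystem

/-! ### Extensions of centric graphs: existence and uniqueness. -/

namespace FusionSystem

variable {T : Type u} [Group T] {F : FusionSystem T}

/-- The center of the second projection of `D`. -/
def centerP2 (D : Subgroup (T × T)) : Subgroup T :=
  p2 D ⊓ Subgroup.centralizer (p2 D : Set T)

variable {D E : Subgroup (T × T)}

theorem conj_eq_of_mem_centerP2 {z x : T} (hz : z ∈ centerP2 D) (hx : x ∈ p2 D) :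
    z * x * z⁻¹ = x := by
  rw [mul_inv_eq_iff_eq_mul]
  exact (Subgroup.mem_centralizer_iff.1 hz.2 x hx).symm

theorem IsGr.mem_centerP2 (hD : F.IsGr D) (hc : F.IsCentric (p1 D)) {z : T} (hz : z ∈ F.S)
    (h : ∀ x ∈ p2 D, z * x * z⁻¹ = x) : z ∈ centerP2 D :=
  ⟨(hc.of_conj hD.conj).mem hz h,
    Subgroup.mem_centralizer_iff.2 fun x hx => (mul_inv_eq_iff_eq_mul.1 (h x hx)).symm⟩

/-- What centralizes the larger image centralizes the smaller one, and lies in it by centricity. So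
the correcting elements produced in the inductions below all stay in the center of the first image.
-/
theorem IsGr.centerP2_le (hD : F.IsGr D) (hE : F.IsGr E) (hc : F.IsCentric (p1 D)) (h : D ≤ E) :
    centerP2 E ≤ centerP2 D := fun _ hz =>
  hD.mem_centerP2 hc (hE.p2_le hz.1) fun _ hx => conj_eq_of_mem_centerP2 hz (p2_mono h hx)

/-- Extension to the normalizer, for centric graphs. -/
theorem IsSaturated.exists_extension [Finite T] {p : ℕ} [Fact p.Prime] (hT : IsPGroup p T)
    (hF : F.IsSaturated p) (hD : F.IsGr D) (hc : F.IsCentric (p1 D)) :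
    ∃ E, F.IsGr E ∧ D ≤ E ∧ ∀ g ∈ Subgroup.normalizer (D : Set (T × T)),
      g.1 ∈ F.S → g.2 ∈ F.S → g.1 ∈ p1 E := by
  -- The image of `D` need not be fully normalized. It is moved by `τ` to a fully normalized `Q`, in
  -- such a way that Aut_S of the image is carried into Aut_S(Q); the extension axiom then applies
  -- to `τ` and to `D` followed by `τ`.
  obtain ⟨Q, τ, hQ, hτ, hτ'⟩ := hF.exists_iso_autIn hT hD.p2_le (autIn_le hD.p2_le)
    (isPGroup_autIn hT _)
  have hA := isGr_gr (F := F) hτ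
  have hA1 : p1 (gr τ.toMonoidHom) = p2 D := p1_gr _
  have hA2 : p2 (gr τ.toMonoidHom) = Q := p2_gr_equiv _
  have hcQ : F.IsCentric Q := (hc.of_conj hD.conj).of_conj ⟨τ, hτ⟩
  obtain ⟨A, hAgr, hAle, hAext⟩ := hF.extend hA (by rwa [hA2])
  have hDA := hD.relComp hA
  have hDA2 : p2 (FusionSystem.relComp D (gr τ.toMonoidHom)) = Q := by
    ext x
    rw [mem_p2]
    constructor
    · rintro ⟨a, b, -, h⟩
      rw [← hA2]
      exact snd_mem_p2 h
    · intro hx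
      obtain ⟨b, hb⟩ := mem_p2.1 (hA2.ge hx)
      obtain ⟨a, ha⟩ := mem_p2.1 (hA1.le (fst_mem_p1 hb))
      exact ⟨a, b, ha, hb⟩
  obtain ⟨B, hB, hBle, hBext⟩ := hF.extend hDA (by rwa [hDA2])
  -- The extension of the composite, followed by the inverse of the extension of `τ`.
  refine ⟨FusionSystem.relComp B (FusionSystem.swap A), hB.relComp hAgr.swap, ?_, ?_⟩
  · rintro ⟨a, b⟩ hd
    obtain ⟨c, hbc⟩ := mem_p1.1 (hA1.ge (snd_mem_p2 hd))
    exact ⟨c, hBle ⟨b, hd, hbc⟩, hAle hbc⟩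
  · rintro ⟨x, z⟩ hg hx hz
    have hzn := snd_mem_normalizer hg
    obtain ⟨β, hβ, hβ'⟩ := exists_mem_autIn hz hzn
    obtain ⟨y, hy, e⟩ := hτ' β hβ
    have hzy : (z, y) ∈ Subgroup.normalizer (gr τ.toMonoidHom : Set (T × T)) := by
      refine mem_normalizer_of_forall fun d hd => ?_
      obtain ⟨w, k1, k2⟩ := mem_gr.1 hd
      refine mem_gr.2 ⟨β w, (hβ' w).trans (by rw [k1]; rfl), (e w).trans ?_⟩
      rw [show (τ w : T) = d.2 from k2]
      rfl
    obtain ⟨y0, hy0⟩ : ∃ y0, (z, y0) ∈ A := mem_p1.1 (hAext _ hzy hz hy)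
    have hzy0 := hAgr.mem_normalizer hAle hy0 (by rw [hA1]; exact hzn)
    have hxy0 : (x, y0) ∈ Subgroup.normalizer
        (FusionSystem.relComp D (gr τ.toMonoidHom) : Set (T × T)) := by
      refine mem_normalizer_of_forall ?_
      rintro ⟨a, c⟩ ⟨b, h1, h2⟩
      exact ⟨z * b * z⁻¹, conj_mem_of_mem_normalizer hg h1, conj_mem_of_mem_normalizer hzy0 h2⟩
    obtain ⟨y1, hy1⟩ : ∃ y1, (x, y1) ∈ B := mem_p1.1 (hBext _ hxy0 hx (hAgr.p2_le (mem_p2.2 ⟨_, hy0⟩)))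
    have hxy1 := hB.mem_normalizer hBle hy1 (show x ∈ _ from fst_mem_normalizer hxy0)
    -- The values of the two extensions over `(x, z)` induce the same automorphism of the centric
    -- group `Q`. They differ by an element of `Q`, by whose preimage `z` is then corrected.
    have hw : y0⁻¹ * y1 ∈ Q := by
      refine hcQ.mem (mul_mem (inv_mem (hAgr.p2_le (snd_mem_p2 hy0)))
        (hB.p2_le (snd_mem_p2 hy1))) fun q hq => ?_
      obtain ⟨a, ha⟩ := mem_p2.1 (hDA2.ge hq)
      have h3 := conj_mem_of_mem_normalizer (mul_mem (inv_mem hxy0) hxy1) ha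
      refine (hDA.snd_eq ha ?_).symm
      convert h3 using 1
      refine Prod.ext ?_ rfl
      simp only [Prod.fst_mul, Prod.fst_inv]
      group
    obtain ⟨w, hw'⟩ := mem_p2.1 (hA2.ge hw)
    refine mem_p1.2 ⟨z * w, y1, hy1, ?_⟩
    rw [mem_swap]
    convert mul_mem hy0 (hAle hw') using 1
    exact Prod.ext rfl (by simp)

/-- Uniqueness of extensions of centric graphs, for normal subgroups. -/
theorem IsSaturated.exists_conj_of_normal [Finite T] {p : ℕ} [Fact p.Prime] (hT : IsPGroup p T)
    (hF : F.IsSaturated p) {D1 D2 : Subgroup (T × T)} (hD1 : F.IsGr D1) (hD2 : F.IsGr D2)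
    (h1 : D ≤ D1) (h2 : D ≤ D2) (hc : F.IsCentric (p1 D)) (he : p1 D1 = p1 D2)
    (hn : p1 D1 ≤ Subgroup.normalizer (p1 D : Set T)) :
    ∃ z ∈ centerP2 D, D2 = MulAut.conj ((1, z) : T × T) • D1 := by
  have hD := hD1.mono h1
  have hc2 := hc.of_conj hD.conj
  -- The map χ comparing the two extensions; the aim is to show that it is conjugation by an element
  -- of the center.
  have hC := hD1.swap.relComp hD2
  -- By normality both values over a point act on the image of `D` through the same automorphism, so
  -- their quotient centralizes that image and lies in it.
  have hCz : ∀ b c : T, (b, c) ∈ FusionSystem.relComp (FusionSystem.swap D1) D2 →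
      b⁻¹ * c ∈ p2 D := by
    rintro b c hbc
    have hbS := hC.p1_le (fst_mem_p1 hbc)
    have hcS := hC.p2_le (snd_mem_p2 hbc)
    obtain ⟨a, k1, k2⟩ : ∃ a, (a, b) ∈ D1 ∧ (a, c) ∈ D2 := hbc
    refine hc2.mem (mul_mem (inv_mem hbS) hcS) fun q hq => ?_
    obtain ⟨u, hu⟩ := mem_p2.1 hq
    have e1 := conj_mem_of_mem_normalizer
      (hD1.mem_normalizer h1 k1 (hn (mem_p1.2 ⟨_, k1⟩))) hu
    have e2 := conj_mem_of_mem_normalizer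
      (hD2.mem_normalizer h2 k2 (hn (mem_p1.2 ⟨_, k1⟩))) hu
    have e3 : b * q * b⁻¹ = c * q * c⁻¹ := hD.snd_eq e1 e2
    calc b⁻¹ * c * q * (b⁻¹ * c)⁻¹ = b⁻¹ * (c * q * c⁻¹) * b := by group
      _ = q := by rw [← e3]; group
  have hC1 : p1 (FusionSystem.relComp (FusionSystem.swap D1) D2) = p2 D1 := by
    ext b
    rw [mem_p1]
    constructor
    · rintro ⟨c, a, k1, -⟩
      exact snd_mem_p2 (mem_swap.1 k1)
    · intro hb
      obtain ⟨a, ha⟩ := mem_p2.1 hb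
      obtain ⟨c, hc⟩ := mem_p1.1 (he.le (fst_mem_p1 ha))
      exact ⟨c, a, ha, hc⟩
  have hC2 : p2 (FusionSystem.relComp (FusionSystem.swap D1) D2) = p2 D1 := by
    refine Subgroup.eq_of_le_of_card_le ?_ ?_
    · intro c hc
      obtain ⟨b, hb⟩ := mem_p2.1 hc
      have := mul_mem (hC1.le (fst_mem_p1 hb)) (p2_mono h1 (hCz b c hb))
      rwa [mul_inv_cancel_left] at this
    · rw [hC.card_p2, ← hC.card_p1, hC1]
  obtain ⟨χ, hχ, hχC⟩ := hC.exists_iso' hC1 hC2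
  have hmem : ∀ x : p2 D1, ((x : T), (χ x : T)) ∈
      FusionSystem.relComp (FusionSystem.swap D1) D2 := fun x => by
    rw [hχC]
    exact mem_gr.2 ⟨x, rfl, rfl⟩
  have hfix : ∀ x : p2 D1, (x : T) ∈ p2 D → χ x = x := by
    intro x hx
    obtain ⟨u, hu⟩ := mem_p2.1 hx
    exact Subtype.ext (hC.snd_eq (hmem x) ⟨u, h1 hu, h2 hu⟩)
  -- χ fixes the image of `D` and moves each `x` by an element of it, so its powers only accumulate
  -- copies of `x⁻¹ * χ x`. Hence χ is a p-element.
  have hpow : ∀ (n : ℕ) (x : p2 D1), ((χ : MulAut (p2 D1)) ^ n) x = x * (x⁻¹ * χ x) ^ n := by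
    intro n
    induction n with
    | zero => intro x; simp
    | succ n ih =>
      intro x
      rw [pow_succ', MulAut.mul_apply, ih, map_mul, map_pow, hfix (x⁻¹ * χ x) (hCz _ _ (hmem x)),
        pow_succ', ← mul_assoc, mul_inv_cancel_left]
  obtain ⟨k, hk⟩ := IsPGroup.iff_card.1 hT
  have hχp : (χ : MulAut (p2 D1)) ^ p ^ k = 1 := by
    refine MulEquiv.ext fun x => ?_
    have : (x⁻¹ * χ x) ^ p ^ k = 1 := by
      refine Subtype.ext ?_
      rw [← hk, Subgroup.coe_pow, pow_card_eq_one']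
      rfl
    rw [hpow, this, mul_one]
    rfl
  -- By the Sylow property, up to an isomorphism in `F`, the p-automorphism χ is conjugation by some
  -- `y` in S.
  obtain ⟨N, τ, hN, hτ, hy⟩ := hF.exists_iso_autIn hT hD1.p2_le
    (P := Subgroup.zpowers (χ : MulAut (p2 D1)))
    (by rw [Subgroup.zpowers_le]; exact hχ) (isPGroup_zpowers hχp)
  obtain ⟨y, hy, e⟩ := hy χ (Subgroup.mem_zpowers _)
  obtain ⟨B, hB, hB1, hB2⟩ := IsGr.image_mem hτ (p2_mono h1)
  -- χ is trivial on the image of `D`, so `y` centralizes the transported image and lies in it by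
  -- centricity; it can then be pulled back.
  have hyB : y ∈ p2 B := by
    rw [← hB1] at hc2
    refine (hc2.of_conj hB.conj).mem hy fun x hx => ?_
    obtain ⟨a, ha⟩ := mem_p2.1 hx
    obtain ⟨w, k1, k2⟩ := mem_gr.1 (hB2 ha)
    have := e w
    rw [hfix w (by rw [k1, ← hB1]; exact fst_mem_p1 ha)] at this
    rw [← show (τ w : T) = x from k2]
    exact this.symm
  obtain ⟨a, ha⟩ := mem_p2.1 hyB
  obtain ⟨w, k1, k2⟩ := mem_gr.1 (hB2 ha)
  have haD : (w : T) ∈ p2 D := by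
    rw [k1, ← hB1]
    exact fst_mem_p1 ha
  have hconj : ∀ x, χ x = w * x * w⁻¹ := by
    intro x
    apply τ.injective
    refine Subtype.ext ?_
    rw [e x, ← show (τ w : T) = y from k2]
    simp
  refine ⟨w, hD.mem_centerP2 hc (hD.p2_le haD) fun x hx => ?_, ?_⟩
  · have := hfix ⟨x, p2_mono h1 hx⟩ hx
    rw [hconj] at this
    exact congrArg Subtype.val this
  · refine (hD2.eq_of_le ?_ ?_).symm
    · rintro ⟨a, c⟩ hac
      rw [mem_conj_smul] at hac
      obtain ⟨a', l1, l2⟩ := hmem ⟨_, snd_mem_p2 hac⟩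
      rw [hconj] at l2
      have : (((1, (w : T)) : T × T)⁻¹ * (a, c) * (1, (w : T))).1 = a' := hD1.fst_eq hac l1
      subst this
      convert l2 using 1
      refine Prod.ext ?_ ?_
      · simp
      · simp only [Prod.snd_mul, Prod.snd_inv, Subgroup.coe_mul, Subgroup.coe_inv]
        group
    · rw [p1_conj_smul, conj_one_smul, he]

theorem isPGroup_prod {p : ℕ} [Fact p.Prime] [Finite T] (hT : IsPGroup p T) :
    IsPGroup p (T × T) := by
  obtain ⟨n, hn⟩ := IsPGroup.iff_card.1 hT
  exact IsPGroup.iff_card.2 ⟨n + n, by rw [Nat.card_prod, hn, pow_add]⟩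

/-- Uniqueness of extensions of centric graphs. -/
theorem IsSaturated.exists_conj_of_p1_eq [Finite T] {p : ℕ} [Fact p.Prime] (hT : IsPGroup p T)
    (hF : F.IsSaturated p) {D1 D2 : Subgroup (T × T)} (hD1 : F.IsGr D1) (hD2 : F.IsGr D2)
    (h1 : D ≤ D1) (h2 : D ≤ D2) (hc : F.IsCentric (p1 D)) (he : p1 D1 = p1 D2) :
    ∃ z ∈ centerP2 D, D2 = MulAut.conj ((1, z) : T × T) • D1 := by
  -- Downward induction on the order of the common subgraph `D`.
  induction hd : Nat.card (T × T) - Nat.card D using Nat.strong_induction_on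
    generalizing D D1 D2 with
  | _ d ih =>
  rcases h1.lt_or_eq with hlt | rfl
  · obtain ⟨g, hg, hg', hgn⟩ := ((isPGroup_prod hT).to_subgroup D1).exists_mem_normalizer hlt
    -- `E1` is the normalizer of `D` in `D1`, and `E2` is the part of `D2` with the same source. The
    -- normal case conjugates `E1` to `E2`, after which `E2` is a larger common subgraph.
    set E1 := D1 ⊓ Subgroup.normalizer (D : Set (T × T)) with hE1
    set E2 := D2 ⊓ Subgroup.comap (MonoidHom.fst T T) (p1 E1) with hE2
    have hDE1 : D ≤ E1 := le_inf h1 Subgroup.le_normalizer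
    have hDE2 : D ≤ E2 := le_inf h2 fun d hd => p1_mono hDE1 (fst_mem_p1 hd)
    have hlt1 : D < E1 := lt_of_le_of_ne hDE1 fun e => hg' (e ▸ ⟨hg, hgn⟩)
    have hE12 : p1 E1 = p1 E2 := by
      ext x
      constructor
      · intro hx
        obtain ⟨b, hb⟩ := mem_p1.1 (he.le (p1_mono inf_le_left hx))
        exact mem_p1.2 ⟨b, hb, hx⟩
      · intro hx
        obtain ⟨b, -, hb⟩ := mem_p1.1 hx
        exact hb
    have hgE1 : F.IsGr E1 := hD1.mono inf_le_left
    have hgE2 : F.IsGr E2 := hD2.mono inf_le_left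
    obtain ⟨z, hz, e⟩ := hF.exists_conj_of_normal hT hgE1 hgE2 hDE1 hDE2 hc hE12 (by
      intro x hx
      obtain ⟨b, hb⟩ := mem_p1.1 hx
      exact fst_mem_normalizer hb.2)
    have hzS : z ∈ F.S := (hD1.mono h1).p2_le hz.1
    have hcard : Nat.card D < Nat.card E2 := by
      rw [← hgE2.card_p1, ← hE12, hgE1.card_p1]
      exact Subgroup.card_lt_of_lt hlt1
    have hcardT : Nat.card E2 ≤ Nat.card (T × T) := Subgroup.card_le_card_group E2
    obtain ⟨w, hw, e'⟩ := ih _ (by omega) (D := E2)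
      (hD1.conj_smul (g := (1, z)) (one_mem _) hzS) hD2
      (e.le.trans (conj_smul_mono _ inf_le_left)) inf_le_left
      (hc.mono (p1_mono hDE2) hgE2.p1_le) (by rw [p1_conj_smul, conj_one_smul, he]) rfl
    -- `w` is central in the image of `E2`, hence in the image of `D`, so the product is still a
    -- central element there.
    refine ⟨w * z, mul_mem ((hD1.mono h1).centerP2_le hgE2 hc hDE2 hw) hz, ?_⟩
    rw [e', conj_smul_smul]
    simp
  · refine ⟨1, one_mem _, ?_⟩
    rw [← Prod.one_eq_mk, conj_one_smul]
    exact (hD2.eq_of_le h2 he.ge).symm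

/-! ### Maximal graphs -/

/-- The graph `D` of a morphism between centric subgroups of `H` and `K` is maximal. -/
structure IsMaxGr (F : FusionSystem T) (H K : Subgroup T) (D : Subgroup (T × T)) : Prop where
  isGr : F.IsGr D
  p1_le : p1 D ≤ H
  p2_le : p2 D ≤ K
  centric : F.IsCentric (p1 D)
  eq_of_le : ∀ E, F.IsGr E → p1 E ≤ H → p2 E ≤ K → D ≤ E → E = D

variable {H K : Subgroup T}

theorem IsGr.exists_isMaxGr [Finite T] (hD : F.IsGr D) (h1 : p1 D ≤ H) (h2 : p2 D ≤ K)
    (hc : F.IsCentric (p1 D)) : ∃ E, D ≤ E ∧ F.IsMaxGr H K E := by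
  have hfin : {E : Subgroup (T × T) | F.IsGr E ∧ p1 E ≤ H ∧ p2 E ≤ K}.Finite := Set.toFinite _
  obtain ⟨E, hDE, hE⟩ := hfin.exists_le_maximal (a := D) ⟨hD, h1, h2⟩
  exact ⟨E, hDE, hE.prop.1, hE.prop.2.1, hE.prop.2.2, hc.mono (p1_mono hDE) hE.prop.1.p1_le,
    fun E' h h1 h2 hle => le_antisymm (hE.le_of_ge ⟨h, h1, h2⟩ hle) hle⟩

theorem IsMaxGr.conj_smul (hD : F.IsMaxGr H K D) (hH : H ≤ F.S) (hK : K ≤ F.S) {g : T × T}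
    (h1 : g.1 ∈ H) (h2 : g.2 ∈ K) : F.IsMaxGr H K (MulAut.conj g • D) where
  isGr := hD.isGr.conj_smul (hH h1) (hK h2)
  p1_le := by
    rw [p1_conj_smul]
    exact conj_smul_le h1 hD.p1_le
  p2_le := by
    rw [p2_conj_smul]
    exact conj_smul_le h2 hD.p2_le
  centric := by
    rw [p1_conj_smul]
    exact hD.centric.of_conj ⟨_, isIso_conjIso (hH h1) (hD.p1_le.trans hH)⟩
  eq_of_le := by
    intro E hE hE1 hE2 hle
    have : MulAut.conj g⁻¹ • E = D := by
      refine hD.eq_of_le _ (hE.conj_smul (inv_mem (hH h1)) (inv_mem (hK h2))) ?_ ?_ ?_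
      · rw [p1_conj_smul]
        exact conj_smul_le (inv_mem h1) hE1
      · rw [p2_conj_smul]
        exact conj_smul_le (inv_mem h2) hE2
      · have := conj_smul_mono g⁻¹ hle
        rwa [conj_smul_smul, inv_mul_cancel, conj_one_smul] at this
    rw [← this, conj_smul_smul, mul_inv_cancel, conj_one_smul]

/-- Extension to the normalizer inside `H × K`. -/
theorem IsSaturated.exists_extension_le [Finite T] {p : ℕ} [Fact p.Prime] (hT : IsPGroup p T)
    (hF : F.IsSaturated p) (hH : H ≤ F.S) (hK : K ≤ F.S) (hD : F.IsGr D)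
    (hc : F.IsCentric (p1 D)) (h1 : p1 D ≤ H) (h2 : p2 D ≤ K) :
    ∃ E, F.IsGr E ∧ D ≤ E ∧ p1 E ≤ H ∧ p2 E ≤ K ∧
      ∀ g ∈ Subgroup.normalizer (D : Set (T × T)), g.1 ∈ H → g.2 ∈ K → g.1 ∈ p1 E := by
  obtain ⟨E, hE, hDE, h⟩ := hF.exists_extension hT hD hc
  refine ⟨E ⊓ H.prod K, hE.mono inf_le_left, le_inf hDE fun d hd =>
    ⟨h1 (fst_mem_p1 hd), h2 (snd_mem_p2 hd)⟩, ?_, ?_, ?_⟩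
  · intro x hx
    obtain ⟨b, -, hb⟩ := mem_p1.1 hx
    exact hb.1
  · intro x hx
    obtain ⟨b, -, hb⟩ := mem_p2.1 hx
    exact hb.2
  · intro g hg hg1 hg2
    obtain ⟨y, hy⟩ := mem_p1.1 (h g hg (hH hg1) (hK hg2))
    have hy' : (g.1, y) ∈ Subgroup.normalizer (D : Set (T × T)) :=
      hE.mem_normalizer hDE hy (show g.1 ∈ _ from fst_mem_normalizer hg)
    -- The value `y` of the extension at `g.1` and the given `g.2` act alike on the image of `D`, so
    -- they differ by an element of that image. This puts `y` in `K`.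
    have : g.2⁻¹ * y ∈ p2 D := by
      refine (hc.of_conj hD.conj).mem (mul_mem (inv_mem (hK hg2)) (hE.p2_le (snd_mem_p2 hy)))
        fun q hq => ?_
      obtain ⟨a, ha⟩ := mem_p2.1 hq
      have h3 := conj_mem_of_mem_normalizer (mul_mem (inv_mem hg) hy') ha
      refine (hD.snd_eq ha ?_).symm
      convert h3 using 1
      refine Prod.ext ?_ rfl
      simp only [Prod.fst_mul, Prod.fst_inv]
      group
    refine mem_p1.2 ⟨y, hy, hg1, ?_⟩
    have := mul_mem hg2 (h2 this)
    rwa [mul_inv_cancel_left] at this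

/-- The maximal graph above a centric graph is unique up to conjugation by an element of the
center. -/
theorem IsSaturated.exists_conj_of_isMaxGr [Finite T] {p : ℕ} [Fact p.Prime] (hT : IsPGroup p T)
    (hF : F.IsSaturated p) (hH : H ≤ F.S) (hK : K ≤ F.S) {D1 D2 : Subgroup (T × T)}
    (hD1 : F.IsMaxGr H K D1) (hD2 : F.IsMaxGr H K D2) (h1 : D ≤ D1) (h2 : D ≤ D2)
    (hc : F.IsCentric (p1 D)) :
    ∃ z ∈ centerP2 D, D2 = MulAut.conj ((1, z) : T × T) • D1 := by
  induction hd : Nat.card (T × T) - Nat.card D using Nat.strong_induction_on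
    generalizing D D1 D2 with
  | _ d ih =>
  have hD := hD1.isGr.mono h1
  rcases h1.lt_or_eq with hlt1 | rfl
  · obtain ⟨E, hE, hDE, hE1, hE2, hext⟩ := hF.exists_extension_le hT hH hK hD hc
      ((p1_mono h1).trans hD1.p1_le) ((p2_mono h1).trans hD1.p2_le)
    -- Both maximal graphs are compared with one that contains the extension of `D` to its
    -- normalizer in H × K. This extension shares with each of them a graph strictly larger than
    -- `D`.
    obtain ⟨D3, hED3, hD3⟩ := hE.exists_isMaxGr hE1 hE2 (hc.mono (p1_mono hDE) hE.p1_le)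
    have key : ∀ D1, F.IsMaxGr H K D1 → D < D1 →
        ∃ z ∈ centerP2 D, D3 = MulAut.conj ((1, z) : T × T) • D1 := by
      intro D1 hD1 hlt
      obtain ⟨g, hg, hg', hgn⟩ := ((isPGroup_prod hT).to_subgroup D1).exists_mem_normalizer hlt
      set E1 := D1 ⊓ Subgroup.normalizer (D : Set (T × T)) with hE1
      set E2 := E ⊓ Subgroup.comap (MonoidHom.fst T T) (p1 E1) with hE2
      have hDE1 : D ≤ E1 := le_inf hlt.le Subgroup.le_normalizer
      have hDE2 : D ≤ E2 := le_inf hDE fun d hd => p1_mono hDE1 (fst_mem_p1 hd)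
      have hlt1 : D < E1 := lt_of_le_of_ne hDE1 fun e => hg' (e ▸ ⟨hg, hgn⟩)
      have hE12 : p1 E1 = p1 E2 := by
        ext x
        constructor
        · intro hx
          obtain ⟨c, hc⟩ := mem_p1.1 hx
          obtain ⟨b, hb⟩ := mem_p1.1 (hext _ hc.2 (hD1.p1_le (fst_mem_p1 hc.1))
            (hD1.p2_le (snd_mem_p2 hc.1)))
          exact mem_p1.2 ⟨b, hb, hx⟩
        · intro hx
          obtain ⟨b, -, hb⟩ := mem_p1.1 hx
          exact hb
      have hgE1 : F.IsGr E1 := hD1.isGr.mono inf_le_left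
      have hgE2 : F.IsGr E2 := hE.mono inf_le_left
      obtain ⟨z, hz, e⟩ := hF.exists_conj_of_p1_eq hT hgE1 hgE2 hDE1 hDE2 hc hE12
      have hzK : z ∈ K := hD1.p2_le (p2_mono hlt.le hz.1)
      have hcard : Nat.card D < Nat.card E2 := by
        rw [← hgE2.card_p1, ← hE12, hgE1.card_p1]
        exact Subgroup.card_lt_of_lt hlt1
      have hcardT : Nat.card E2 ≤ Nat.card (T × T) := Subgroup.card_le_card_group E2
      obtain ⟨w, hw, e'⟩ := ih _ (by omega) (D := E2)
        (hD1.conj_smul hH hK (g := (1, z)) (one_mem _) hzK) hD3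
        (e.le.trans (conj_smul_mono _ inf_le_left)) (inf_le_left.trans hED3)
        (hc.mono (p1_mono hDE2) hgE2.p1_le) rfl
      refine ⟨w * z, mul_mem (hD.centerP2_le hgE2 hc hDE2 hw) hz, ?_⟩
      rw [e', conj_smul_smul]
      simp
    rcases h2.lt_or_eq with hlt2 | rfl
    · obtain ⟨z, hz, e⟩ := key D1 hD1 hlt1
      obtain ⟨w, hw, e'⟩ := key D2 hD2 hlt2
      refine ⟨w⁻¹ * z, mul_mem (inv_mem hw) hz, ?_⟩
      have : D2 = MulAut.conj ((1, w⁻¹) : T × T) • D3 := by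
        rw [e', conj_smul_smul, Prod.mk_mul_mk, inv_mul_cancel, one_mul, ← Prod.one_eq_mk,
          conj_one_smul]
      rw [this, e, conj_smul_smul]
      simp
    -- Here `D2` is `D` itself, and its maximality contradicts the strict inclusion in `D1`.
    · exact absurd (hD2.eq_of_le _ hD1.isGr hD1.p1_le hD1.p2_le h1) hlt1.ne'
  · refine ⟨1, one_mem _, ?_⟩
    rw [← Prod.one_eq_mk, conj_one_smul]
    exact hD1.eq_of_le _ hD2.isGr hD2.p1_le hD2.p2_le h2

/-- An element of `H × K` that conjugates a maximal graph to one which has a centric subgroup in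
common with it has components in the projections. -/
theorem IsSaturated.mem_of_le_conj [Finite T] {p : ℕ} [Fact p.Prime] (hT : IsPGroup p T)
    (hF : F.IsSaturated p) (hH : H ≤ F.S) (hK : K ≤ F.S) (hD : F.IsMaxGr H K D)
    (h1 : E ≤ D) {g : T × T} (hg1 : g.1 ∈ H) (hg2 : g.2 ∈ K) (h2 : E ≤ MulAut.conj g • D)
    (hc : F.IsCentric (p1 E)) : g.1 ∈ p1 D ∧ g.2 ∈ p2 D := by
  obtain ⟨z, hz, e⟩ := hF.exists_conj_of_isMaxGr hT hH hK hD (hD.conj_smul hH hK hg1 hg2) h1 h2 hc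
  have hzD : z ∈ p2 D := p2_mono h1 hz.1
  -- `D` and its conjugate by `g` are maximal above a common centric graph, so they also differ by a
  -- central `z`. Correcting `g` by `z` gives an element normalizing `D`.
  have hn : ((1, z) : T × T)⁻¹ * g ∈ Subgroup.normalizer (D : Set (T × T)) := by
    apply mem_normalizer_of_conj_smul_eq
    rw [← conj_smul_smul, e, conj_smul_smul, inv_mul_cancel, conj_one_smul]
  obtain ⟨B, hB, hDB, hB1, hB2, hext⟩ := hF.exists_extension_le hT hH hK hD.isGr hD.centric
    hD.p1_le hD.p2_le
  have := hext _ hn (by simpa using hg1) (mul_mem (inv_mem (hD.p2_le hzD)) hg2)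
  -- By maximality the extension of `D` to its normalizer is `D` itself, so `g.1` is already in its
  -- source.
  rw [hD.eq_of_le B hB hB1 hB2 hDB, Prod.fst_mul, Prod.fst_inv, inv_one, one_mul] at this
  refine ⟨this, ?_⟩
  obtain ⟨b, hb⟩ := mem_p1.1 this
  have hbn := mul_mem (inv_mem (Subgroup.le_normalizer hb)) hn
  -- `b` is the value of `D` at `g.1`. It acts on the image of `D` as `z⁻¹ * g.2` does, so
  -- centricity controls the second component.
  have hb2 : b⁻¹ * (z⁻¹ * g.2) ∈ p2 D := by
    refine (hD.centric.of_conj hD.isGr.conj).mem (mul_mem (inv_mem (hD.isGr.p2_le (snd_mem_p2 hb)))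
      (mul_mem (inv_mem (hD.isGr.p2_le hzD)) (hK hg2))) fun q hq => ?_
    obtain ⟨a, ha⟩ := mem_p2.1 hq
    have h3 := conj_mem_of_mem_normalizer hbn ha
    refine (hD.isGr.snd_eq ha ?_).symm
    convert h3 using 1
    refine Prod.ext ?_ rfl
    simp only [Prod.fst_mul, Prod.fst_inv]
    group
  have := mul_mem hzD (mul_mem (snd_mem_p2 hb) hb2)
  simpa using this

end FusionSystem

/-! ### Sums over classes of an equivalence relation -/

section RelSum

variable {α β γ : Type*} {N : Type*} [AddCommMonoid N]

theorem exists_relReps (s : Setoid α) (X : Set α) :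
    ∃ Y ⊆ X, (∀ x ∈ X, ∃ y ∈ Y, s y x) ∧ ∀ y ∈ Y, ∀ y' ∈ Y, s y y' → y = y' := by
  have h : ∀ q : (Quotient.mk s '' X), ∃ x ∈ X, Quotient.mk s x = q := fun q => q.2
  choose f hf hf' using h
  refine ⟨Set.range f, ?_, fun x hx => ?_, ?_⟩
  · rintro _ ⟨q, rfl⟩
    exact hf q
  · exact ⟨f ⟨_, x, hx, rfl⟩, ⟨_, rfl⟩, Quotient.exact (hf' _)⟩
  · rintro _ ⟨q, rfl⟩ _ ⟨q', rfl⟩ h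
    have := Quotient.sound h
    rw [hf', hf'] at this
    rw [Subtype.ext this]

/-- Representatives of the classes of `s` which meet `X`. -/
noncomputable def relReps [Finite α] (s : Setoid α) (X : Set α) : Finset α :=
  (Set.toFinite (exists_relReps s X).choose).toFinset

/-- The sum of `g` over representatives of the classes of `s` which meet `X`. -/
noncomputable def relSum [Finite α] (s : Setoid α) (X : Set α) (g : α → N) : N :=
  ∑ x ∈ relReps s X, g x

variable [Finite α] [Finite β] [Finite γ]

theorem mem_of_mem_relReps {s : Setoid α} {X : Set α} {x : α} (h : x ∈ relReps s X) : x ∈ X :=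
  (exists_relReps s X).choose_spec.1 ((Set.Finite.mem_toFinset _).1 h)

theorem exists_mem_relReps (s : Setoid α) {X : Set α} {x : α} (h : x ∈ X) :
    ∃ y ∈ relReps s X, s y x := by
  obtain ⟨y, hy, h⟩ := (exists_relReps s X).choose_spec.2.1 x h
  exact ⟨y, (Set.Finite.mem_toFinset _).2 hy, h⟩

theorem eq_of_mem_relReps {s : Setoid α} {X : Set α} {x y : α} (hx : x ∈ relReps s X)
    (hy : y ∈ relReps s X) (h : s x y) : x = y :=
  (exists_relReps s X).choose_spec.2.2 x ((Set.Finite.mem_toFinset _).1 hx) y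
    ((Set.Finite.mem_toFinset _).1 hy) h

theorem relSum_congr {s : Setoid α} {X : Set α} {g g' : α → N} (h : ∀ x ∈ X, g x = g' x) :
    relSum s X g = relSum s X g' :=
  Finset.sum_congr rfl fun x hx => h x (mem_of_mem_relReps hx)

theorem relSum_eq_zero {s : Setoid α} {X : Set α} {g : α → N} (h : ∀ x ∈ X, g x = 0) :
    relSum s X g = 0 :=
  Finset.sum_eq_zero fun x hx => h x (mem_of_mem_relReps hx)

theorem map_relSum {N' G : Type*} [AddCommMonoid N'] [FunLike G N N'] [AddMonoidHomClass G N N']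
    (f : G) (s : Setoid α) (X : Set α) (g : α → N) :
    f (relSum s X g) = relSum s X fun x => f (g x) :=
  map_sum f _ _

/-- Nested sums over representatives. -/
theorem relSum_nest {s : Setoid α} {X : Set α} {t : α → Setoid β} {Z : α → Set β}
    {r : Setoid γ} {W : Set γ} {g : γ → N} (e : α → β → γ)
    (hg : ∀ w ∈ W, ∀ w' ∈ W, r w w' → g w = g w')
    (hW : ∀ x ∈ X, ∀ z ∈ Z x, e x z ∈ W)
    (hsurj : ∀ w ∈ W, ∃ x ∈ X, ∀ x' ∈ X, s x' x → ∃ z ∈ Z x', r (e x' z) w)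
    (ht : ∀ x ∈ X, ∀ z ∈ Z x, ∀ z' ∈ Z x, r (e x z) (e x z') ↔ t x z z')
    (hs : ∀ x ∈ X, ∀ z ∈ Z x, ∀ x' ∈ X, ∀ z' ∈ Z x', r (e x z) (e x' z') → s x x') :
    relSum s X (fun x => relSum (t x) (Z x) fun z => g (e x z)) = relSum r W g := by
  classical
  simp only [relSum]
  rw [Finset.sum_sigma']
  -- A pair of representatives is sent to the chosen representative of the class of `e x z`. The
  -- hypotheses say that this is a bijection.
  have hex : ∀ p ∈ (relReps s X).sigma fun x => relReps (t x) (Z x),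
      ∃ w ∈ relReps r W, r w (e p.1 p.2) := by
    intro p hp
    rw [Finset.mem_sigma] at hp
    exact exists_mem_relReps r (hW _ (mem_of_mem_relReps hp.1) _ (mem_of_mem_relReps hp.2))
  choose f hf hf' using hex
  refine Finset.sum_bij f hf ?_ ?_ ?_
  · rintro ⟨x, z⟩ hp ⟨x', z'⟩ hp' h
    have h1 := hf' _ hp
    rw [h] at h1
    have h2 := r.trans (r.symm h1) (hf' _ hp')
    rw [Finset.mem_sigma] at hp hp'
    have h3 := eq_of_mem_relReps hp.1 hp'.1 (hs _ (mem_of_mem_relReps hp.1) _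
      (mem_of_mem_relReps hp.2) _ (mem_of_mem_relReps hp'.1) _ (mem_of_mem_relReps hp'.2) h2)
    dsimp only at h3
    subst h3
    have h4 := eq_of_mem_relReps hp.2 hp'.2 ((ht _ (mem_of_mem_relReps hp.1) _
      (mem_of_mem_relReps hp.2) _ (mem_of_mem_relReps hp'.2)).1 h2)
    dsimp only at h4
    rw [h4]
  · intro w hw
    obtain ⟨x, hx, h⟩ := hsurj w (mem_of_mem_relReps hw)
    obtain ⟨x', hx', hxx'⟩ := exists_mem_relReps s hx
    obtain ⟨z, hz, hzw⟩ := h x' (mem_of_mem_relReps hx') hxx'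
    obtain ⟨z', hz', hzz'⟩ := exists_mem_relReps (t x') hz
    have hp : (⟨x', z'⟩ : Σ _ : α, β) ∈ (relReps s X).sigma fun x => relReps (t x) (Z x) :=
      Finset.mem_sigma.2 ⟨hx', hz'⟩
    refine ⟨_, hp, eq_of_mem_relReps (hf _ hp) hw ?_⟩
    have h5 := (ht x' (mem_of_mem_relReps hx') _ (mem_of_mem_relReps hz') _ hz).2 hzz'
    exact r.trans (hf' _ hp) (r.trans h5 hzw)
  · intro p hp
    have h1 := hf _ hp
    have h2 := hf' _ hp
    rw [Finset.mem_sigma] at hp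
    exact (hg _ (mem_of_mem_relReps h1) _
      (hW _ (mem_of_mem_relReps hp.1) _ (mem_of_mem_relReps hp.2)) h2).symm

/-- Only one class contributes, and it may be evaluated at any of its members, whatever
representative was chosen. -/
theorem relSum_eq_of_unique {s : Setoid α} {X : Set α} {g : α → N} {x : α} (hx : x ∈ X)
    (hg : ∀ y ∈ X, s y x → g y = g x) (h : ∀ y ∈ X, ¬ s y x → g y = 0) :
    relSum s X g = g x := by
  obtain ⟨y, hy, hyx⟩ := exists_mem_relReps s hx
  rw [relSum, Finset.sum_eq_single_of_mem y hy, hg y (mem_of_mem_relReps hy) hyx]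
  intro z hz hzy
  refine h z (mem_of_mem_relReps hz) fun hzx => hzy ?_
  exact eq_of_mem_relReps hz hy (s.trans hzx (s.symm hyx))

/-- Change of variables in a sum over representatives. -/
theorem relSum_reindex {s : Setoid α} {X : Set α} {r : Setoid γ} {W : Set γ} {g : γ → N}
    (e : α → γ) (hg : ∀ w ∈ W, ∀ w' ∈ W, r w w' → g w = g w') (hW : ∀ x ∈ X, e x ∈ W)
    (hsurj : ∀ w ∈ W, ∃ x ∈ X, r (e x) w)
    (hs : ∀ x ∈ X, ∀ x' ∈ X, r (e x) (e x') ↔ s x x') :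
    relSum s X (fun x => g (e x)) = relSum r W g := by
  rw [← relSum_nest (s := s) (X := X) (t := fun _ => (⊥ : Setoid Unit)) (Z := fun _ => Set.univ)
    (r := r) (W := W) (fun x _ => e x) hg (fun x hx _ _ => hW x hx)
    (fun w hw => ?_) (fun x hx z _ z' _ => ?_) (fun x hx _ _ x' hx' _ _ h => (hs x hx x' hx').1 h)]
  · refine relSum_congr fun x _ => ?_
    rw [relSum_eq_of_unique (x := ()) (Set.mem_univ _) (fun _ _ _ => rfl)
      (fun y _ h => absurd rfl h)]
  · obtain ⟨x, hx, h⟩ := hsurj w hw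
    exact ⟨x, hx, fun x' hx' hxx' => ⟨(), Set.mem_univ _, r.trans ((hs x' hx' x hx).2 hxx') h⟩⟩
  · exact iff_of_true (r.refl _) rfl

theorem relSum_bot_univ (g : α → N) : relSum (⊥ : Setoid α) Set.univ g = ∑ᶠ x, g x := by
  classical
  have := Fintype.ofFinite α
  rw [finsum_eq_sum_of_fintype, relSum]
  congr 1
  rw [Finset.eq_univ_iff_forall]
  intro x
  obtain ⟨y, hy, h⟩ := exists_mem_relReps (⊥ : Setoid α) (Set.mem_univ x)
  have : y = x := h
  rwa [← this]

end RelSum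

/-! ### Double cosets and slices of graphs. -/

namespace FusionSystem

variable {T : Type u} [Group T]

/-- The relation `x ∼ b x l`, for `b` in the second projection of `D` and `l ∈ L`. -/
def cosetRel (D : Subgroup (T × T)) (L : Subgroup T) : Setoid T where
  r x y := ∃ b ∈ p2 D, ∃ l ∈ L, y = b * x * l
  iseqv :=
    { refl := fun x => ⟨1, one_mem _, 1, one_mem _, by simp⟩
      symm := by
        rintro x y ⟨b, hb, l, hl, rfl⟩
        exact ⟨b⁻¹, inv_mem hb, l⁻¹, inv_mem hl, by group⟩
      trans := by
        rintro x y z ⟨b, hb, l, hl, rfl⟩ ⟨b', hb', l', hl', rfl⟩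
        exact ⟨b' * b, mul_mem hb' hb, l * l', mul_mem hl hl', by group⟩ }

theorem cosetRel_iff {D : Subgroup (T × T)} {L : Subgroup T} {x y : T} :
    cosetRel D L x y ↔ ∃ b ∈ p2 D, ∃ l ∈ L, y = b * x * l := Iff.rfl

/-- A sum over double cosets inside `J` as a sum over representatives. -/
theorem finsum_doubleCoset [Finite T] {N : Type*} [AddCommMonoid N] {D : Subgroup (T × T)}
    {K L J : Subgroup T} (hD : p2 D = K) (hK : K ≤ J) (hL : L ≤ J) (g : T → N)
    (hg : ∀ x ∈ J, ∀ y ∈ J, cosetRel D L x y → g x = g y) :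
    ∑ᶠ q : DoubleCoset.Quotient (K.subgroupOf J : Set J) (L.subgroupOf J : Set J),
      g (q.out : T) = relSum (cosetRel D L) J g := by
  have : Finite (DoubleCoset.Quotient (K.subgroupOf J : Set J) (L.subgroupOf J : Set J)) :=
    inferInstanceAs (Finite (_root_.Quotient _))
  rw [← relSum_bot_univ]
  have hrel : ∀ x y : J, DoubleCoset.setoid (K.subgroupOf J : Set J) (L.subgroupOf J : Set J) x y ↔
      cosetRel D L (x : T) y := by
    intro x y
    rw [DoubleCoset.rel_iff, cosetRel_iff, hD]
    constructor
    · rintro ⟨a, ha, b, hb, rfl⟩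
      exact ⟨a, ha, b, hb, rfl⟩
    · rintro ⟨a, ha, b, hb, h⟩
      exact ⟨⟨a, hK ha⟩, ha, ⟨b, hL hb⟩, hb, Subtype.ext h⟩
  refine relSum_reindex _ hg (fun x _ => x.out.2) (fun w hw => ?_) (fun x _ y _ => ?_)
  · refine ⟨Quotient.mk _ ⟨w, hw⟩, Set.mem_univ _, ?_⟩
    rw [← hrel _ ⟨w, hw⟩]
    exact Quotient.exact (Quotient.out_eq _)
  · rw [← hrel]
    constructor
    · intro h
      have := Quotient.sound h
      exact (Quotient.out_eq x).symm.trans (this.trans (Quotient.out_eq y))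
    · intro h
      have : x = y := h
      rw [this]

/-- The relation `D` restricted along conjugation by `x`: all `(a, b)` with `b ∈ L` and
`(a, x b x⁻¹) ∈ D`. -/
def slice (D : Subgroup (T × T)) (L : Subgroup T) (x : T) : Subgroup (T × T) :=
  MulAut.conj ((1, x⁻¹) : T × T) • D ⊓ Subgroup.comap (MonoidHom.snd T T) L

theorem mem_slice {D : Subgroup (T × T)} {L : Subgroup T} {x a b : T} :
    (a, b) ∈ slice D L x ↔ b ∈ L ∧ (a, x * b * x⁻¹) ∈ D := by
  rw [slice, Subgroup.mem_inf, mem_conj_smul, and_comm]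
  simp

theorem p2_slice_le (D : Subgroup (T × T)) (L : Subgroup T) (x : T) : p2 (slice D L x) ≤ L := by
  intro b hb
  obtain ⟨a, h⟩ := mem_p2.1 hb
  exact h.2

theorem p1_slice_le (D : Subgroup (T × T)) (L : Subgroup T) (x : T) :
    p1 (slice D L x) ≤ p1 D := by
  intro a ha
  obtain ⟨b, h⟩ := mem_p1.1 ha
  exact mem_p1.2 ⟨_, (mem_slice.1 h).2⟩

/-- Transitivity of induction at the level of graphs: double coset representatives multiply. -/
theorem slice_slice (D : Subgroup (T × T)) {K L : Subgroup T} (h : L ≤ K) (x : T) {y : T}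
    (hy : y ∈ K) : slice (slice D K x) L y = slice D L (x * y) := by
  ext ⟨a, b⟩
  simp only [mem_slice]
  have e : x * (y * b * y⁻¹) * x⁻¹ = x * y * b * (x * y)⁻¹ := by group
  rw [e]
  exact ⟨fun h => ⟨h.1, h.2.2⟩, fun hb => ⟨hb.1, mul_mem (mul_mem hy (h hb.1)) (inv_mem hy), hb.2⟩⟩

theorem slice_one {D : Subgroup (T × T)} {L : Subgroup T} (h : p2 D ≤ L) : slice D L 1 = D := by
  ext ⟨a, b⟩
  rw [mem_slice, one_mul, inv_one, mul_one]
  exact ⟨fun h => h.2, fun hd => ⟨h (snd_mem_p2 hd), hd⟩⟩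

/-- Another representative of the same double coset changes the slice only by a conjugation. The
terms of the Mackey formula will therefore not depend on the choice. -/
theorem slice_mul {D : Subgroup (T × T)} {L : Subgroup T} {x l : T} {d : T × T} (hd : d ∈ D)
    (hl : l ∈ L) :
    slice D L (d.2 * x * l) = MulAut.conj ((d.1, l⁻¹) : T × T) • slice D L x := by
  ext ⟨a, b⟩
  rw [mem_slice, mem_conj_smul]
  change _ ↔ (d.1⁻¹ * a * d.1, (l⁻¹)⁻¹ * b * l⁻¹) ∈ _
  rw [mem_slice, inv_inv]
  refine and_congr ?_ ?_
  · constructor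
    · exact fun h => mul_mem (mul_mem hl h) (inv_mem hl)
    · intro h
      have := mul_mem (mul_mem (inv_mem hl) h) hl
      convert this using 1
      group
  · have : (a, d.2 * x * l * b * (d.2 * x * l)⁻¹) =
        d * (d.1⁻¹ * a * d.1, x * (l * b * l⁻¹) * x⁻¹) * d⁻¹ := by
      refine Prod.ext ?_ ?_
      · simp only [Prod.fst_mul, Prod.fst_inv]; group
      · simp only [Prod.snd_mul, Prod.snd_inv]; group
    rw [this]
    constructor
    · intro h
      have := mul_mem (mul_mem (inv_mem hd) h) hd
      convert this using 1
      group
    · exact fun h => mul_mem (mul_mem hd h) (inv_mem hd)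

variable {F : FusionSystem T}

theorem IsGr.slice {D : Subgroup (T × T)} (h : F.IsGr D) (L : Subgroup T) {x : T} (hx : x ∈ F.S) :
    F.IsGr (slice D L x) :=
  (h.conj_smul (g := (1, x⁻¹)) (one_mem _) (inv_mem hx)).mono inf_le_left

end FusionSystem

/-! ### Normal forms in the Mackey algebra -/

namespace MackeyAlgebra

variable {T : Type u} [Group T] (R : Type u) [CommRing R] (F : FusionSystem T)

open Classical in
/-- `I_A^B`, extended by `0`. -/
noncomputable def iA (A B : Subgroup T) : MackeyAlgebra R F :=
  if h : A ≤ B ∧ B ≤ F.S then ind R h.1 h.2 else 0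

open Classical in
/-- `c_φ⁻¹ R_{φ(P)}^K` for the morphism `φ : P → K` with graph `D`, extended by `0`. -/
noncomputable def rho (D : Subgroup (T × T)) (K : Subgroup T) : MackeyAlgebra R F :=
  if h : ∃ (P Q : Subgroup T) (φ : P ≃* Q), F.IsIso φ ∧ Q ≤ K ∧ K ≤ F.S ∧ D = gr φ.toMonoidHom
  then conj R (isIso_symm h.choose_spec.choose_spec.choose_spec.1) *
    res R h.choose_spec.choose_spec.choose_spec.2.1 h.choose_spec.choose_spec.choose_spec.2.2.1
  else 0

/-- `I_{φ(P)}^K c_φ` for the morphism `φ : P → K` with graph `D`. -/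
noncomputable def lam (D : Subgroup (T × T)) (K : Subgroup T) : MackeyAlgebra R F :=
  iA R F (p2 D) K * rho R F (swap D) (p1 D)

/-- `c_{c_h}` on `A`. -/
noncomputable def cA (A : Subgroup T) (h : T) : MackeyAlgebra R F :=
  rho R F (swap (conjGr h A)) A

variable {F} {A B K L J P Q : Subgroup T} {D E : Subgroup (T × T)}

theorem iA_eq (h : A ≤ B) (hB : B ≤ F.S) : iA R F A B = ind R h hB := dif_pos ⟨h, hB⟩

theorem swap_gr (φ : P ≃* Q) : swap (gr φ.toMonoidHom) = gr φ.symm.toMonoidHom := by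
  ext d
  rw [mem_swap, mem_gr, mem_gr]
  constructor
  · rintro ⟨x, h1, h2⟩
    exact ⟨φ x, h2, by simpa using h1⟩
  · rintro ⟨x, h1, h2⟩
    exact ⟨φ.symm x, h2, by simpa using h1⟩

theorem gr_injective {P' Q' : Subgroup T} {φ : P ≃* Q} {φ' : P' ≃* Q'}
    (h : gr φ.toMonoidHom = gr φ'.toMonoidHom) :
    P = P' ∧ Q = Q' ∧ ∀ x : P, ∀ x' : P', (x : T) = x' → (φ x : T) = φ' x' := by
  have hP : P = P' := by rw [← p1_gr φ.toMonoidHom, h, p1_gr]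
  have hQ : Q = Q' := by rw [← p2_gr_equiv φ, h, p2_gr_equiv]
  refine ⟨hP, hQ, fun x x' hx => ?_⟩
  have : ((x : T), (φ x : T)) ∈ gr φ'.toMonoidHom := by
    rw [← h]
    exact mem_gr.2 ⟨x, rfl, rfl⟩
  obtain ⟨y, h1, h2⟩ := mem_gr.1 this
  have : y = x' := Subtype.ext (h1.trans hx)
  rw [← this]
  exact h2.symm

/-- A graph determines its isomorphism together with source and target, so the choices hidden in
`rho` do not matter. -/
theorem rho_gr {φ : P ≃* Q} (hφ : F.IsIso φ) (hQ : Q ≤ K) (hK : K ≤ F.S) :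
    rho R F (gr φ.toMonoidHom) K = conj R (isIso_symm hφ) * res R hQ hK := by
  have h : ∃ (P' Q' : Subgroup T) (φ' : P' ≃* Q'), F.IsIso φ' ∧ Q' ≤ K ∧ K ≤ F.S ∧
    gr φ.toMonoidHom = gr φ'.toMonoidHom := ⟨P, Q, φ, hφ, hQ, hK, rfl⟩
  rw [rho, dif_pos h]
  have key : ∀ (P' Q' : Subgroup T) (φ' : P' ≃* Q') (hφ' : F.IsIso φ') (hQ' : Q' ≤ K),
      gr φ.toMonoidHom = gr φ'.toMonoidHom →
      conj R (isIso_symm hφ') * res R hQ' hK = conj R (isIso_symm hφ) * res R hQ hK := by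
    intro P' Q' φ' hφ' hQ' e
    obtain ⟨rfl, rfl, e⟩ := gr_injective e
    have : φ = φ' := MulEquiv.ext fun x => Subtype.ext (e x x rfl)
    subst this
    rfl
  exact key _ _ _ h.choose_spec.choose_spec.choose_spec.1
    h.choose_spec.choose_spec.choose_spec.2.1 h.choose_spec.choose_spec.choose_spec.2.2.2

theorem rho_eq_zero (h : ¬ (F.IsGr D ∧ p2 D ≤ K ∧ K ≤ F.S)) : rho R F D K = 0 := by
  rw [rho, dif_neg]
  rintro ⟨P, Q, φ, hφ, hQ, hK, rfl⟩
  exact h ⟨isGr_gr hφ, by rwa [p2_gr_equiv], hK⟩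

theorem iA_eq_zero (h : ¬ (A ≤ B ∧ B ≤ F.S)) : iA R F A B = 0 := dif_neg h

theorem iA_mul_iA (h : A ≤ B) (h' : B ≤ K) : iA R F B K * iA R F A B = iA R F A K := by
  by_cases hK : K ≤ F.S
  · rw [iA_eq R h' hK, iA_eq R h (h'.trans hK), iA_eq R (h.trans h') hK]
    have := mk_rel R (Rel.ind_ind (F := F) (R := R) A B K h h' hK)
    rwa [map_mul] at this
  · rw [iA_eq_zero R (B := K) fun h => hK h.2, iA_eq_zero R (B := K) fun h => hK h.2, zero_mul]

theorem iA_self_mul_of_ne (h : A ≠ B) : iA R F A A * iA R F B B = 0 := by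
  by_cases hA : A ≤ F.S
  · by_cases hB : B ≤ F.S
    · rw [iA_eq R le_rfl hA, iA_eq R le_rfl hB, ind_orthogonal R hA hB h]
    · rw [iA_eq_zero R (B := B) fun h => hB h.2, mul_zero]
  · rw [iA_eq_zero R (B := A) fun h => hA h.2, zero_mul]

/-- Multiplication of normal forms. -/
theorem rho_mul_rho (hD : F.IsGr D) (hE : F.IsGr E) (h : p2 D ≤ p1 E) (hEK : p2 E ≤ K)
    (hK : K ≤ F.S) : rho R F D (p1 E) * rho R F E K = rho R F (relComp D E) K := by
  obtain ⟨φ, hφ, e⟩ := hD.exists_iso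
  obtain ⟨ψ, hψ, e'⟩ := hE.exists_iso
  -- The restriction of `E` to the image of `D`: through it the restriction in the first factor
  -- moves past the conjugation in the second.
  set E' := E ⊓ Subgroup.comap (MonoidHom.fst T T) (p2 D) with hE'
  have hgE' : F.IsGr E' := hE.mono inf_le_left
  have hp1 : p1 E' = p2 D := by
    ext x
    constructor
    · intro hx
      obtain ⟨b, hb⟩ := mem_p1.1 hx
      exact hb.2
    · intro hx
      obtain ⟨b, hb⟩ := mem_p1.1 (h hx)
      exact mem_p1.2 ⟨b, hb, hx⟩
  obtain ⟨ψ', hψ', e''⟩ := hgE'.exists_iso' hp1 rfl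
  have hp2 : p2 E' ≤ p2 E := p2_mono inf_le_left
  have hcomp : relComp D E = gr (φ.trans ψ').toMonoidHom := by
    ext d
    rw [mem_relComp, mem_gr]
    constructor
    · rintro ⟨b, h1, h2⟩
      have h3 : (b, d.2) ∈ E' := ⟨h2, snd_mem_p2 h1⟩
      rw [e] at h1
      rw [e''] at h3
      obtain ⟨x, k1, k2⟩ := mem_gr.1 h1
      obtain ⟨y, l1, l2⟩ := mem_gr.1 h3
      refine ⟨x, k1, ?_⟩
      have : φ x = y := Subtype.ext (k2.trans l1.symm)
      rw [← show (ψ' y : T) = d.2 from l2, ← this]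
      rfl
    · rintro ⟨x, k1, k2⟩
      have h1 : ((φ x : T), d.2) ∈ E' := by
        exact e''.ge (mem_gr.2 ⟨φ x, rfl, k2⟩)
      refine ⟨φ x, ?_, h1.1⟩
      exact e.ge (mem_gr.2 ⟨x, k1, rfl⟩)
  have h1 := rho_gr R hφ h hE.p1_le
  have h2 := rho_gr R hψ hEK hK
  rw [← e] at h1
  rw [← e'] at h2
  rw [h1, h2, hcomp, rho_gr R (isIso_trans hφ hψ') (hp2.trans hEK) hK]
  have h3 := mk_rel R (Rel.conj_res (F := F) (R := R) (p2 E') (p2 E) (p2 D) (p1 E)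
    hp2 hE.p2_le h hE.p1_le ψ.symm (isIso_symm hψ) ψ'.symm (isIso_symm hψ') (by
      intro y
      have : ((ψ'.symm y : T), (y : T)) ∈ E := by
        have : ((ψ'.symm y : T), (y : T)) ∈ E' := by
          exact e''.ge (mem_gr.2 ⟨ψ'.symm y, rfl, by simp⟩)
        exact this.1
      refine hE.fst_eq this ?_
      exact e'.ge (mem_gr.2 ⟨ψ.symm (Subgroup.inclusion hp2 y), rfl, by simp⟩)))
  have h4 := mk_rel R (Rel.conj_conj (F := F) (R := R) _ _ _ ψ'.symm φ.symm
    (isIso_symm hψ') (isIso_symm hφ))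
  have h5 := mk_rel R (Rel.res_res (F := F) (R := R) _ _ _ hp2 hEK hK)
  rw [map_mul, map_mul] at h3
  rw [map_mul] at h4 h5
  change conj R (isIso_symm hψ') * res R hp2 _ = res R h _ * conj R (isIso_symm hψ) at h3
  change conj R (isIso_symm hφ) * conj R (isIso_symm hψ') =
    conj R (isIso_symm (isIso_trans hφ hψ')) at h4
  change res R hp2 _ * res R hEK hK = res R (hp2.trans hEK) hK at h5
  calc _ = conj R (isIso_symm hφ) * (res R h hE.p1_le * conj R (isIso_symm hψ)) *
        res R hEK hK := by simp only [mul_assoc]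
    _ = conj R (isIso_symm hφ) * conj R (isIso_symm hψ') * (res R hp2 hE.p2_le * res R hEK hK) := by
      rw [← h3]
      simp only [mul_assoc]
    _ = _ := by rw [h4, h5]

theorem rho_mul_rho' (hD : F.IsGr D) (hE : F.IsGr E) (hA : p1 E = A) (h : p2 D ≤ A)
    (hEK : p2 E ≤ K) (hK : K ≤ F.S) : rho R F D A * rho R F E K = rho R F (relComp D E) K := by
  subst hA
  exact rho_mul_rho R hD hE h hEK hK

/-- With `conj_eq_rho` this turns restrictions and conjugations into the same kind of element, so
that multiplying them becomes composing graphs. -/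
theorem res_eq_rho (h : A ≤ B) (hB : B ≤ F.S) : res R h hB = rho R F (diag A) B := by
  have := rho_gr R (isIso_refl (h.trans hB)) h hB
  refine Eq.trans ?_ this.symm
  have h2 : conj R (isIso_symm (isIso_refl (F := F) (h.trans hB))) =
    conj R (isIso_refl (F := F) (h.trans hB)) := rfl
  rw [h2, conj_refl R (h.trans hB), mul_res]

theorem conj_eq_rho {θ : P ≃* Q} (hθ : F.IsIso θ) :
    conj R hθ = rho R F (swap (gr θ.toMonoidHom)) P := by
  rw [swap_gr, rho_gr R (isIso_symm hθ) le_rfl (F.le_of_mem hθ).1, res_self]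
  exact (conj_mul R hθ _).symm

theorem iA_self (hA : A ≤ F.S) : iA R F A A = rho R F (diag A) A := by
  rw [iA_eq R le_rfl hA, ← res_self, res_eq_rho]

theorem rho_of_conj_self (hA : A ≤ F.S) {h : T} (hh : h ∈ A) : cA R F A h = iA R F A A := by
  have hsm : MulAut.conj h • A = A := conj_smul_eq_of_mem_normalizer (Subgroup.le_normalizer hh)
  have hiso : F.IsIso ((conjIso h A).trans (MulEquiv.subgroupCongr hsm)) :=
    F.conj_mem hA hA (hA hh) fun x => rfl
  have h1 := conj_eq_rho R hiso
  rw [iA_eq R le_rfl hA, ← show conj R hiso = ind R le_rfl hA from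
    mk_rel R (Rel.conj_self A hA _ hiso h hh fun y => rfl), h1, cA]
  congr 2

theorem relComp_diag_left :
    relComp (diag A) D = D ⊓ Subgroup.comap (MonoidHom.fst T T) A := by
  ext ⟨a, c⟩
  rw [mem_relComp]
  constructor
  · rintro ⟨b, h1, h2⟩
    obtain ⟨k1, k2⟩ := mem_diag.1 h1
    have : a = b := k2
    subst this
    exact ⟨h2, k1⟩
  · rintro ⟨h1, h2⟩
    exact ⟨a, mem_diag.2 ⟨h2, rfl⟩, h1⟩

theorem relComp_diag_right (h : p2 D ≤ A) : relComp D (diag A) = D := by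
  ext ⟨a, c⟩
  rw [mem_relComp]
  constructor
  · rintro ⟨b, h1, h2⟩
    have : b = c := (mem_diag.1 h2).2
    subst this
    exact h1
  · intro h1
    exact ⟨c, h1, mem_diag.2 ⟨h (snd_mem_p2 h1), rfl⟩⟩

theorem IsGr.inf_comap_p1 (hD : F.IsGr D) (h : E ≤ D) :
    D ⊓ Subgroup.comap (MonoidHom.fst T T) (p1 E) = E := by
  symm
  refine (hD.mono inf_le_left).eq_of_le (le_inf h fun d hd => fst_mem_p1 hd) ?_
  intro x hx
  obtain ⟨b, -, hb⟩ := mem_p1.1 hx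
  exact hb

/-- Restriction in the source. -/
theorem rho_res_left (hD : F.IsGr D) (hK : p2 D ≤ K) (hKS : K ≤ F.S) (h : E ≤ D) :
    rho R F (diag (p1 E)) (p1 D) * rho R F D K = rho R F E K := by
  rw [rho_mul_rho R (isGr_diag ((p1_mono h).trans hD.p1_le)) hD
    (by rw [p2_diag]; exact p1_mono h) hK hKS, relComp_diag_left,
    IsGr.inf_comap_p1 hD h]

theorem rho_res_right (hD : F.IsGr D) (hL : p2 D ≤ L) (hK : L ≤ K) (hKS : K ≤ F.S) :
    rho R F D L * rho R F (diag L) K = rho R F D K := by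
  rw [rho_mul_rho' R hD (isGr_diag (hK.trans hKS)) (p1_diag L) hL (by rwa [p2_diag]) hKS,
    relComp_diag_right hL]

theorem iA_mul_rho (D : Subgroup (T × T)) (K : Subgroup T) :
    iA R F (p1 D) (p1 D) * rho R F D K = rho R F D K := by
  by_cases h : F.IsGr D ∧ p2 D ≤ K ∧ K ≤ F.S
  · rw [iA_self R h.1.p1_le, rho_res_left R h.1 h.2.1 h.2.2 le_rfl]
  · rw [rho_eq_zero R h, mul_zero]

theorem rho_mul_iA_self (D : Subgroup (T × T)) (K : Subgroup T) :
    rho R F D K * iA R F K K = rho R F D K := by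
  by_cases h : F.IsGr D ∧ p2 D ≤ K ∧ K ≤ F.S
  · rw [iA_self R h.2.2, rho_res_right R h.1 h.2.1 le_rfl h.2.2]
  · rw [rho_eq_zero R h, zero_mul]

theorem relComp_conjGr_left {h : T} :
    relComp (swap (conjGr h (p1 D))) D = MulAut.conj ((h, 1) : T × T) • D := by
  ext ⟨a, c⟩
  rw [mem_relComp, mem_conj_smul]
  constructor
  · rintro ⟨b, h1, h2⟩
    have : a = h * b * h⁻¹ := (mem_conjGr.1 (mem_swap.1 h1)).2
    subst this
    convert h2 using 1
    refine Prod.ext ?_ ?_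
    · simp only [Prod.fst_mul, Prod.fst_inv]; group
    · simp
  · intro hd
    refine ⟨h⁻¹ * a * h, mem_swap.2 (mem_conjGr.2 ⟨(fst_mem_p1 hd :), ?_⟩), ?_⟩
    · simp only; group
    · convert hd using 1
      refine Prod.ext rfl ?_
      simp

theorem relComp_conjGr_right {k : T} (hD : p2 D ≤ K) :
    relComp D (conjGr k K) = MulAut.conj ((1, k) : T × T) • D := by
  ext ⟨a, c⟩
  rw [mem_relComp, mem_conj_smul]
  constructor
  · rintro ⟨b, h1, h2⟩
    have : c = k * b * k⁻¹ := (mem_conjGr.1 h2).2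
    subst this
    convert h1 using 1
    refine Prod.ext ?_ ?_
    · simp
    · simp only [Prod.snd_mul, Prod.snd_inv]; group
  · intro hd
    have h1 : ((1, k) : T × T)⁻¹ * (a, c) * (1, k) = (a, k⁻¹ * c * k) := by
      refine Prod.ext ?_ rfl
      simp
    rw [h1] at hd
    exact ⟨k⁻¹ * c * k, hd, mem_conjGr.2 ⟨hD (snd_mem_p2 hd), by simp only; group⟩⟩

theorem rho_conj_fst (hD : F.IsGr D) (hK : p2 D ≤ K) (hKS : K ≤ F.S) {h : T} (hh : h ∈ F.S) :
    rho R F (MulAut.conj ((h, 1) : T × T) • D) K = cA R F (p1 D) h * rho R F D K := by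
  rw [cA, rho_mul_rho R (isGr_conjGr hh hD.p1_le).swap hD (by rw [p2_swap, p1_conjGr]) hK hKS,
    relComp_conjGr_left]

theorem swap_swap (D : Subgroup (T × T)) : swap (swap D) = D := rfl

theorem swap_conj_smul (h k : T) (D : Subgroup (T × T)) :
    swap (MulAut.conj ((h, k) : T × T) • D) = MulAut.conj ((k, h) : T × T) • swap D := by
  ext ⟨a, b⟩
  rw [mem_swap, mem_conj_smul, mem_conj_smul]
  exact Iff.rfl

theorem swap_conjGr (h : T) (A : Subgroup T) :
    swap (conjGr h A) = conjGr h⁻¹ (MulAut.conj h • A) := by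
  ext ⟨a, b⟩
  rw [mem_swap, mem_conjGr, mem_conjGr, mem_conj_smul]
  simp only [inv_inv]
  constructor
  · rintro ⟨h1, rfl⟩
    exact ⟨by convert h1 using 1; group, by group⟩
  · rintro ⟨h1, rfl⟩
    exact ⟨h1, by group⟩

/-- Conjugation by an element of `K` acts on level `K` as I_K^K, so it is absorbed. This is why
morphisms to `K` matter only modulo inner automorphisms of `K`. -/
theorem rho_conj_snd (hD : F.IsGr D) (hK : p2 D ≤ K) (hKS : K ≤ F.S) {k : T} (hk : k ∈ K) :
    rho R F (MulAut.conj ((1, k) : T × T) • D) K = rho R F D K := by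
  have hsm : MulAut.conj k • K = K := conj_smul_eq_of_mem_normalizer (Subgroup.le_normalizer hk)
  have h1 := rho_of_conj_self (F := F) R hKS (inv_mem hk)
  rw [cA, swap_conjGr, inv_inv,
    conj_smul_eq_of_mem_normalizer (Subgroup.le_normalizer (inv_mem hk))] at h1
  conv_rhs => rw [← rho_mul_iA_self, ← h1]
  rw [rho_mul_rho' R hD (isGr_conjGr (hKS hk) hKS) (p1_conjGr k K) hK
    (by rw [p2_conjGr, hsm]) hKS, relComp_conjGr_right hK]

theorem rho_conj (hD : F.IsGr D) (hK : p2 D ≤ K) (hKS : K ≤ F.S) {g : T × T} (hh : g.1 ∈ F.S)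
    (hk : g.2 ∈ K) : rho R F (MulAut.conj g • D) K = cA R F (p1 D) g.1 * rho R F D K := by
  obtain ⟨h, k⟩ := g
  have hh : h ∈ F.S := hh
  have hk : k ∈ K := hk
  have hg : MulAut.conj ((h, k) : T × T) • D =
      MulAut.conj ((1, k) : T × T) • MulAut.conj ((h, 1) : T × T) • D := by
    rw [conj_smul_smul]
    simp
  rw [hg, rho_conj_snd R (hD.conj_smul hh (one_mem _))
    (by rw [p2_conj_smul, conj_one_smul]; exact hK) hKS hk, rho_conj_fst R hD hK hKS hh]

/-- Conjugation and induction. -/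
theorem rho_mul_iA (hD : F.IsGr D) (h : E ≤ D) :
    rho R F D (p2 D) * iA R F (p2 E) (p2 D) = iA R F (p1 E) (p1 D) * rho R F E (p2 E) := by
  obtain ⟨φ, hφ, e⟩ := hD.exists_iso
  obtain ⟨ψ, hψ, e'⟩ := (hD.mono h).exists_iso
  have h1 := rho_gr R hφ le_rfl hD.p2_le
  have h2 := rho_gr R hψ le_rfl (hD.mono h).p2_le
  rw [← e] at h1
  rw [← e'] at h2
  rw [h1, h2, iA_eq R (p2_mono h) hD.p2_le, iA_eq R (p1_mono h) hD.p1_le, res_self, res_self,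
    conj_mul, conj_mul]
  have h3 := mk_rel R (Rel.conj_ind (F := F) (R := R) _ _ _ _ (p2_mono h) hD.p2_le (p1_mono h)
    hD.p1_le φ.symm (isIso_symm hφ) ψ.symm (isIso_symm hψ) (by
      intro y
      have : ((ψ.symm y : T), (y : T)) ∈ E := by
        exact e'.ge (mem_gr.2 ⟨ψ.symm y, rfl, by simp⟩)
      refine hD.fst_eq (h this) ?_
      exact e.ge (mem_gr.2 ⟨φ.symm (Subgroup.inclusion (p2_mono h) y), rfl, by simp⟩)))
  rw [map_mul, map_mul] at h3
  exact h3

theorem iA_conj (hB : B ≤ F.S) (hA : A ≤ B) {h : T} (hh : h ∈ B) :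
    iA R F (MulAut.conj h • A) B * cA R F A h = iA R F A B := by
  have hsm : MulAut.conj h • B = B := conj_smul_eq_of_mem_normalizer (Subgroup.le_normalizer hh)
  have h1 := rho_mul_iA R (isGr_conjGr (hB hh) hB).swap
    (E := swap (conjGr h A)) (by
      rintro ⟨a, b⟩ hd
      have := mem_conjGr.1 (mem_swap.1 hd)
      exact mem_swap.2 (mem_conjGr.2 ⟨hA this.1, this.2⟩))
  rw [p2_swap, p2_swap, p1_swap, p1_swap, p1_conjGr, p1_conjGr, p2_conjGr, p2_conjGr, hsm] at h1
  change cA R F B h * _ = _ * cA R F A h at h1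
  rw [← h1, rho_of_conj_self R hB hh, iA_mul_iA R hA le_rfl]

/-- The two slices are conjugate by an element of p1 D × L. The component in `L` is absorbed by
restriction from `L`, the one in the source of `D` by induction to that source. -/
theorem iA_slice_rho_eq (hD : F.IsGr D) (hKS : K ≤ F.S) (hL : L ≤ K) {x y : T}
    (hx : x ∈ K) (h : cosetRel D L x y) :
    iA R F (p1 (slice D L x)) (p1 D) * rho R F (slice D L x) L =
      iA R F (p1 (slice D L y)) (p1 D) * rho R F (slice D L y) L := by
  obtain ⟨b, hb, l, hl, rfl⟩ := h
  obtain ⟨a, ha⟩ := mem_p2.1 hb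
  have haS := hD.p1_le (mem_p1.2 ⟨b, ha⟩)
  rw [slice_mul ha hl, rho_conj R (hD.slice L (hKS hx)) (p2_slice_le _ _ _) (hL.trans hKS) haS
    (inv_mem hl), p1_conj_smul, ← mul_assoc, iA_conj R hD.p1_le (p1_slice_le _ _ _)
    (mem_p1.2 ⟨b, ha⟩)]

end MackeyAlgebra

/-! ### The Mackey formula for normal forms, and their span. -/

namespace MackeyAlgebra

variable {T : Type u} [Group T] (R : Type u) [CommRing R] {F : FusionSystem T}
  {A B K L J P Q : Subgroup T} {D E : Subgroup (T × T)}

/-- The Mackey formula for normal forms. -/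
theorem rho_mul_ind [Finite T] (hD : F.IsGr D) (hK : p2 D ≤ K) (hKS : K ≤ F.S) (hL : L ≤ K) :
    rho R F D K * iA R F L K = relSum (cosetRel D L) K fun x =>
      iA R F (p1 (slice D L x)) (p1 D) * rho R F (slice D L x) L := by
  have : Finite (DoubleCoset.Quotient ((p2 D).subgroupOf K : Set K) (L.subgroupOf K : Set K)) :=
    inferInstanceAs (Finite (_root_.Quotient _))
  have := Fintype.ofFinite
    (DoubleCoset.Quotient ((p2 D).subgroupOf K : Set K) (L.subgroupOf K : Set K))
  rw [← finsum_doubleCoset (D := D) rfl hK hL (fun x => iA R F (p1 (slice D L x)) (p1 D) *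
    rho R F (slice D L x) L) fun x hx y _ h => iA_slice_rho_eq R hD hKS hL hx h,
    ← rho_res_right R hD le_rfl hK hKS, iA_eq R hL hKS, ← res_eq_rho R hK hKS, mul_assoc]
  have h1 := mk_rel R (Rel.mackey (F := F) (R := R) L (p2 D) K hL hK hKS)
  rw [map_mul, finsum_eq_sum_of_fintype, map_sum] at h1
  change res R hK hKS * ind R hL hKS = _ at h1
  rw [h1, Finset.mul_sum, finsum_eq_sum_of_fintype]
  refine Finset.sum_congr rfl fun q _ => ?_
  obtain ⟨x, hx⟩ := q.out
  obtain ⟨W, hW⟩ : ∃ W, interConj (p2 D) L x = W := ⟨_, rfl⟩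
  have hWL : W ≤ L := hW ▸ interConj_le _ _ _
  have hWQ : MulAut.conj x • W ≤ p2 D := hW ▸ conj_interConj_le _ _ _
  have hWS : W ≤ F.S := hWL.trans (hL.trans hKS)
  -- Moving c_φ⁻¹ past the induction restricts `D` to the points lying over the conjugate of `W`.
  -- This restriction has the same source as the slice, and its composite with the conjugation is
  -- the slice.
  have key : rho R F D (p2 D) * (ind R hWQ (hK.trans hKS) *
      conj R (isIso_conjIso (hKS hx) hWS) * res R hWL (hL.trans hKS)) =
      iA R F (p1 (slice D L x)) (p1 D) * rho R F (slice D L x) L := by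
    have hgE : F.IsGr (D ⊓ Subgroup.comap (MonoidHom.snd T T) (MulAut.conj x • W)) :=
      hD.mono inf_le_left
    have hgC := (isGr_conjGr (F := F) (hKS hx) hWS).swap
    have hE2 : p2 (D ⊓ Subgroup.comap (MonoidHom.snd T T) (MulAut.conj x • W)) =
        MulAut.conj x • W := by
      ext b
      rw [mem_p2]
      constructor
      · rintro ⟨a, -, h⟩
        exact h
      · intro hb
        obtain ⟨a, ha⟩ := mem_p2.1 (hWQ hb)
        exact ⟨a, ha, hb⟩
    have hmemW : ∀ b, b ∈ MulAut.conj x • W ↔ b ∈ p2 D ∧ x⁻¹ * b * x ∈ L := by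
      intro b
      rw [mem_conj_smul, ← hW, interConj, Subgroup.mem_inf, mem_conj_smul]
      refine and_congr_left fun _ => iff_of_eq (congrArg (· ∈ p2 D) ?_)
      group
    have hE1 : p1 (D ⊓ Subgroup.comap (MonoidHom.snd T T) (MulAut.conj x • W)) =
        p1 (slice D L x) := by
      ext a
      rw [mem_p1, mem_p1]
      constructor
      · rintro ⟨b, h, h'⟩
        refine ⟨x⁻¹ * b * x, mem_slice.2 ⟨((hmemW b).1 h').2, ?_⟩⟩
        have e : x * (x⁻¹ * b * x) * x⁻¹ = b := by group
        rw [e]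
        exact h
      · rintro ⟨b, h⟩
        obtain ⟨h1, h2⟩ := mem_slice.1 h
        refine ⟨_, h2, (hmemW _).2 ⟨snd_mem_p2 h2, ?_⟩⟩
        have e : x⁻¹ * (x * b * x⁻¹) * x = b := by group
        exact e.symm ▸ h1
    have hcomp : relComp (relComp (D ⊓ Subgroup.comap (MonoidHom.snd T T) (MulAut.conj x • W))
        (swap (conjGr x W))) (diag W) = slice D L x := by
      rw [relComp_diag_right]
      · ext ⟨a, b⟩
        rw [mem_relComp, mem_slice]
        constructor
        · rintro ⟨c, ⟨h1, -⟩, h2⟩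
          obtain ⟨k1, k2⟩ := mem_conjGr.1 (mem_swap.1 h2)
          have k2 : c = x * b * x⁻¹ := k2
          subst k2
          exact ⟨hWL k1, h1⟩
        · rintro ⟨h1, h2⟩
          have e : x⁻¹ * (x * b * x⁻¹) * x = b := by group
          have h3 := (hmemW (x * b * x⁻¹)).2 ⟨snd_mem_p2 h2, e.symm ▸ h1⟩
          refine ⟨_, ⟨h2, h3⟩, mem_swap.2 (mem_conjGr.2 ⟨?_, rfl⟩)⟩
          rw [mem_conj_smul, e] at h3
          exact h3
      · intro b hb
        obtain ⟨a, c, -, h⟩ := mem_p2.1 hb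
        exact (mem_conjGr.1 (mem_swap.1 h)).1
    have h2 : conj R (isIso_conjIso (F := F) (hKS hx) hWS) = rho R F (swap (conjGr x W)) W :=
      conj_eq_rho R _
    have h3 := rho_mul_iA R hD (E := D ⊓ Subgroup.comap (MonoidHom.snd T T) (MulAut.conj x • W))
      inf_le_left
    rw [hE2, hE1] at h3
    rw [← iA_eq R hWQ, h2, res_eq_rho, ← mul_assoc, ← mul_assoc, h3, mul_assoc, mul_assoc,
      ← mul_assoc (rho R F _ _), rho_mul_rho' R hgE hgC (by rw [p1_swap, p2_conjGr]) hE2.le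
        (by rw [p2_swap, p1_conjGr]) hWS, rho_mul_rho' R (hgE.relComp hgC)
        (isGr_diag hWS) (p1_diag W) ?_ (by rwa [p2_diag]) (hL.trans hKS), hcomp]
    intro b hb
    obtain ⟨a, c, -, h⟩ := mem_p2.1 hb
    exact (mem_conjGr.1 (mem_swap.1 h)).1
  subst hW
  rw [map_mul, map_mul]
  exact key

theorem one_eq_sum [Finite T] :
    (1 : MackeyAlgebra R F) = ∑ᶠ K : {K : Subgroup T // K ≤ F.S}, iA R F K.1 K.1 := by
  have := Fintype.ofFinite {K : Subgroup T // K ≤ F.S}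
  have h := mk_rel R (Rel.one (F := F) (R := R))
  rw [map_one, finsum_eq_sum_of_fintype, map_sum] at h
  rw [← h, finsum_eq_sum_of_fintype]
  exact Finset.sum_congr rfl fun K _ => (iA_eq R le_rfl K.2).symm

/-- Induction on the elements of the Mackey algebra. -/
theorem induction {C : MackeyAlgebra R F → Prop}
    (hind : ∀ (A B : Subgroup T) (h : A ≤ B) (hB : B ≤ F.S), C (ind R h hB))
    (hres : ∀ (A B : Subgroup T) (h : A ≤ B) (hB : B ≤ F.S), C (res R h hB))
    (hconj : ∀ (P Q : Subgroup T) (φ : P ≃* Q) (hφ : F.IsIso φ), C (conj R hφ))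
    (halg : ∀ r : R, C (algebraMap R _ r)) (hadd : ∀ a b, C a → C b → C (a + b))
    (hmul : ∀ a b, C a → C b → C (a * b)) (a : MackeyAlgebra R F) : C a := by
  obtain ⟨a, rfl⟩ := RingQuot.mkAlgHom_surjective R (F.Rel R) a
  change C (mk R F a)
  induction a using FreeAlgebra.induction with
  | grade0 r => rw [AlgHom.commutes]; exact halg r
  | grade1 g =>
    cases g with
    | ind A B h hB => exact hind A B h hB
    | res A B h hB => exact hres A B h hB
    | conj P Q φ hφ => exact hconj P Q φ hφ
  | mul a b ha hb => rw [map_mul]; exact hmul _ _ ha hb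
  | add a b ha hb => rw [map_add]; exact hadd _ _ ha hb

theorem rho_mul_iA_of_ne (D : Subgroup (T × T)) (h : K ≠ L) :
    rho R F D K * iA R F L L = 0 := by
  rw [← rho_mul_iA_self, mul_assoc, iA_self_mul_of_ne R h, mul_zero]

theorem iA_mul_self (A B : Subgroup T) : iA R F B B * iA R F A B = iA R F A B := by
  by_cases h : A ≤ B
  · exact iA_mul_iA R h le_rfl
  · rw [iA_eq_zero R (A := A) fun h' => h h'.1, mul_zero]

theorem rho_mul_iA_eq_zero (D : Subgroup (T × T)) (A : Subgroup T) (h : K ≠ B) :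
    rho R F D K * iA R F A B = 0 := by
  rw [← iA_mul_self R A B, ← mul_assoc, rho_mul_iA_of_ne R D h, zero_mul]

theorem rho_mul_rho_eq_zero (D E : Subgroup (T × T)) (h : K ≠ p1 E) :
    rho R F D K * rho R F E L = 0 := by
  rw [← iA_mul_rho R E L, ← mul_assoc, rho_mul_iA_of_ne R D h, zero_mul]

theorem p1_relComp (h : p2 D ≤ p1 E) : p1 (relComp D E) = p1 D := by
  ext x
  rw [mem_p1, mem_p1]
  constructor
  · rintro ⟨b, c, h, -⟩
    exact ⟨c, h⟩
  · rintro ⟨b, hb⟩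
    obtain ⟨c, hc⟩ := mem_p1.1 (h (snd_mem_p2 hb))
    exact ⟨c, b, hb, hc⟩

theorem p2_relComp_le (D E : Subgroup (T × T)) : p2 (relComp D E) ≤ p2 E := by
  intro b hb
  obtain ⟨a, c, -, h⟩ := mem_p2.1 hb
  exact snd_mem_p2 h

variable (F) in
/-- The elements `I_A^B c_φ⁻¹ R_{φ(A)}^K` span the Mackey algebra. -/
theorem span_eq_top [Finite T] :
    Submodule.span R (Set.range fun t : Subgroup (T × T) × Subgroup T × Subgroup T =>
      iA R F (p1 t.1) t.2.1 * rho R F t.1 t.2.2) = ⊤ := by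
  set V := Submodule.span R (Set.range fun t : Subgroup (T × T) × Subgroup T × Subgroup T =>
      iA R F (p1 t.1) t.2.1 * rho R F t.1 t.2.2) with hV
  have hmem : ∀ D B K, iA R F (p1 D) B * rho R F D K ∈ V := fun D B K =>
    Submodule.subset_span ⟨(D, B, K), rfl⟩
  have hone : (1 : MackeyAlgebra R F) ∈ V := by
    have := Fintype.ofFinite {K : Subgroup T // K ≤ F.S}
    rw [one_eq_sum, finsum_eq_sum_of_fintype]
    refine Submodule.sum_mem _ fun K _ => ?_
    have := hmem (diag K.1) K.1 K.1
    rwa [p1_diag, ← iA_self R K.2, iA_mul_iA R le_rfl le_rfl] at this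
  -- Right multiplication by `a` preserves the span as soon as it does so on products with a genuine
  -- graph in them; the degenerate products are zero.
  have hgen : ∀ a : MackeyAlgebra R F,
      (∀ (D : Subgroup (T × T)) (B K : Subgroup T), F.IsGr D → p2 D ≤ K → K ≤ F.S →
        iA R F (p1 D) B * rho R F D K * a ∈ V) → ∀ v ∈ V, v * a ∈ V := by
    intro a ha v hv
    induction hv using Submodule.span_induction with
    | mem v hv =>
      obtain ⟨⟨D, B, K⟩, rfl⟩ := hv
      by_cases h : F.IsGr D ∧ p2 D ≤ K ∧ K ≤ F.S
      · exact ha D B K h.1 h.2.1 h.2.2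
      · simp only [rho_eq_zero R h, mul_zero, zero_mul]
        exact zero_mem _
    | zero => rw [zero_mul]; exact zero_mem _
    | add x y _ _ hx hy => rw [add_mul]; exact add_mem hx hy
    | smul r x _ hx => rw [smul_mul_assoc]; exact Submodule.smul_mem _ _ hx
  have key : ∀ a : MackeyAlgebra R F, ∀ v ∈ V, v * a ∈ V := by
    intro a
    induction a using MackeyAlgebra.induction with
    | hind A B h hB =>
      refine hgen _ fun D C K hD hK hKS => ?_
      rw [← iA_eq R h hB, mul_assoc]
      by_cases hBK : K = B
      · subst hBK
        rw [rho_mul_ind R hD hK hKS h, relSum, Finset.mul_sum]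
        refine Submodule.sum_mem _ fun x _ => ?_
        rw [← mul_assoc]
        by_cases hC : p1 D ≤ C
        · rw [iA_mul_iA R (p1_slice_le _ _ _) hC]
          exact hmem _ _ _
        · rw [iA_eq_zero R fun h => hC h.1, zero_mul, zero_mul]
          exact zero_mem _
      · rw [rho_mul_iA_eq_zero R D A hBK, mul_zero]
        exact zero_mem _
    | hres A B h hB =>
      refine hgen _ fun D C K hD hK hKS => ?_
      rw [res_eq_rho, mul_assoc]
      by_cases hAK : K = A
      · subst hAK
        rw [rho_res_right R hD hK h hB]
        exact hmem _ _ _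
      · rw [rho_mul_rho_eq_zero R D _ (by rwa [p1_diag]), mul_zero]
        exact zero_mem _
    | hconj P Q φ hφ =>
      refine hgen _ fun D C K hD hK hKS => ?_
      have h1 : p1 (swap (gr φ.toMonoidHom)) = Q := by rw [p1_swap, p2_gr_equiv]
      rw [conj_eq_rho, mul_assoc]
      by_cases hQK : K = Q
      · subst hQK
        rw [rho_mul_rho' R hD (isGr_gr (F := F) hφ).swap h1 hK (by rw [p2_swap, p1_gr])
          (F.le_of_mem hφ).1, ← p1_relComp (hK.trans h1.ge)]
        exact hmem _ _ _
      · rw [rho_mul_rho_eq_zero R D _ (by rwa [h1]), mul_zero]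
        exact zero_mem _
    | halg r =>
      intro v hv
      rw [← Algebra.commutes, ← Algebra.smul_def]
      exact Submodule.smul_mem _ _ hv
    | hadd a b ha hb =>
      intro v hv
      rw [mul_add]
      exact add_mem (ha v hv) (hb v hv)
    | hmul a b ha hb =>
      intro v hv
      rw [← mul_assoc]
      exact hb _ (ha v hv)
  rw [eq_top_iff]
  intro a _
  have := key a 1 hone
  rwa [one_mul] at this

/-- There are finitely many normal forms. So finite generation over the Mackey algebra and over `R`
are the same, which is what lets restriction preserve it. -/
instance [Finite T] : Module.Finite R (MackeyAlgebra R F) :=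
  ⟨Submodule.fg_def.2 ⟨_, Set.finite_range _, span_eq_top R F⟩⟩

/-- Writes a normal form as an element I c_φ times a restriction. In an induced module the second
factor can be moved across the tensor sign when `K` is contained in `H`. -/
theorem lam_swap (hD : F.IsGr D) (hK : p2 D ≤ K) (hKS : K ≤ F.S) (B : Subgroup T) :
    iA R F (p1 D) B * rho R F D K = lam R F (swap D) B * rho R F (diag (p2 D)) K := by
  rw [lam, p2_swap, p1_swap, swap_swap, mul_assoc, rho_res_right R hD le_rfl hK hKS]

theorem lam_mul_iA (hD : F.IsGr D) (hK : p2 D ≤ K) (h : E ≤ D) :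
    lam R F D K * iA R F (p1 E) (p1 D) = lam R F E K := by
  have h1 := rho_mul_iA R hD.swap (E := swap E) fun d hd => h hd
  rw [p2_swap, p2_swap, p1_swap, p1_swap] at h1
  rw [lam, mul_assoc, h1, ← mul_assoc, iA_mul_iA R (p2_mono h) hK, lam]

/-- Up to a conjugation inside `H`, the element I c_φ depends only on the H × K-class of the graph.
This allows passing to the chosen representatives. -/
theorem lam_conj (hD : F.IsGr D) (hK : p2 D ≤ K) (hKS : K ≤ F.S) {g : T × T} (hh : g.1 ∈ F.S)
    (hk : g.2 ∈ K) : lam R F (MulAut.conj g • D) K * cA R F (p1 D) g.1 = lam R F D K := by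
  obtain ⟨h, k⟩ := g
  have h1 := conj_smul_le hh hD.p1_le
  have h2 : MulAut.conj h⁻¹ • MulAut.conj h • p1 D = p1 D := by
    rw [conj_smul_smul, inv_mul_cancel, conj_one_smul]
  rw [lam, cA, p1_conj_smul, p2_conj_smul, swap_conj_smul, swap_conjGr, mul_assoc,
    rho_mul_rho' R (hD.swap.conj_smul (hKS hk) hh) (isGr_conjGr (inv_mem hh) h1) (p1_conjGr _ _)
      (by rw [p2_conj_smul, p2_swap]) (by rw [p2_conjGr, h2]) hD.p1_le,
    relComp_conjGr_right (by rw [p2_conj_smul, p2_swap]), conj_smul_smul]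
  have h3 : ((1, h⁻¹) : T × T) * (k, h) = (k, 1) := by simp
  rw [h3, rho_conj_fst R hD.swap (by rw [p2_swap]) hD.p1_le (hKS hk), ← mul_assoc, p1_swap,
    iA_conj R hKS hK hk, lam]

end MackeyAlgebra

/-! ### A model of coinduction -/

section RelSum

variable {α A N : Type*} [Finite α] [Semiring A] [AddCommMonoid N] [Module A N] (s : Setoid α)
  (X : Set α)

theorem smul_relSum (a : A) (g : α → N) : a • relSum s X g = relSum s X fun x => a • g x :=
  Finset.smul_sum

theorem relSum_smul (g : α → A) (n : N) : relSum s X g • n = relSum s X fun x => g x • n :=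
  Finset.sum_smul

end RelSum

section Coinduction

open MackeyAlgebra

variable {T : Type u} [Group T] (R : Type u) [CommRing R] (F : FusionSystem T)
  (H : Subgroup T) (N : Type u) [AddCommGroup N] [Module R N]
  [Module (MackeyAlgebra R (inner H)) N] [IsScalarTower R (MackeyAlgebra R (inner H)) N]

/-- `D` is the graph of a morphism in `F` from a subgroup of `H` to `K`. -/
structure IsGrIn (K : Subgroup T) (D : Subgroup (T × T)) : Prop where
  isGr : F.IsGr D
  p1_le : p1 D ≤ H
  p2_le : p2 D ≤ K

/-- The compatible families of elements of `N`, indexed by the morphisms in `F` from subgroups of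
`H` to `K`. -/
def Fam (K : Subgroup T) : Submodule R (Subgroup (T × T) → N) where
  -- The conditions are: a default value 0 away from the relevant graphs, compatibility with
  -- restriction and conjugation in `H`, and invariance under inner automorphisms of `K`.
  carrier := {n | (∀ D, ¬ IsGrIn F H K D → n D = 0) ∧
    (∀ D E, IsGrIn F H K D → (inner H).IsGr E → p2 E ≤ p1 D →
      rho R (inner H) E (p1 D) • n D = n (relComp E D)) ∧
    ∀ D, IsGrIn F H K D → ∀ k ∈ K, n (MulAut.conj ((1, k) : T × T) • D) = n D}
  zero_mem' := ⟨fun _ _ => rfl, fun _ _ _ _ _ => smul_zero _, fun _ _ _ _ => rfl⟩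
  add_mem' := by
    rintro n m ⟨h1, h2, h3⟩ ⟨k1, k2, k3⟩
    refine ⟨fun D hD => ?_, fun D E hD hE h => ?_, fun D hD k hk => ?_⟩
    · rw [Pi.add_apply, h1 D hD, k1 D hD, add_zero]
    · rw [Pi.add_apply, smul_add, h2 D E hD hE h, k2 D E hD hE h, Pi.add_apply]
    · rw [Pi.add_apply, Pi.add_apply, h3 D hD k hk, k3 D hD k hk]
  smul_mem' := by
    rintro r n ⟨h1, h2, h3⟩
    refine ⟨fun D hD => ?_, fun D E hD hE h => ?_, fun D hD k hk => ?_⟩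
    · rw [Pi.smul_apply, h1 D hD, smul_zero]
    · rw [Pi.smul_apply, smul_comm, h2 D E hD hE h, Pi.smul_apply]
    · rw [Pi.smul_apply, Pi.smul_apply, h3 D hD k hk]

variable {R F H N} {K L J : Subgroup T} {D E : Subgroup (T × T)}

theorem IsGrIn.le (hD : IsGrIn F H L D) (h : L ≤ K) : IsGrIn F H K D :=
  ⟨hD.isGr, hD.p1_le, hD.p2_le.trans h⟩

theorem IsGrIn.conj_snd (hD : IsGrIn F H K D) (hK : K ≤ F.S) {k : T} (hk : k ∈ K) :
    IsGrIn F H K (MulAut.conj ((1, k) : T × T) • D) :=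
  ⟨hD.isGr.conj_smul (one_mem _) (hK hk), by rw [p1_conj_smul, conj_one_smul]; exact hD.p1_le,
    by rw [p2_conj_smul]; exact conj_smul_le hk hD.p2_le⟩

theorem IsGrIn.slice (hD : IsGrIn F H K D) (hK : K ≤ F.S) (L : Subgroup T) {x : T} (hx : x ∈ K) :
    IsGrIn F H L (slice D L x) :=
  ⟨hD.isGr.slice L (hK hx), (p1_slice_le _ _ _).trans hD.p1_le, p2_slice_le _ _ _⟩

theorem isGr_of_inner (hH : H ≤ F.S) (h : (inner H).IsGr E) : F.IsGr E := by
  obtain ⟨P, Q, φ, hφ, rfl⟩ := h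
  exact isGr_gr (inner_le hH _ _ hφ)

theorem IsGrIn.relComp_left (hD : IsGrIn F H K D) (hH : H ≤ F.S) (hE : (inner H).IsGr E) :
    IsGrIn F H K (relComp E D) := by
  refine ⟨(isGr_of_inner hH hE).relComp hD.isGr, fun a ha => ?_,
    (p2_relComp_le _ _).trans hD.p2_le⟩
  obtain ⟨c, b, h, -⟩ := mem_p1.1 ha
  exact hE.p1_le (fst_mem_p1 h)

theorem relComp_assoc (D E G : Subgroup (T × T)) :
    relComp (relComp D E) G = relComp D (relComp E G) := by
  ext ⟨a, d⟩
  simp only [mem_relComp]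
  constructor
  · rintro ⟨c, ⟨b, h1, h2⟩, h3⟩
    exact ⟨b, h1, c, h2, h3⟩
  · rintro ⟨b, h1, c, h2, h3⟩
    exact ⟨c, ⟨b, h1, h2⟩, h3⟩

namespace Fam

theorem ext_iff' {n m : Fam R F H N K} :
    n = m ↔ ∀ D, IsGrIn F H K D → n.1 D = m.1 D := by
  refine ⟨fun h D _ => by rw [h], fun h => Subtype.ext (funext fun D => ?_)⟩
  by_cases hD : IsGrIn F H K D
  · exact h D hD
  · rw [n.2.1 D hD, m.2.1 D hD]

theorem map_rho (n : Fam R F H N K) (hD : IsGrIn F H K D) (hE : (inner H).IsGr E)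
    (h : p2 E ≤ p1 D) : rho R (inner H) E (p1 D) • n.1 D = n.1 (relComp E D) :=
  n.2.2.1 D E hD hE h

theorem map_conj_snd (n : Fam R F H N K) (hD : IsGrIn F H K D) {k : T} (hk : k ∈ K) :
    n.1 (MulAut.conj ((1, k) : T × T) • D) = n.1 D :=
  n.2.2.2 D hD k hk

theorem map_conj_fst (n : Fam R F H N K) (hD : IsGrIn F H K D) {h : T} (hh : h ∈ H) :
    n.1 (MulAut.conj ((h, 1) : T × T) • D) = cA R (inner H) (p1 D) h • n.1 D := by
  rw [cA, Fam.map_rho n hD (isGr_conjGr (F := inner H) hh hD.p1_le).swap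
    (by rw [p2_swap, p1_conjGr]), relComp_conjGr_left]

theorem map_conj (n : Fam R F H N K) (hH : H ≤ F.S) (hD : IsGrIn F H K D) {g : T × T}
    (hh : g.1 ∈ H) (hk : g.2 ∈ K) :
    n.1 (MulAut.conj g • D) = cA R (inner H) (p1 D) g.1 • n.1 D := by
  obtain ⟨h, k⟩ := g
  have hg : MulAut.conj ((h, k) : T × T) • D =
      MulAut.conj ((1, k) : T × T) • MulAut.conj ((h, 1) : T × T) • D := by
    rw [conj_smul_smul]
    simp
  have h1 : IsGrIn F H K (MulAut.conj ((h, 1) : T × T) • D) := by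
    rw [← relComp_conjGr_left]
    exact hD.relComp_left hH (isGr_conjGr (F := inner H) hh hD.p1_le).swap
  rw [hg, Fam.map_conj_snd n h1 hk, Fam.map_conj_fst n hD hh]

theorem map_res (n : Fam R F H N K) (hD : IsGrIn F H K D) (h : E ≤ D) :
    rho R (inner H) (diag (p1 E)) (p1 D) • n.1 D = n.1 E := by
  rw [Fam.map_rho n hD (isGr_diag (F := inner H) ((p1_mono h).trans hD.p1_le))
    (by rw [p2_diag]; exact p1_mono h), relComp_diag_left, IsGr.inf_comap_p1 hD.isGr h]

theorem map_self (n : Fam R F H N K) (hD : IsGrIn F H K D) :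
    iA R (inner H) (p1 D) (p1 D) • n.1 D = n.1 D := by
  rw [iA_self R (F := inner H) hD.p1_le, Fam.map_res n hD le_rfl]

open Classical in
/-- A compatible family from its values on the graphs of morphisms. -/
noncomputable def mk (hH : H ≤ F.S) (hK : K ≤ F.S) (g : Subgroup (T × T) → N)
    (hA : ∀ D E, IsGrIn F H K D → (inner H).IsGr E → p2 E ≤ p1 D →
      rho R (inner H) E (p1 D) • g D = g (relComp E D))
    (hB : ∀ D, IsGrIn F H K D → ∀ k ∈ K, g (MulAut.conj ((1, k) : T × T) • D) = g D) :
    Fam R F H N K :=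
  ⟨fun D => if IsGrIn F H K D then g D else 0, fun D hD => if_neg hD, fun D E hD hE h => by
    dsimp only
    rw [if_pos hD, if_pos (hD.relComp_left hH hE), hA D E hD hE h], fun D hD k hk => by
    dsimp only
    rw [if_pos hD, if_pos (hD.conj_snd hK hk), hB D hD k hk]⟩

theorem mk_apply {hH : H ≤ F.S} {hK : K ≤ F.S} {g : Subgroup (T × T) → N}
    {hA : ∀ D E, IsGrIn F H K D → (inner H).IsGr E → p2 E ≤ p1 D →
      rho R (inner H) E (p1 D) • g D = g (relComp E D)}
    {hB : ∀ D, IsGrIn F H K D → ∀ k ∈ K, g (MulAut.conj ((1, k) : T × T) • D) = g D}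
    (hD : IsGrIn F H K D) : (mk hH hK g hA hB).1 D = g D := if_pos hD

/-- Restriction of families from `K` to `L`. -/
noncomputable def res (hH : H ≤ F.S) (hK : K ≤ F.S) (h : L ≤ K) :
    Fam R F H N K →ₗ[R] Fam R F H N L where
  toFun n := mk hH (h.trans hK) n.1 (fun D E hD hE h' => map_rho n (hD.le h) hE h')
    (fun _ hD _ hk => map_conj_snd n (hD.le h) (h hk))
  map_add' n m := by
    rw [ext_iff']
    intro D hD
    rw [mk_apply hD, Submodule.coe_add, Submodule.coe_add, Pi.add_apply, Pi.add_apply, mk_apply hD,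
      mk_apply hD]
  map_smul' r n := by
    rw [ext_iff']
    intro D hD
    rw [mk_apply hD, RingHom.id_apply, Submodule.coe_smul, Submodule.coe_smul, Pi.smul_apply,
      Pi.smul_apply, mk_apply hD]

theorem res_apply {hH : H ≤ F.S} {hK : K ≤ F.S} {h : L ≤ K} (n : Fam R F H N K)
    (hD : IsGrIn F H L D) : (res hH hK h n).1 D = n.1 D := if_pos hD

theorem relComp_swap_gr_conj_snd {P Q : Subgroup T} (θ : P ≃* Q) (k : Q) :
    relComp (MulAut.conj ((1, (k : T)) : T × T) • D) (swap (gr θ.toMonoidHom)) =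
      MulAut.conj ((1, (θ.symm k : T)) : T × T) • relComp D (swap (gr θ.toMonoidHom)) := by
  have key : ∀ b c : T, (b, c) ∈ swap (gr θ.toMonoidHom) ↔ ∃ x : Q, (x : T) = b ∧
      (θ.symm x : T) = c := by
    intro b c
    rw [swap_gr, mem_gr]
    exact Iff.rfl
  have hsymm : ∀ x y : Q, θ.symm (x * y) = θ.symm x * θ.symm y := map_mul _
  ext ⟨a, c⟩
  simp only [mem_conj_smul, mem_relComp, key]
  constructor
  · rintro ⟨_, h1, x, rfl, rfl⟩
    refine ⟨_, by simpa using h1, k⁻¹ * x * k, by simp, by simp⟩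
  · rintro ⟨_, h1, x, rfl, h2⟩
    refine ⟨k * x * k⁻¹, ?_, k * x * k⁻¹, rfl, ?_⟩
    · simpa [mul_assoc] using h1
    · rw [map_mul, map_mul, map_inv, Subgroup.coe_mul, Subgroup.coe_mul, h2]
      simp [mul_assoc]

theorem isGrIn_relComp_swap_gr {P Q : Subgroup T} {θ : P ≃* Q} (hθ : F.IsIso θ)
    (hD : IsGrIn F H Q D) : IsGrIn F H P (relComp D (swap (gr θ.toMonoidHom))) := by
  refine ⟨hD.isGr.relComp (isGr_gr (F := F) hθ).swap, ?_, (p2_relComp_le _ _).trans ?_⟩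
  · rw [p1_relComp (by rw [p1_swap, p2_gr_equiv]; exact hD.p2_le)]
    exact hD.p1_le
  · rw [p2_swap, p1_gr]

theorem p1_relComp_swap_gr {P Q : Subgroup T} (θ : P ≃* Q) (hD : p2 D ≤ Q) :
    p1 (relComp D (swap (gr θ.toMonoidHom))) = p1 D :=
  p1_relComp (by rwa [p1_swap, p2_gr_equiv])

/-- Transport of families along an isomorphism. -/
noncomputable def conj (hH : H ≤ F.S) {P Q : Subgroup T} {θ : P ≃* Q} (hθ : F.IsIso θ) :
    Fam R F H N P →ₗ[R] Fam R F H N Q where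
  toFun n := mk hH (F.le_of_mem hθ).2 (fun D => n.1 (relComp D (swap (gr θ.toMonoidHom))))
    (fun D E hD hE h' => by
      have := map_rho n (isGrIn_relComp_swap_gr hθ hD) hE
        (by rwa [p1_relComp_swap_gr θ hD.p2_le])
      rwa [p1_relComp_swap_gr θ hD.p2_le, ← relComp_assoc] at this)
    (fun D hD k hk => by
      rw [relComp_swap_gr_conj_snd θ ⟨k, hk⟩]
      exact map_conj_snd n (isGrIn_relComp_swap_gr hθ hD) (θ.symm _).2)
  map_add' n m := by
    rw [ext_iff']
    intro D hD
    rw [mk_apply hD, Submodule.coe_add, Submodule.coe_add, Pi.add_apply, Pi.add_apply, mk_apply hD,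
      mk_apply hD]
  map_smul' r n := by
    rw [ext_iff']
    intro D hD
    rw [mk_apply hD, RingHom.id_apply, Submodule.coe_smul, Submodule.coe_smul, Pi.smul_apply,
      Pi.smul_apply, mk_apply hD]

theorem conj_apply {hH : H ≤ F.S} {P Q : Subgroup T} {θ : P ≃* Q} {hθ : F.IsIso θ}
    (n : Fam R F H N P) (hD : IsGrIn F H Q D) :
    (conj hH hθ n).1 D = n.1 (relComp D (swap (gr θ.toMonoidHom))) := if_pos hD

/-- The module version of `MackeyAlgebra.iA_slice_rho_eq`: the terms defining the induced family
depend only on the double coset. -/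
theorem term_congr (n : Fam R F H N L) (hH : H ≤ F.S) (hK : K ≤ F.S) (hD : IsGrIn F H K D)
    {x y : T} (hx : x ∈ K) (h : cosetRel D L x y) :
    iA R (inner H) (p1 (slice D L x)) (p1 D) • n.1 (slice D L x) =
      iA R (inner H) (p1 (slice D L y)) (p1 D) • n.1 (slice D L y) := by
  obtain ⟨b, hb, l, hl, rfl⟩ := h
  obtain ⟨a, ha⟩ := mem_p2.1 hb
  have haD : a ∈ p1 D := mem_p1.2 ⟨b, ha⟩
  rw [slice_mul ha hl, map_conj n hH (hD.slice hK L hx) (g := (a, l⁻¹)) (hD.p1_le haD)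
    (inv_mem hl), p1_conj_smul, ← mul_smul, iA_conj R hD.p1_le (p1_slice_le _ _ _) haD]

/-- Slicing commutes with composition, at the cost of replacing `x` by `f * x`, where `f` is the
value of `D` at `h`. This matches the terms when an induced family is tested for compatibility. -/
theorem relComp_slice {h f x : T} (hh : (h, f) ∈ D) :
    relComp (slice E (p1 (slice D L x)) h) (slice D L x) = slice (relComp E D) L (f * x) := by
  ext ⟨a, c⟩
  simp only [mem_relComp, mem_slice]
  have e : ∀ b, (b, x * c * x⁻¹) ∈ D ↔ (h * b * h⁻¹, f * x * c * (f * x)⁻¹) ∈ D := by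
    intro b
    have e1 : (h * b * h⁻¹, f * x * c * (f * x)⁻¹) = (h, f) * (b, x * c * x⁻¹) * (h, f)⁻¹ := by
      refine Prod.ext (by simp) ?_
      simp [mul_assoc]
    rw [e1]
    exact ⟨fun h1 => mul_mem (mul_mem hh h1) (inv_mem hh), fun h1 => by
      have := mul_mem (mul_mem (inv_mem hh) h1) hh
      convert this using 1
      group⟩
  constructor
  · rintro ⟨b, ⟨h1, h2⟩, h3, h4⟩
    exact ⟨h3, _, h2, (e b).1 h4⟩
  · rintro ⟨h1, b, h2, h3⟩
    have e2 : h * (h⁻¹ * b * h) * h⁻¹ = b := by group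
    have h4 : (h⁻¹ * b * h, x * c * x⁻¹) ∈ D := (e _).2 (by rwa [e2])
    exact ⟨h⁻¹ * b * h, ⟨mem_p1.2 ⟨c, mem_slice.2 ⟨h1, h4⟩⟩, by rwa [e2]⟩, h1, h4⟩

variable [Finite T]

/-- Induction of families from `L` to `K`. -/
noncomputable def ind (hH : H ≤ F.S) (hK : K ≤ F.S) (L : Subgroup T) :
    Fam R F H N L →ₗ[R] Fam R F H N K where
  toFun n := mk hH hK (fun D => relSum (cosetRel D L) K fun x =>
      iA R (inner H) (p1 (slice D L x)) (p1 D) • n.1 (slice D L x))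
    (fun D E hD hE h' => by
      choose! f hf using fun a (ha : a ∈ p1 D) => mem_p1.1 ha
      have hDE := hD.relComp_left hH hE
      rw [smul_relSum]
      -- Here `f a` is the value of `D` at `a`. The double cosets for the composite of `E` and `D`
      -- are enumerated by a double coset `x` for `D`, followed by a double coset `a` in the source
      -- of `D`, through the products `f a * x`.
      refine Eq.trans ?_ (relSum_nest (s := cosetRel D L) (X := (K : Set T))
        (t := fun x => cosetRel E (p1 (slice D L x))) (Z := fun _ => (p1 D : Set T))
        (fun x a => f a * x) (fun w hw w' hw' hww' => term_congr n hH hK hDE hw hww')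
        (fun x hx a ha => mul_mem (hD.p2_le (mem_p2.2 ⟨a, hf a ha⟩)) hx) ?_ ?_ ?_)
      · refine relSum_congr fun x hx => ?_
        have hsl := hD.slice hK L hx
        rw [← mul_smul, rho_mul_ind R hE h' hD.p1_le
          (p1_slice_le _ _ _), relSum_smul]
        refine relSum_congr fun a ha => ?_
        have hp : p1 (relComp E D) = p1 E := p1_relComp h'
        have hEs : (inner H).IsGr (slice E (p1 (slice D L x)) a) :=
          hE.slice _ (hD.p1_le ha)
        rw [mul_smul, map_rho n hsl hEs (p2_slice_le _ _ _), hp,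
          relComp_slice (hf a ha), ← relComp_slice (hf a ha),
          p1_relComp (p2_slice_le _ _ _)]
      · intro w hw
        refine ⟨w, hw, ?_⟩
        rintro x hx ⟨b, hb, l, hl, rfl⟩
        obtain ⟨a, ha⟩ := mem_p2.1 hb
        have haD : a ∈ p1 D := mem_p1.2 ⟨b, ha⟩
        refine ⟨a, haD, 1, one_mem _, l, hl, ?_⟩
        rw [hD.isGr.snd_eq (hf a haD) ha, one_mul]
      · intro x hx a ha a' ha'
        constructor
        · rintro ⟨b, hb, l, hl, e⟩
          obtain ⟨c, d, hc, hd⟩ := mem_p2.1 hb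
          have h1 : (a⁻¹ * d⁻¹ * a', x * l * x⁻¹) ∈ D := by
            have := mul_mem (mul_mem (inv_mem (hf a ha)) (inv_mem hd)) (hf a' ha')
            convert this using 1
            refine Prod.ext rfl ?_
            simp only [Prod.snd_mul, Prod.snd_inv, eq_mul_inv_of_mul_eq e]
            group
          exact ⟨d, snd_mem_p2 hc, a⁻¹ * d⁻¹ * a', mem_p1.2 ⟨l, mem_slice.2 ⟨hl, h1⟩⟩, by group⟩
        · rintro ⟨d, hd, c, hc, rfl⟩
          obtain ⟨l, hl⟩ := mem_p1.1 hc
          obtain ⟨hl, hl'⟩ := mem_slice.1 hl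
          obtain ⟨c', hc'⟩ := mem_p2.1 hd
          have hdD := h' hd
          refine ⟨f d, mem_p2.2 ⟨c', d, hc', hf d hdD⟩, l, hl, ?_⟩
          have := mul_mem (mul_mem (hf d hdD) (hf a ha)) hl'
          rw [hD.isGr.snd_eq (hf _ ha') this]
          simp only [Prod.snd_mul]
          group
      · rintro x hx a ha x' hx' a' ha' ⟨b, hb, l, hl, e⟩
        refine ⟨(f a')⁻¹ * b * f a, mul_mem (mul_mem (inv_mem (snd_mem_p2 (hf a' ha')))
          (p2_relComp_le _ _ hb)) (snd_mem_p2 (hf a ha)), l, hl, ?_⟩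
        rw [eq_inv_mul_of_mul_eq e]
        group)
    -- Conjugating `D` by `k` is undone by the change of variables from `x` to `k * x`.
    (fun D hD k hk => by
      have hsl : ∀ x, slice (MulAut.conj ((1, k) : T × T) • D) L (k * x) = slice D L x := by
        intro x
        ext ⟨a, b⟩
        rw [mem_slice, mem_slice, mem_conj_smul]
        simp [mul_assoc]
      have hp : p1 (MulAut.conj ((1, k) : T × T) • D) = p1 D := by
        rw [p1_conj_smul, conj_one_smul]
      symm
      refine Eq.trans (relSum_congr fun x hx => ?_) (relSum_reindex (fun x => k * x)
        (fun w hw w' hw' hww' => term_congr n hH hK (hD.conj_snd hK hk) hw hww')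
        (fun x hx => mul_mem hk hx) (fun w hw => ⟨k⁻¹ * w, mul_mem (inv_mem hk) hw, ?_⟩) ?_)
      · rw [hsl, hp]
      · simp only [mul_inv_cancel_left]
        exact (cosetRel _ _).refl _
      · intro x hx x' hx'
        rw [cosetRel_iff, cosetRel_iff, p2_conj_smul]
        constructor
        · rintro ⟨b, hb, l, hl, e⟩
          refine ⟨k⁻¹ * b * k, mem_conj_smul.1 hb, l, hl, ?_⟩
          rw [eq_inv_mul_of_mul_eq e]
          group
        · rintro ⟨b, hb, l, hl, rfl⟩
          refine ⟨k * b * k⁻¹, mem_conj_smul.2 ?_, l, hl, by group⟩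
          convert hb using 1
          group)
  map_add' n m := by
    rw [ext_iff']
    intro D hD
    rw [mk_apply hD, Submodule.coe_add, Submodule.coe_add, Pi.add_apply, mk_apply hD,
      mk_apply hD]
    simp only [Pi.add_apply, smul_add, relSum, Finset.sum_add_distrib]
  map_smul' r n := by
    rw [ext_iff']
    intro D hD
    rw [mk_apply hD, RingHom.id_apply, Submodule.coe_smul, Submodule.coe_smul, Pi.smul_apply,
      mk_apply hD]
    simp only [Pi.smul_apply, relSum, Finset.smul_sum, smul_comm _ r]

theorem ind_apply {hH : H ≤ F.S} {hK : K ≤ F.S} (n : Fam R F H N L)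
    (hD : IsGrIn F H K D) : (ind hH hK L n).1 D = relSum (cosetRel D L) K fun x =>
      iA R (inner H) (p1 (slice D L x)) (p1 D) • n.1 (slice D L x) := if_pos hD

end Fam

end Coinduction

/-! ### The Mackey relations for compatible families. -/

section CoinductionModule

open MackeyAlgebra

variable {T : Type u} [Group T] {R : Type u} [CommRing R] {F : FusionSystem T}
  {H : Subgroup T} {N : Type u} [AddCommGroup N] [Module R N]
  [Module (MackeyAlgebra R (inner H)) N] [IsScalarTower R (MackeyAlgebra R (inner H)) N]
  {K L J P Q W : Subgroup T} {D E : Subgroup (T × T)}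

namespace Fam

theorem res_self (hH : H ≤ F.S) (hK : K ≤ F.S) (n : Fam R F H N K) :
    res hH hK le_rfl n = n := by
  rw [ext_iff']
  intro D hD
  rw [res_apply n hD]

theorem res_res (hH : H ≤ F.S) (hJ : J ≤ F.S) (hKJ : K ≤ J) (hLK : L ≤ K) (n : Fam R F H N J) :
    res hH (hKJ.trans hJ) hLK (res hH hJ hKJ n) = res hH hJ (hLK.trans hKJ) n := by
  rw [ext_iff']
  intro D hD
  rw [res_apply _ hD, res_apply _ (hD.le hLK), res_apply _ hD]

theorem conj_self (hH : H ≤ F.S) {θ : K ≃* K} (hθ : F.IsIso θ) {k : T} (hk : k ∈ K)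
    (e : ∀ y : K, (θ y : T) = k * y * k⁻¹) (n : Fam R F H N K) : conj hH hθ n = n := by
  rw [ext_iff']
  intro D hD
  have h1 : gr θ.toMonoidHom = conjGr k K := by
    ext d
    rw [mem_gr, mem_conjGr]
    constructor
    · rintro ⟨x, h1, h2⟩
      refine ⟨h1 ▸ x.2, ?_⟩
      rw [← h2, ← h1]
      exact e x
    · rintro ⟨h1, h2⟩
      exact ⟨⟨_, h1⟩, rfl, (e _).trans h2.symm⟩
  rw [conj_apply n hD, h1, swap_conjGr,
    conj_smul_eq_of_mem_normalizer (Subgroup.le_normalizer hk), relComp_conjGr_right hD.p2_le,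
    map_conj_snd n hD (inv_mem hk)]

theorem relComp_swap_gr_trans (θ : P ≃* Q) (η : Q ≃* W) :
    relComp (relComp D (swap (gr η.toMonoidHom))) (swap (gr θ.toMonoidHom)) =
      relComp D (swap (gr (θ.trans η).toMonoidHom)) := by
  rw [relComp_assoc]
  congr 1
  ext ⟨a, c⟩
  simp only [mem_relComp, mem_swap, mem_gr]
  constructor
  · rintro ⟨b, ⟨x, h1, h2⟩, y, h3, h4⟩
    have : θ y = x := Subtype.ext (h4.trans h1.symm)
    subst this
    exact ⟨y, h3, h2⟩
  · rintro ⟨y, h1, h2⟩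
    exact ⟨_, ⟨θ y, rfl, h2⟩, y, h1, rfl⟩

theorem conj_conj (hH : H ≤ F.S) {θ : P ≃* Q} {η : Q ≃* W} (hθ : F.IsIso θ) (hη : F.IsIso η)
    (n : Fam R F H N P) :
    conj hH hη (conj hH hθ n) = conj hH (isIso_trans hθ hη) n := by
  rw [ext_iff']
  intro D hD
  rw [conj_apply _ hD, conj_apply _ (isGrIn_relComp_swap_gr hη hD), conj_apply _ hD,
    relComp_swap_gr_trans]

theorem conj_res (hH : H ≤ F.S) {P' Q' : Subgroup T} (hP : P ≤ P') (hQ : Q ≤ Q')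
    (hP' : P' ≤ F.S) (hQ' : Q' ≤ F.S) {θ : P' ≃* Q'} (hθ : F.IsIso θ) {θ' : P ≃* Q}
    (hθ' : F.IsIso θ') (e : ∀ y : P, (θ' y : T) = θ (Subgroup.inclusion hP y))
    (n : Fam R F H N P') : conj hH hθ' (res hH hP' hP n) = res hH hQ' hQ (conj hH hθ n) := by
  rw [ext_iff']
  intro D hD
  rw [conj_apply _ hD, res_apply _ (isGrIn_relComp_swap_gr hθ' hD), res_apply _ hD,
    conj_apply _ (hD.le hQ)]
  refine congrArg n.1 ?_
  ext ⟨a, c⟩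
  simp only [mem_relComp, mem_swap, mem_gr]
  constructor
  · rintro ⟨b, h1, x, h2, h3⟩
    exact ⟨b, h1, Subgroup.inclusion hP x, h2, (e x).symm.trans h3⟩
  · rintro ⟨b, h1, x, h2, h3⟩
    refine ⟨b, h1, θ'.symm ⟨b, hD.p2_le (snd_mem_p2 h1)⟩, ?_, by simp⟩
    have h4 := e (θ'.symm ⟨b, hD.p2_le (snd_mem_p2 h1)⟩)
    rw [MulEquiv.apply_symm_apply] at h4
    have h5 := θ.injective (Subtype.ext (h3.trans h4))
    rw [← show (x : T) = c from h2, h5]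
    rfl

/-- Identifies the terms on the two sides of the Mackey formula for families: slicing by `y` and
conjugating back by `x` is slicing by `y * x`. -/
theorem relComp_slice_swap_conjGr {x y : T} (hD : p2 D ≤ K) (hy : y ∈ K) :
    relComp (slice D (MulAut.conj x • interConj K L x) y) (swap (conjGr x (interConj K L x))) =
      slice D L (y * x) := by
  have e : ∀ c, y * x * c * (y * x)⁻¹ = y * (x * c * x⁻¹) * y⁻¹ := fun c => by group
  have e' : ∀ c, x⁻¹ * (x * c * x⁻¹) * x = c := fun c => by group
  ext ⟨a, c⟩
  simp only [mem_relComp, mem_slice, mem_swap, mem_conjGr]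
  constructor
  · rintro ⟨_, ⟨h1, h2⟩, h3, rfl⟩
    exact ⟨interConj_le _ _ _ h3, by rwa [e]⟩
  · rintro ⟨h1, h2⟩
    rw [e] at h2
    have h3 : c ∈ interConj K L x := by
      refine ⟨mem_conj_smul.2 ?_, h1⟩
      have h4 := mul_mem (mul_mem (inv_mem hy) (hD (snd_mem_p2 h2))) hy
      convert h4 using 1
      simp only
      group
    exact ⟨_, ⟨mem_conj_smul.2 (by rwa [e']), h2⟩, h3, rfl⟩

theorem relSum_val {α : Type*} [Finite α] (s : Setoid α) (X : Set α) (g : α → Fam R F H N K)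
    (D : Subgroup (T × T)) : (relSum s X g).1 D = relSum s X fun x => (g x).1 D :=
  map_relSum (LinearMap.proj D ∘ₗ (Fam R F H N K).subtype) s X g

variable [Finite T]

/-- There is a single double coset, that of 1. -/
theorem ind_self (hH : H ≤ F.S) (hK : K ≤ F.S) (n : Fam R F H N K) : ind hH hK K n = n := by
  rw [ext_iff']
  intro D hD
  rw [ind_apply n hD, relSum_eq_of_unique (x := 1) (one_mem K)
    (fun y hy h => term_congr n hH hK hD hy h) (fun y hy h => absurd ⟨1, one_mem _, y⁻¹, ?_, ?_⟩ h),
    slice_one hD.p2_le, map_self n hD]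
  · exact inv_mem hy
  · group

/-- Double cosets for `L` in `J` are pairs formed by a double coset `x` for `K` in `J` and one, `y`,
for `L` in `K`. The corresponding representative is `x * y`. -/
theorem ind_ind (hH : H ≤ F.S) (hJ : J ≤ F.S) (hKJ : K ≤ J) (hLK : L ≤ K) (n : Fam R F H N L) :
    ind hH hJ K (ind hH (hKJ.trans hJ) L n) = ind hH hJ L n := by
  rw [ext_iff']
  intro D hD
  rw [ind_apply _ hD, ind_apply _ hD]
  refine Eq.trans ?_ (relSum_nest (s := cosetRel D K) (X := (J : Set T))
    (t := fun x => cosetRel (slice D K x) L) (Z := fun _ => (K : Set T))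
    (fun x y => x * y) (fun w hw w' hw' hww' => term_congr n hH hJ hD hw hww')
    (fun x hx y hy => mul_mem hx (hKJ hy)) ?_ ?_ ?_)
  · refine relSum_congr fun x hx => ?_
    rw [ind_apply _ (hD.slice hJ K hx), smul_relSum]
    refine relSum_congr fun y hy => ?_
    rw [← mul_smul, iA_mul_iA R (p1_slice_le _ _ _) (p1_slice_le _ _ _), slice_slice D hLK x hy]
  · intro w hw
    refine ⟨w, hw, ?_⟩
    rintro x hx ⟨b, hb, k, hk, rfl⟩
    exact ⟨k, hk, b, hb, 1, one_mem _, by group⟩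
  · intro x hx y hy z hz
    constructor
    · rintro ⟨b, hb, l, hl, e⟩
      obtain ⟨a, ha⟩ := mem_p2.1 hb
      have e1 : x⁻¹ * b * x = z * l⁻¹ * y⁻¹ := by
        rw [eq_mul_inv_iff_mul_eq, eq_mul_inv_iff_mul_eq, ← mul_right_inj x, e]
        group
      refine ⟨x⁻¹ * b * x, mem_p2.2 ⟨a, mem_slice.2 ⟨?_, ?_⟩⟩, l, hl, ?_⟩
      · rw [e1]
        exact mul_mem (mul_mem hz (inv_mem (hLK hl))) (inv_mem hy)
      · convert ha using 2
        group
      · rw [e1]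
        group
    · rintro ⟨b, hb, l, hl, rfl⟩
      obtain ⟨a, ha⟩ := mem_p2.1 hb
      exact ⟨_, snd_mem_p2 (mem_slice.1 ha).2, l, hl, by group⟩
  · rintro x hx y hy x' hx' y' hy' ⟨b, hb, l, hl, e⟩
    refine ⟨b, hb, y * l * y'⁻¹, mul_mem (mul_mem hy (hLK hl)) (inv_mem hy'), ?_⟩
    rw [eq_mul_inv_of_mul_eq e]
    group

theorem conj_ind (hH : H ≤ F.S) {P' Q' : Subgroup T} (hP : P ≤ P')
    (hP' : P' ≤ F.S) (hQ' : Q' ≤ F.S) {θ : P' ≃* Q'} (hθ : F.IsIso θ) {θ' : P ≃* Q}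
    (hθ' : F.IsIso θ') (e : ∀ y : P, (θ' y : T) = θ (Subgroup.inclusion hP y))
    (n : Fam R F H N P) : conj hH hθ (ind hH hP' P n) = ind hH hQ' Q (conj hH hθ' n) := by
  rw [ext_iff']
  intro D hD
  have hD' := isGrIn_relComp_swap_gr hθ hD
  rw [conj_apply _ hD, ind_apply _ hD', ind_apply _ hD, p1_relComp_swap_gr θ hD.p2_le]
  have key : ∀ x : P', slice (relComp D (swap (gr θ.toMonoidHom))) P x =
      relComp (slice D Q (θ x)) (swap (gr θ'.toMonoidHom)) := by
    intro x
    ext ⟨a, c⟩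
    simp only [mem_slice, mem_relComp, mem_swap, mem_gr]
    constructor
    · rintro ⟨hc, b, h1, y, h2, h3⟩
      have hy : y = x * Subgroup.inclusion hP ⟨c, hc⟩ * x⁻¹ := Subtype.ext h2
      refine ⟨θ' ⟨c, hc⟩, ⟨(θ' _).2, ?_⟩, ⟨c, hc⟩, rfl, rfl⟩
      rw [e, ← Subgroup.coe_mul, ← map_mul, ← Subgroup.coe_inv, ← map_inv, ← Subgroup.coe_mul,
        ← map_mul, ← hy]
      exact (show (θ y : T) = b from h3) ▸ h1
    · rintro ⟨b, ⟨hb, h1⟩, y, h2, h3⟩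
      have h2 : (y : T) = c := h2
      have h3 : (θ' y : T) = b := h3
      subst h2 h3
      refine ⟨y.2, _, h1, x * Subgroup.inclusion hP y * x⁻¹, rfl, ?_⟩
      change ((θ (x * Subgroup.inclusion hP y * x⁻¹) : Q') : T) = _
      rw [map_mul, map_mul, map_inv, e]
      rfl
  classical
  -- `θ` as a function on all of `T`; the value 1 outside `P'` is never used.
  let f : T → T := fun x => if h : x ∈ P' then (θ ⟨x, h⟩ : T) else 1
  have hf : ∀ x : P', f x = θ x := fun x => dif_pos x.2
  refine Eq.trans (relSum_congr fun x hx => ?_) (relSum_reindex f (X := (P' : Set T))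
    (s := cosetRel (relComp D (swap (gr θ.toMonoidHom))) P)
    (fun w hw w' hw' hww' => term_congr _ hH hQ' hD hw hww') ?_ ?_ ?_)
  · have h1 := hf ⟨x, hx⟩
    have h2 := key ⟨x, hx⟩
    dsimp only at h1 h2
    have hs := hD.slice hQ' Q (θ ⟨x, hx⟩).2
    rw [h1, h2, conj_apply _ hs, p1_relComp_swap_gr θ' hs.p2_le]
  · intro x hx
    rw [hf ⟨x, hx⟩]
    exact (θ _).2
  · intro w hw
    refine ⟨θ.symm ⟨w, hw⟩, (θ.symm _).2, ?_⟩
    rw [hf, MulEquiv.apply_symm_apply]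
  · intro x hx y hy
    lift x to P' using hx
    lift y to P' using hy
    rw [hf, hf]
    constructor
    · rintro ⟨b, hb, l, hl, h⟩
      have h1 : (y : T) = θ.symm ⟨b, hD.p2_le hb⟩ * x * θ'.symm ⟨l, hl⟩ := by
        have h2 : θ y = θ (θ.symm ⟨b, hD.p2_le hb⟩ * x * Subgroup.inclusion hP (θ'.symm ⟨l, hl⟩)) := by
          rw [map_mul, map_mul]
          refine Subtype.ext (h.trans ?_)
          rw [Subgroup.coe_mul, Subgroup.coe_mul, ← e]
          simp
        rw [θ.injective h2]
        rfl
      obtain ⟨a, ha⟩ := mem_p2.1 hb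
      exact ⟨_, mem_p2.2 ⟨a, b, ha, mem_swap.2 (mem_gr.2 ⟨θ.symm ⟨b, hD.p2_le hb⟩, rfl, by simp⟩)⟩,
        _, (θ'.symm ⟨l, hl⟩).2, h1⟩
    · rintro ⟨b, hb, l, hl, h⟩
      obtain ⟨a, c, hc, hb⟩ := mem_p2.1 hb
      obtain ⟨z, hz, hz'⟩ := mem_gr.1 (mem_swap.1 hb)
      have hz : (z : T) = b := hz
      have hz' : (θ z : T) = c := hz'
      subst hz hz'
      refine ⟨_, snd_mem_p2 hc, θ' ⟨l, hl⟩, (θ' _).2, ?_⟩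
      have : y = z * x * Subgroup.inclusion hP ⟨l, hl⟩ := Subtype.ext h
      rw [this, map_mul, map_mul, e]
      rfl

/-- The double cosets of p2 D and `L` in `J` refine those of `K` and `L`. Those inside the class of
`q` are indexed by double cosets in `K` modulo the intersection of `K` with a conjugate of `L`. -/
theorem res_ind (hH : H ≤ F.S) (hJ : J ≤ F.S) (hKJ : K ≤ J) (hLJ : L ≤ J) (n : Fam R F H N L) :
    res hH hJ hKJ (ind hH hJ L n) =
      ∑ᶠ q : DoubleCoset.Quotient (K.subgroupOf J : Set J) (L.subgroupOf J : Set J),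
        ind hH (hKJ.trans hJ) (MulAut.conj (q.out : T) • interConj K L (q.out : T))
          (conj hH (isIso_conjIso (hJ q.out.2) ((interConj_le K L (q.out : T)).trans
            (hLJ.trans hJ))) (res hH (hLJ.trans hJ) (interConj_le K L (q.out : T)) n)) := by
  have : Finite (DoubleCoset.Quotient (K.subgroupOf J : Set J) (L.subgroupOf J : Set J)) :=
    inferInstanceAs (Finite (_root_.Quotient _))
  rw [ext_iff']
  intro D hD
  rw [res_apply _ hD, ind_apply _ (hD.le hKJ), ← relSum_bot_univ, relSum_val]
  have hrel : ∀ x y : J, DoubleCoset.setoid (K.subgroupOf J : Set J) (L.subgroupOf J : Set J) x y ↔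
      ∃ k ∈ K, ∃ l ∈ L, (y : T) = k * x * l := by
    intro x y
    rw [DoubleCoset.rel_iff]
    constructor
    · rintro ⟨a, ha, b, hb, rfl⟩
      exact ⟨a, ha, b, hb, rfl⟩
    · rintro ⟨a, ha, b, hb, h⟩
      exact ⟨⟨a, hKJ ha⟩, ha, ⟨b, hLJ hb⟩, hb, Subtype.ext h⟩
  symm
  refine Eq.trans (relSum_congr fun q _ => ?_) (relSum_nest (X := Set.univ)
    (t := fun q : DoubleCoset.Quotient (K.subgroupOf J : Set J) (L.subgroupOf J : Set J) =>
      cosetRel D (MulAut.conj (q.out : T) • interConj K L (q.out : T)))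
    (Z := fun _ => (K : Set T)) (fun q y => y * (q.out : T))
    (fun w hw w' hw' hww' => term_congr n hH hJ (hD.le hKJ) hw hww')
    (fun q _ y hy => mul_mem (hKJ hy) q.out.2) ?_ ?_ ?_)
  · rw [ind_apply _ hD]
    refine relSum_congr fun y hy => ?_
    have hs := hD.slice (hKJ.trans hJ) (MulAut.conj (q.out : T) • interConj K L (q.out : T)) hy
    have hs' := isGrIn_relComp_swap_gr (isIso_conjIso (hJ q.out.2)
      ((interConj_le K L (q.out : T)).trans (hLJ.trans hJ))) hs
    have h1 := relComp_slice_swap_conjGr (L := L) (x := q.out) hD.p2_le hy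
    rw [conj_apply _ hs, res_apply _ hs', ← p1_relComp_swap_gr (conjIso (q.out : T) _) hs.p2_le]
    change iA R (inner H) (p1 (relComp _ (swap (conjGr _ _)))) _ • n.1 (relComp _ (swap (conjGr _ _))) = _
    rw [h1]
  · intro w hw
    refine ⟨Quotient.mk _ ⟨w, hw⟩, Set.mem_univ _, ?_⟩
    rintro q - rfl
    obtain ⟨k, hk, l, hl, h⟩ := (hrel _ _).1 (Quotient.exact (Quotient.out_eq
      (Quotient.mk (DoubleCoset.setoid (K.subgroupOf J : Set J) (L.subgroupOf J : Set J)) ⟨w, hw⟩)))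
    exact ⟨k, hk, 1, one_mem _, l, hl, by rw [one_mul]; exact h⟩
  · intro q _ y hy z hz
    constructor
    · rintro ⟨b, hb, l, hl, h⟩
      refine ⟨b, hb, q.out * l * (q.out : T)⁻¹, conj_smul_mem_conj_smul ⟨mem_conj_smul.2 ?_, hl⟩, ?_⟩
      · have h1 := mul_mem (mul_mem (inv_mem hy) (inv_mem (hD.p2_le hb))) hz
        rw [eq_mul_inv_of_mul_eq h] at h1
        convert h1 using 1
        group
      · rw [eq_mul_inv_of_mul_eq h]
        group
    · rintro ⟨b, hb, l, hl, rfl⟩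
      exact ⟨b, hb, _, interConj_le _ _ _ (mem_conj_smul.1 hl), by group⟩
  · rintro q - y hy q' - y' hy' ⟨b, hb, l, hl, h⟩
    have h1 := (hrel q.out q'.out).2 ⟨y'⁻¹ * b * y,
      mul_mem (mul_mem (inv_mem hy') (hD.p2_le hb)) hy, l, hl, by
        rw [eq_inv_mul_of_mul_eq h]
        group⟩
    have h2 := Quotient.sound h1
    exact (Quotient.out_eq q).symm.trans (h2.trans (Quotient.out_eq q'))

end Fam

end CoinductionModule

/-! ### The coinduced module over the Mackey algebra. -/

section CoinductionModule

open MackeyAlgebra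

variable {T : Type u} [Group T] (R : Type u) [CommRing R] {F : FusionSystem T}
  {H : Subgroup T} (hH : H ≤ F.S) (N : Type u) [AddCommGroup N] [Module R N]
  [Module (MackeyAlgebra R (inner H)) N] [IsScalarTower R (MackeyAlgebra R (inner H)) N]

/-- The Mackey functor coinduced from `N`. -/
def Coind (_ : H ≤ F.S) : Type u := ∀ K : {K : Subgroup T // K ≤ F.S}, Fam R F H N K.1

noncomputable instance : AddCommGroup (Coind R N hH) :=
  inferInstanceAs (AddCommGroup (∀ K : {K : Subgroup T // K ≤ F.S}, Fam R F H N K.1))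

noncomputable instance : Module R (Coind R N hH) :=
  inferInstanceAs (Module R (∀ K : {K : Subgroup T // K ≤ F.S}, Fam R F H N K.1))

namespace Coind

variable {R hH N} {A B C : {K : Subgroup T // K ≤ F.S}}

/-- The component of a family at `K`. -/
noncomputable def proj (K : {K : Subgroup T // K ≤ F.S}) : Coind R N hH →ₗ[R] Fam R F H N K.1 :=
  LinearMap.proj (φ := fun K : {K : Subgroup T // K ≤ F.S} => Fam R F H N K.1) K

theorem sum_apply {ι : Type*} (s : Finset ι) (f : ι → Coind R N hH)
    (K : {K : Subgroup T // K ≤ F.S}) : (∑ i ∈ s, f i) K = ∑ i ∈ s, f i K :=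
  map_sum (proj K) f s

open Classical in
/-- The endomorphism with the single component `f`. -/
noncomputable def hom (A B : {K : Subgroup T // K ≤ F.S})
    (f : Fam R F H N A.1 →ₗ[R] Fam R F H N B.1) : Module.End R (Coind R N hH) :=
  LinearMap.single R (fun K : {K : Subgroup T // K ≤ F.S} => Fam R F H N K.1) B ∘ₗ f ∘ₗ
    LinearMap.proj A

theorem hom_apply_same (f : Fam R F H N A.1 →ₗ[R] Fam R F H N B.1) (w : Coind R N hH) :
    hom A B f w B = f (w A) := by
  classical
  exact Pi.single_eq_same (M := fun K : {K : Subgroup T // K ≤ F.S} => Fam R F H N K.1) B _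

theorem hom_apply_of_ne (f : Fam R F H N A.1 →ₗ[R] Fam R F H N B.1) (w : Coind R N hH)
    (h : C ≠ B) : hom A B f w C = 0 := by
  classical
  exact Pi.single_eq_of_ne (M := fun K : {K : Subgroup T // K ≤ F.S} => Fam R F H N K.1) h _

theorem hom_mul_hom (g : Fam R F H N B.1 →ₗ[R] Fam R F H N C.1)
    (f : Fam R F H N A.1 →ₗ[R] Fam R F H N B.1) :
    (hom B C g * hom A B f : Module.End R (Coind R N hH)) = hom A C (g ∘ₗ f) := by
  refine LinearMap.ext fun w => funext fun K => ?_
  rw [Module.End.mul_apply]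
  by_cases hK : K = C
  · subst hK
    rw [hom_apply_same, hom_apply_same, hom_apply_same, LinearMap.comp_apply]
  · rw [hom_apply_of_ne _ _ hK, hom_apply_of_ne _ _ hK]

theorem hom_mul_hom_of_ne {B' : {K : Subgroup T // K ≤ F.S}}
    (g : Fam R F H N B'.1 →ₗ[R] Fam R F H N C.1)
    (f : Fam R F H N A.1 →ₗ[R] Fam R F H N B.1) (h : B' ≠ B) :
    (hom B' C g * hom A B f : Module.End R (Coind R N hH)) = 0 := by
  refine LinearMap.ext fun w => funext fun K => ?_
  rw [Module.End.mul_apply]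
  by_cases hK : K = C
  · subst hK
    rw [hom_apply_same, hom_apply_of_ne _ _ h, map_zero]
    rfl
  · rw [hom_apply_of_ne _ _ hK]
    rfl

theorem hom_sum {ι : Type*} (s : Finset ι) (f : ι → Fam R F H N A.1 →ₗ[R] Fam R F H N B.1) :
    (∑ i ∈ s, hom A B (f i) : Module.End R (Coind R N hH)) = hom A B (∑ i ∈ s, f i) := by
  refine LinearMap.ext fun w => funext fun K => ?_
  rw [LinearMap.sum_apply, sum_apply]
  by_cases hK : K = B
  · subst hK
    rw [hom_apply_same, LinearMap.sum_apply]
    exact Finset.sum_congr rfl fun i _ => hom_apply_same _ _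
  · rw [hom_apply_of_ne _ _ hK]
    exact Finset.sum_eq_zero fun i _ => hom_apply_of_ne _ _ hK

theorem sum_hom_id [Fintype {K : Subgroup T // K ≤ F.S}] :
    (∑ K, hom K K LinearMap.id : Module.End R (Coind R N hH)) = 1 := by
  classical
  refine LinearMap.ext fun w => ?_
  rw [LinearMap.sum_apply]
  refine funext fun K => ?_
  rw [sum_apply, Finset.sum_eq_single_of_mem K (Finset.mem_univ _)]
  · exact hom_apply_same _ _
  · intro L _ hL
    exact hom_apply_of_ne _ _ hL.symm

variable [Finite T]

/-- The action of the generators of the Mackey algebra. -/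
noncomputable def gen : F.Gen → Module.End R (Coind R N hH)
  | .ind A B h hB => hom ⟨A, h.trans hB⟩ ⟨B, hB⟩ (Fam.ind hH hB A)
  | .res A B h hB => hom ⟨B, hB⟩ ⟨A, h.trans hB⟩ (Fam.res hH hB h)
  | .conj P Q _ hφ => hom ⟨P, (F.le_of_mem hφ).1⟩ ⟨Q, (F.le_of_mem hφ).2⟩ (Fam.conj hH hφ)

theorem lift_gen_rel {a b : FreeAlgebra R F.Gen} (hab : F.Rel R a b) :
    FreeAlgebra.lift R (gen (R := R) (hH := hH) (N := N)) a =
      FreeAlgebra.lift R (gen (R := R) (hH := hH) (N := N)) b := by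
  cases hab with
  | res_self K hK =>
    rw [FreeAlgebra.lift_ι_apply, FreeAlgebra.lift_ι_apply, gen, gen]
    exact congrArg _ (LinearMap.ext fun n => (Fam.res_self hH hK n).trans (Fam.ind_self hH hK n).symm)
  | conj_self K hK φ hφ x hx e =>
    rw [FreeAlgebra.lift_ι_apply, FreeAlgebra.lift_ι_apply, gen, gen]
    exact congrArg _ (LinearMap.ext fun n =>
      (Fam.conj_self hH hφ hx e n).trans (Fam.ind_self hH hK n).symm)
  | res_res L K J hLK hKJ hJ =>
    rw [map_mul, FreeAlgebra.lift_ι_apply, FreeAlgebra.lift_ι_apply, FreeAlgebra.lift_ι_apply, gen,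
      gen, gen, hom_mul_hom]
    exact congrArg _ (LinearMap.ext fun n => Fam.res_res hH hJ hKJ hLK n)
  | ind_ind L K J hLK hKJ hJ =>
    rw [map_mul, FreeAlgebra.lift_ι_apply, FreeAlgebra.lift_ι_apply, FreeAlgebra.lift_ι_apply, gen,
      gen, gen, hom_mul_hom]
    exact congrArg _ (LinearMap.ext fun n => Fam.ind_ind hH hJ hKJ hLK n)
  | conj_conj P Q W φ ψ hφ hψ =>
    rw [map_mul, FreeAlgebra.lift_ι_apply, FreeAlgebra.lift_ι_apply, FreeAlgebra.lift_ι_apply, gen,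
      gen, gen, hom_mul_hom]
    exact congrArg _ (LinearMap.ext fun n => Fam.conj_conj hH hφ hψ n)
  | conj_ind P P' Q Q' hP hP' hQ hQ' θ hθ θ' hθ' e =>
    rw [map_mul, map_mul, FreeAlgebra.lift_ι_apply, FreeAlgebra.lift_ι_apply,
      FreeAlgebra.lift_ι_apply, FreeAlgebra.lift_ι_apply, gen, gen, gen, gen, hom_mul_hom,
      hom_mul_hom]
    exact congrArg _ (LinearMap.ext fun n => Fam.conj_ind hH hP hP' hQ' hθ hθ' e n)
  | conj_res P P' Q Q' hP hP' hQ hQ' θ hθ θ' hθ' e =>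
    rw [map_mul, map_mul, FreeAlgebra.lift_ι_apply, FreeAlgebra.lift_ι_apply,
      FreeAlgebra.lift_ι_apply, FreeAlgebra.lift_ι_apply, gen, gen, gen, gen, hom_mul_hom,
      hom_mul_hom]
    exact congrArg _ (LinearMap.ext fun n => Fam.conj_res hH hP hQ hP' hQ' hθ hθ' e n)
  | mackey L K J hL hK hJ =>
    have : Finite (DoubleCoset.Quotient (K.subgroupOf J : Set J) (L.subgroupOf J : Set J)) :=
      inferInstanceAs (Finite (_root_.Quotient _))
    have := Fintype.ofFinite
      (DoubleCoset.Quotient (K.subgroupOf J : Set J) (L.subgroupOf J : Set J))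
    rw [map_mul, FreeAlgebra.lift_ι_apply, FreeAlgebra.lift_ι_apply, gen, gen, hom_mul_hom,
      finsum_eq_sum_of_fintype, map_sum]
    simp only [map_mul, FreeAlgebra.lift_ι_apply, gen, hom_mul_hom, hom_sum]
    refine congrArg _ (LinearMap.ext fun n => ?_)
    rw [LinearMap.sum_apply]
    exact (Fam.res_ind hH hJ hK hL n).trans (finsum_eq_sum_of_fintype _)
  | orthogonal A B hA hB hne =>
    rw [map_mul, FreeAlgebra.lift_ι_apply, FreeAlgebra.lift_ι_apply, gen, gen, map_zero]
    exact hom_mul_hom_of_ne _ _ fun h => hne (congrArg Subtype.val h)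
  | one =>
    have := Fintype.ofFinite {K : Subgroup T // K ≤ F.S}
    rw [map_one, finsum_eq_sum_of_fintype, map_sum, ← sum_hom_id]
    refine Finset.sum_congr rfl fun K _ => ?_
    rw [FreeAlgebra.lift_ι_apply, gen]
    exact congrArg _ (LinearMap.ext fun n => Fam.ind_self hH K.2 n)

/-- The action of the Mackey algebra. -/
noncomputable def action : MackeyAlgebra R F →ₐ[R] Module.End R (Coind R N hH) :=
  MackeyAlgebra.lift R (FreeAlgebra.lift R gen) fun _ _ => lift_gen_rel

noncomputable instance : Module (MackeyAlgebra R F) (Coind R N hH) :=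
  Module.compHom _ (action (hH := hH) (N := N)).toRingHom

theorem action_gen (g : F.Gen) (w : Coind R N hH) :
    MackeyAlgebra.mk R F (FreeAlgebra.ι R g) • w = gen g w := by
  change action (MackeyAlgebra.mk R F (FreeAlgebra.ι R g)) w = _
  rw [action, MackeyAlgebra.lift_mk, FreeAlgebra.lift_ι_apply]

theorem algebraMap_smul (r : R) (w : Coind R N hH) :
    algebraMap R (MackeyAlgebra R F) r • w = r • w := by
  change action (algebraMap R (MackeyAlgebra R F) r) w = _
  rw [AlgHom.commutes]
  rfl

variable {K L : Subgroup T}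

theorem ind_smul (h : L ≤ K) (hK : K ≤ F.S) (w : Coind R N hH) :
    (ind R h hK • w) ⟨K, hK⟩ = Fam.ind hH hK L (w ⟨L, h.trans hK⟩) := by
  rw [ind, action_gen, gen, hom_apply_same]

theorem ind_smul_of_ne (h : L ≤ K) (hK : K ≤ F.S) (w : Coind R N hH)
    {J : {K : Subgroup T // K ≤ F.S}} (hJ : J.1 ≠ K) : (ind R h hK • w) J = 0 := by
  rw [ind, action_gen, gen, hom_apply_of_ne _ _ fun h => hJ (congrArg Subtype.val h)]

theorem res_smul (h : L ≤ K) (hK : K ≤ F.S) (w : Coind R N hH) :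
    (res R h hK • w) ⟨L, h.trans hK⟩ = Fam.res hH hK h (w ⟨K, hK⟩) := by
  rw [res, action_gen, gen, hom_apply_same]

theorem res_smul_of_ne (h : L ≤ K) (hK : K ≤ F.S) (w : Coind R N hH)
    {J : {K : Subgroup T // K ≤ F.S}} (hJ : J.1 ≠ L) : (res R h hK • w) J = 0 := by
  rw [res, action_gen, gen, hom_apply_of_ne _ _ fun h => hJ (congrArg Subtype.val h)]

theorem conj_smul {P Q : Subgroup T} {θ : P ≃* Q} (hθ : F.IsIso θ) (w : Coind R N hH) :
    (conj R hθ • w) ⟨Q, (F.le_of_mem hθ).2⟩ =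
      Fam.conj hH hθ (w ⟨P, (F.le_of_mem hθ).1⟩) := by
  rw [conj, action_gen, gen, hom_apply_same]

theorem conj_smul_of_ne {P Q : Subgroup T} {θ : P ≃* Q} (hθ : F.IsIso θ) (w : Coind R N hH)
    {J : {K : Subgroup T // K ≤ F.S}} (hJ : J.1 ≠ Q) : (conj R hθ • w) J = 0 := by
  rw [conj, action_gen, gen, hom_apply_of_ne _ _ fun h => hJ (congrArg Subtype.val h)]

end Coind

end CoinductionModule

/-! ### The unit of coinduction -/

section CoinductionUnit

open MackeyAlgebra

variable {T : Type u} [Group T] [Finite T] (R : Type u) [CommRing R] {F : FusionSystem T}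
  {H : Subgroup T}

namespace MackeyAlgebra

variable {K L A B : Subgroup T} {D E : Subgroup (T × T)}

theorem incl_iA (hH : H ≤ F.S) (hK : K ≤ H) :
    incl R (inner_le hH) (iA R (inner H) L K) = iA R F L K := by
  by_cases h : L ≤ K
  · rw [iA_eq R h (F := inner H) hK, iA_eq R h (hK.trans hH)]
    exact incl_ind R (inner_le hH) h hK
  · rw [iA_eq_zero R fun h' => h h'.1, iA_eq_zero R fun h' => h h'.1, map_zero]

theorem incl_rho (hH : H ≤ F.S) (hE : (inner H).IsGr E) (h : p2 E ≤ K) (hK : K ≤ H) :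
    incl R (inner_le hH) (rho R (inner H) E K) = rho R F E K := by
  obtain ⟨φ, hφ, e⟩ := hE.exists_iso
  have h1 := rho_gr R hφ h hK
  have h2 := rho_gr R (inner_le hH _ _ hφ) h (hK.trans hH)
  rw [← e] at h1 h2
  rw [h1, h2, map_mul]
  exact congrArg₂ _ (incl_conj R (inner_le hH) (isIso_symm hφ)) (incl_res R (inner_le hH) h hK)

theorem incl_algebraMap {E : FusionSystem T} (h : E ≤ F) (r : R) :
    incl R h (algebraMap R _ r) = algebraMap R _ r * incl R h 1 := by
  rw [Algebra.algebraMap_eq_smul_one, incl_smul, Algebra.smul_def]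

end MackeyAlgebra

variable {K L : Subgroup T} {D E : Subgroup (T × T)}

namespace Coind

section Unit

variable (hH : H ≤ F.S) (M : Type u) [AddCommGroup M] [Module (MackeyAlgebra R F) M]

variable {M} in
/-- The component of the unit of coinduction at the graph of a morphism. -/
noncomputable def unitAux (x : M) (D : Subgroup (T × T)) (K : Subgroup T) (hD : p1 D ≤ H) :
    Restriction R (inner_le hH) M :=
  ⟨rho R F D K • x, by
    have := smul_mem_restriction R (inner_le hH) (iA R (inner H) (p1 D) (p1 D)) (rho R F D K • x)
    rwa [incl_iA R hH hD, ← mul_smul, iA_mul_rho] at this⟩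

variable {M}

theorem restriction_ext {x y : Restriction R (inner_le hH) M}
    (h : Restriction.val R (inner_le hH) M x = Restriction.val R (inner_le hH) M y) : x = y :=
  Subtype.ext h

theorem val_smul (a : MackeyAlgebra R (inner H)) (x : Restriction R (inner_le hH) M) :
    Restriction.val R (inner_le hH) M (a • x) =
      incl R (inner_le hH) a • Restriction.val R (inner_le hH) M x := rfl

theorem val_unitAux (x : M) (hD : p1 D ≤ H) :
    Restriction.val R (inner_le hH) M (unitAux R hH x D K hD) = rho R F D K • x := rfl

theorem incl_one_smul_val (x : Restriction R (inner_le hH) M) :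
    incl R (inner_le hH) 1 • Restriction.val R (inner_le hH) M x =
      Restriction.val R (inner_le hH) M x := x.2

variable [Module R (Restriction R (inner_le hH) M)]
  [IsScalarTower R (MackeyAlgebra R (inner H)) (Restriction R (inner_le hH) M)]

open Classical in
/-- The unit of coinduction. -/
noncomputable def unitFun (x : M) : Coind R (Restriction R (inner_le hH) M) hH := fun K =>
  ⟨fun D => if h : IsGrIn F H K.1 D then unitAux R hH x D K.1 h.p1_le else 0, fun D hD => dif_neg hD,
    fun D E hD hE h => by
      dsimp only
      rw [dif_pos hD, dif_pos (hD.relComp_left hH hE)]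
      refine restriction_ext R hH ?_
      rw [val_smul R hH, val_unitAux, val_unitAux, incl_rho R hH hE h hD.p1_le, ← mul_smul,
        rho_mul_rho R (isGr_of_inner hH hE) hD.isGr h hD.p2_le K.2],
    fun D hD k hk => by
      dsimp only
      rw [dif_pos hD, dif_pos (hD.conj_snd K.2 hk)]
      refine restriction_ext R hH ?_
      rw [val_unitAux, val_unitAux, rho_conj_snd R hD.isGr hD.p2_le K.2 hk]⟩

theorem val_unitFun (x : M) {K : {K : Subgroup T // K ≤ F.S}} (hD : IsGrIn F H K.1 D) :
    Restriction.val R (inner_le hH) M ((unitFun R hH x K).1 D) = rho R F D K.1 • x := by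
  rw [← val_unitAux R hH x hD.p1_le]
  exact congrArg _ (dif_pos hD)

theorem ext_val {v w : Coind R (Restriction R (inner_le hH) M) hH}
    (h : ∀ (K : {K : Subgroup T // K ≤ F.S}) (D : Subgroup (T × T)), IsGrIn F H K.1 D →
      Restriction.val R (inner_le hH) M ((v K).1 D) =
        Restriction.val R (inner_le hH) M ((w K).1 D)) : v = w :=
  funext fun K => Fam.ext_iff'.2 fun D hD => restriction_ext R hH (h K D hD)

theorem unitFun_add (x y : M) :
    unitFun R hH (x + y) = unitFun R hH x + unitFun R hH y := ext_val R hH fun K D hD => by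
  change _ = Restriction.val R (inner_le hH) M ((unitFun R hH x K).1 D + (unitFun R hH y K).1 D)
  rw [map_add, val_unitFun R hH _ hD, val_unitFun R hH _ hD, val_unitFun R hH _ hD, smul_add]

variable (M) in
/-- The unit of coinduction, a morphism of Mackey functors. -/
noncomputable def unit : M →ₗ[MackeyAlgebra R F] Coind R (Restriction R (inner_le hH) M) hH where
  toFun := unitFun R hH
  map_add' := unitFun_add R hH
  map_smul' a x := by
    rw [RingHom.id_apply]
    -- It suffices to treat generators. For inductions the claim is the Mackey formula
    -- `rho_mul_ind`; for restrictions and conjugations it is the composition of graphs.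
    induction a using MackeyAlgebra.induction generalizing x with
    | hind A B h hB =>
      refine ext_val R hH fun K D hD => ?_
      rw [val_unitFun R hH _ hD, ← mul_smul]
      by_cases hK : K.1 = B
      · obtain ⟨K, hKS⟩ := K
        dsimp only at hK hD
        subst hK
        rw [ind_smul, Fam.ind_apply _ hD, map_relSum, ← iA_eq R h hB,
          rho_mul_ind R hD.isGr hD.p2_le hB h, relSum_smul]
        refine relSum_congr fun y hy => ?_
        rw [val_smul R hH, val_unitFun R hH _ (hD.slice hB A hy), incl_iA R hH hD.p1_le, mul_smul]
      · rw [ind_smul_of_ne _ _ _ hK, ← iA_eq R h hB, rho_mul_iA_eq_zero R D A hK, zero_smul]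
        exact (map_zero _).symm
    | hres A B h hB =>
      refine ext_val R hH fun K D hD => ?_
      rw [val_unitFun R hH _ hD, ← mul_smul]
      by_cases hK : K.1 = A
      · obtain ⟨K, hKS⟩ := K
        dsimp only at hK hD
        subst hK
        rw [res_smul, Fam.res_apply _ hD, val_unitFun R hH _ (hD.le h), res_eq_rho,
          rho_res_right R hD.isGr hD.p2_le h hB]
      · rw [res_smul_of_ne _ _ _ hK, res_eq_rho, rho_mul_rho_eq_zero R D _ (by rwa [p1_diag]),
          zero_smul]
        exact (map_zero _).symm
    | hconj P Q φ hφ =>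
      refine ext_val R hH fun K D hD => ?_
      rw [val_unitFun R hH _ hD, ← mul_smul]
      have h1 : p1 (swap (gr φ.toMonoidHom)) = Q := by rw [p1_swap, p2_gr_equiv]
      by_cases hK : K.1 = Q
      · obtain ⟨K, hKS⟩ := K
        dsimp only at hK hD
        subst hK
        rw [conj_smul, Fam.conj_apply _ hD, val_unitFun R hH _ (Fam.isGrIn_relComp_swap_gr hφ hD),
          conj_eq_rho, rho_mul_rho' R hD.isGr (isGr_gr (F := F) hφ).swap h1 hD.p2_le
            (by rw [p2_swap, p1_gr]) (F.le_of_mem hφ).1]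
      · rw [conj_smul_of_ne _ _ hK, conj_eq_rho, rho_mul_rho_eq_zero R D _ (by rwa [h1]),
          zero_smul]
        exact (map_zero _).symm
    | halg r =>
      refine ext_val R hH fun K D hD => ?_
      rw [val_unitFun R hH _ hD, algebraMap_smul]
      change _ = Restriction.val R (inner_le hH) M (r • (unitFun R hH x K).1 D)
      rw [← IsScalarTower.algebraMap_smul (MackeyAlgebra R (inner H)) r ((unitFun R hH x K).1 D),
        val_smul R hH, incl_algebraMap, mul_smul, incl_one_smul_val R hH, val_unitFun R hH _ hD, ← mul_smul,
        ← mul_smul, Algebra.commutes]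
    | hadd a b ha hb =>
      rw [add_smul, add_smul, ← ha, ← hb]
      exact unitFun_add R hH _ _
    | hmul a b ha hb => rw [mul_smul, mul_smul, ha, hb]

end Unit

end Coind

end CoinductionUnit

/-! ### The inclusion of a module in its coinduced functor, and its retraction. -/

section CoinductionInclusion

open MackeyAlgebra

variable {T : Type u} [Group T] (R : Type u) [CommRing R] {F : FusionSystem T}
  {H : Subgroup T} {K L : Subgroup T} {D E : Subgroup (T × T)}

namespace FusionSystem

theorem relComp_swap_self (hD : F.IsGr D) : relComp D (swap D) = diag (p1 D) := by
  ext ⟨a, c⟩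
  rw [mem_relComp, mem_diag]
  constructor
  · rintro ⟨b, h1, h2⟩
    exact ⟨mem_p1.2 ⟨b, h1⟩, hD.fst_eq h1 h2⟩
  · rintro ⟨h1, h2⟩
    have h2 : a = c := h2
    subst h2
    obtain ⟨b, hb⟩ := mem_p1.1 h1
    exact ⟨b, hb, hb⟩

/-- `D` and a conjugation by an element of `H` both extend the centric graph `E` to the same source.
By uniqueness they differ by a central element of the image of `E`, which lies in `H`. -/
theorem IsSaturated.isGr_inner_of_le [Finite T] {p : ℕ} [Fact p.Prime] (hT : IsPGroup p T)
    (hF : F.IsSaturated p) (hH : H ≤ F.S) (hD : F.IsGr D) (h1 : p1 D ≤ H) (h2 : p2 D ≤ H)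
    (hE : (inner H).IsGr E) (hc : F.IsCentric (p1 E)) (h : E ≤ D) : (inner H).IsGr D := by
  obtain ⟨P, Q, φ, ⟨hP, hQ, x, hx, e⟩, rfl⟩ := hE
  have h3 : gr φ ≤ conjGr x (p1 D) := by
    rintro ⟨a, b⟩ hd
    obtain ⟨y, rfl, rfl⟩ := mem_gr.1 hd
    exact mem_conjGr.2 ⟨fst_mem_p1 (h hd), e y⟩
  obtain ⟨z, hz, hz'⟩ := hF.exists_conj_of_p1_eq hT (isGr_conjGr (hH hx) hD.p1_le) hD h3 h hc
    (p1_conjGr _ _)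
  rw [hz']
  exact (isGr_conjGr (F := inner H) hx h1).conj_smul (one_mem _)
    (h2 (p2_mono h hz.1))

end FusionSystem

namespace Coind

variable (F H) in
/-- The morphisms in `F` between subgroups of `H` which are not induced by elements of `H` are
not seen by the module `N`. -/
def Detects (N : Type u) [AddCommGroup N] [Module (MackeyAlgebra R (inner H)) N] : Prop :=
  ∀ D E, F.IsGr D → p1 D ≤ H → p2 D ≤ H → ¬ (inner H).IsGr D → (inner H).IsGr E →
    p2 E ≤ p1 D → ∀ K, ∀ n : N, rho R (inner H) (relComp E D) K • n = 0

variable {R} {N : Type u} [AddCommGroup N] [Module (MackeyAlgebra R (inner H)) N]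

theorem rho_smul_eq_zero (hN : ∀ A ≤ H, ¬ F.IsCentric A → ∀ n : N, iA R (inner H) A A • n = 0)
    (h : ¬ F.IsCentric (p1 D)) (n : N) : rho R (inner H) D K • n = 0 := by
  by_cases hD : (inner H).IsGr D ∧ p2 D ≤ K ∧ K ≤ (inner H).S
  · rw [← iA_mul_rho, mul_smul, hN _ hD.1.p1_le h]
  · rw [rho_eq_zero R hD, zero_smul]

/-- Suppose `E` and its composite with `D` both come from `H`. Then so does a restriction of `D`,
and if it is centric `D` itself comes from `H`. In the other cases `rho` is zero by default, or it
passes through a subgroup that is not centric. -/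
theorem detects [Finite T] {p : ℕ} [Fact p.Prime] (hT : IsPGroup p T) (hF : F.IsSaturated p) (hH : H ≤ F.S)
    (hN : ∀ A ≤ H, ¬ F.IsCentric A → ∀ n : N, iA R (inner H) A A • n = 0) :
    Detects R F H N := by
  intro D E hD h1 h2 hDi hE h K n
  have hp : p1 (relComp E D) = p1 E := p1_relComp h
  by_cases hc : F.IsCentric (p1 E)
  · by_cases hi : (inner H).IsGr (relComp E D)
    · refine absurd ?_ hDi
      refine hF.isGr_inner_of_le hT hH hD h1 h2 (hE.swap.relComp hi) ?_ ?_
      · rw [p1_relComp (by rw [p2_swap, hp]), p1_swap]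
        exact hc.of_conj (isGr_of_inner hH hE).conj
      · rintro ⟨a, c⟩ ⟨b, hb, d, hd, hdc⟩
        have := hE.snd_eq hb hd
        dsimp only at this hdc
        rwa [this]
    · rw [rho_eq_zero R fun h => hi h.1, zero_smul]
  · exact rho_smul_eq_zero hN (by rwa [hp]) n

theorem Detects.of_le (hV : Detects R F H N) (hD : F.IsGr D) (h1 : p1 D ≤ H) (h2 : p2 D ≤ H)
    (hDi : ¬ (inner H).IsGr D) (h : E ≤ D) (n : N) : rho R (inner H) E K • n = 0 := by
  have := hV D (diag (p1 E)) hD h1 h2 hDi (isGr_diag (F := inner H) ((p1_mono h).trans h1))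
    (by rw [p2_diag]; exact p1_mono h) K n
  rwa [relComp_diag_left, IsGr.inf_comap_p1 hD h] at this

theorem isGr_inner_conj_snd {k : T} (hk : k ∈ H) :
    (inner H).IsGr (MulAut.conj ((1, k) : T × T) • D) ↔ (inner H).IsGr D := by
  refine ⟨fun h => ?_, fun h => h.conj_smul (one_mem _) hk⟩
  have := h.conj_smul (g := (1, k⁻¹)) (one_mem _) (inv_mem (show k ∈ H from hk))
  rwa [conj_smul_smul, Prod.mk_mul_mk, inv_mul_cancel, one_mul, ← Prod.one_eq_mk,
    conj_one_smul] at this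

theorem Detects.of_slice (hV : Detects R F H N) (hH : H ≤ F.S) (hD : F.IsGr D) (h1 : p1 D ≤ H)
    (h2 : p2 D ≤ H) (hDi : ¬ (inner H).IsGr D) {x : T} (hx : x ∈ H) (n : N) :
    rho R (inner H) (slice D L x) K • n = 0 := by
  refine hV.of_le (D := MulAut.conj ((1, x⁻¹) : T × T) • D)
    (hD.conj_smul (one_mem _) (hH (inv_mem hx))) ?_ ?_ ?_ inf_le_left n
  · rw [p1_conj_smul, conj_one_smul]
    exact h1
  · rw [p2_conj_smul]
    exact conj_smul_le (inv_mem hx) h2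
  · rwa [isGr_inner_conj_snd (inv_mem hx)]

variable [Module R N] [IsScalarTower R (MackeyAlgebra R (inner H)) N]

/-- The inclusion of `N` in the coinduced Mackey functor. -/
noncomputable def zeta (hH : H ≤ F.S) (hV : Detects R F H N) : N →ₗ[R] Coind R N hH where
  toFun n K := ⟨fun D => rho R (inner H) D K.1 • n,
    fun D hD => by
      dsimp only
      rw [rho_eq_zero R fun h => hD ⟨isGr_of_inner hH h.1, h.1.p1_le, h.2.1⟩, zero_smul],
    fun D E hD hE h => by
      dsimp only
      by_cases hK : K.1 ≤ H
      · by_cases hDi : (inner H).IsGr D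
        · rw [← mul_smul, rho_mul_rho R hE hDi h hD.p2_le hK]
        -- `D` does not come from `H`, so its component vanishes by default. Its composite with `E`
        -- might still come from `H`; `hV` says that it acts as zero.
        · rw [rho_eq_zero R fun h => hDi h.1, zero_smul, smul_zero,
            hV D E hD.isGr hD.p1_le (hD.p2_le.trans hK) hDi hE h]
      · rw [rho_eq_zero R (D := D) fun h => hK h.2.2,
          rho_eq_zero R (D := relComp E D) fun h => hK h.2.2, zero_smul, smul_zero],
    fun D hD k hk => by
      dsimp only
      by_cases hK : K.1 ≤ H
      · by_cases hDi : (inner H).IsGr D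
        · rw [rho_conj_snd R (F := FusionSystem.inner H) hDi hD.p2_le hK hk]
        · rw [rho_eq_zero R fun h => hDi h.1,
            rho_eq_zero R fun h => hDi ((isGr_inner_conj_snd (hK hk)).1 h.1)]
      · rw [rho_eq_zero R fun h => hK h.2.2, rho_eq_zero R fun h => hK h.2.2]⟩
  map_add' n m := funext fun K => Subtype.ext (funext fun D => smul_add _ n m)
  map_smul' r n := funext fun K => Subtype.ext (funext fun D => smul_comm _ r n)

theorem zeta_apply {hH : H ≤ F.S} {hV : Detects R F H N} (n : N) (K : {K : Subgroup T // K ≤ F.S})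
    (D : Subgroup (T × T)) : (zeta hH hV n K).1 D = rho R (inner H) D K.1 • n := rfl

theorem ext_val' {hH : H ≤ F.S} {v w : Coind R N hH}
    (h : ∀ (K : {K : Subgroup T // K ≤ F.S}) (D : Subgroup (T × T)), IsGrIn F H K.1 D →
      (v K).1 D = (w K).1 D) : v = w :=
  funext fun K => Fam.ext_iff'.2 (h K)

/-- The retraction of the inclusion of `N` in the coinduced Mackey functor. -/
noncomputable def retract (hH : H ≤ F.S) : Coind R N hH →ₗ[R] N :=
  ∑ᶠ A : {A : Subgroup T // A ≤ H},
    LinearMap.proj (diag A.1) ∘ₗ (Fam R F H N A.1).subtype ∘ₗ proj ⟨A.1, A.2.trans hH⟩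

theorem isGrIn_diag {A : Subgroup T} (hH : H ≤ F.S) (hA : A ≤ H) : IsGrIn F H A (diag A) :=
  ⟨isGr_diag (hA.trans hH), by rwa [p1_diag], by rw [p2_diag]⟩

theorem retract_apply [Fintype {A : Subgroup T // A ≤ H}] {hH : H ≤ F.S} (w : Coind R N hH) :
    retract hH w = ∑ A : {A : Subgroup T // A ≤ H}, (w ⟨A.1, A.2.trans hH⟩).1 (diag A.1) := by
  rw [retract, finsum_eq_sum_of_fintype, LinearMap.sum_apply]
  rfl

theorem iA_smul_of_ne {hH : H ≤ F.S} (w : Coind R N hH) {A B : Subgroup T} (hB : B ≤ H)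
    (h : A ≠ B) : iA R (inner H) A A • (w ⟨B, hB.trans hH⟩).1 (diag B) = 0 := by
  have := Fam.map_self (w ⟨B, hB.trans hH⟩) (isGrIn_diag hH hB)
  rw [p1_diag] at this
  rw [← this, ← mul_smul, iA_self_mul_of_ne R h, zero_smul]

variable [Finite T]

/-- The family of `n` is supported at the subgroups of `H`, so it lies in the restriction of the
coinduced functor. -/
theorem incl_one_smul_zeta {hH : H ≤ F.S} {hV : Detects R F H N} (n : N) :
    incl R (inner_le hH) 1 • zeta hH hV n = zeta hH hV n := by
  have := Fintype.ofFinite {K : Subgroup T // K ≤ (FusionSystem.inner H).S}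
  rw [incl_one, idem, finsum_eq_sum_of_fintype, Finset.sum_smul]
  refine ext_val' fun K D hD => ?_
  rw [sum_apply]
  by_cases hK : K.1 ≤ H
  · rw [Finset.sum_eq_single_of_mem ⟨K.1, hK⟩ (Finset.mem_univ _)]
    · rw [ind_smul, Fam.ind_self]
    · intro L _ hL
      exact ind_smul_of_ne _ _ _ fun h => hL (Subtype.ext h.symm)
  · rw [Finset.sum_eq_zero, zeta_apply, rho_eq_zero R fun h => hK h.2.2, zero_smul]
    · rfl
    · intro L _
      exact ind_smul_of_ne _ _ _ fun h => hK (h.le.trans L.2)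

/-- Over graphs coming from `H` this is the computation made for `unit`. Over the others both sides
vanish; for inductions this needs `Detects.of_slice`. -/
theorem zeta_smul {hH : H ≤ F.S} {hV : Detects R F H N} (a : MackeyAlgebra R (inner H)) (n : N) :
    zeta hH hV (a • n) = incl R (inner_le hH) a • zeta hH hV n := by
  induction a using MackeyAlgebra.induction generalizing n with
  | hind A B h hB =>
    refine ext_val' fun K D hD => ?_
    rw [zeta_apply, incl_ind, ← mul_smul]
    by_cases hK : K.1 = B
    · obtain ⟨K, hKS⟩ := K
      dsimp only at hK hD
      subst hK
      rw [ind_smul, Fam.ind_apply _ hD, ← iA_eq R h hB]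
      by_cases hDi : (inner H).IsGr D
      · rw [rho_mul_ind R hDi hD.p2_le hB h, relSum_smul]
        refine relSum_congr fun y hy => ?_
        rw [zeta_apply, mul_smul]
      · rw [rho_eq_zero R fun h => hDi h.1, zero_mul, zero_smul, relSum_eq_zero]
        intro x hx
        rw [zeta_apply, hV.of_slice hH hD.isGr hD.p1_le (hD.p2_le.trans hB) hDi (hB hx), smul_zero]
    · rw [ind_smul_of_ne _ _ _ hK, ← iA_eq R h hB, rho_mul_iA_eq_zero R D A hK, zero_smul]
      rfl
  | hres A B h hB =>
    refine ext_val' fun K D hD => ?_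
    rw [zeta_apply, incl_res, ← mul_smul, res_eq_rho]
    by_cases hK : K.1 = A
    · obtain ⟨K, hKS⟩ := K
      dsimp only at hK hD
      subst hK
      rw [res_smul, Fam.res_apply _ hD, zeta_apply]
      by_cases hDi : (inner H).IsGr D
      · rw [rho_res_right R hDi hD.p2_le h hB]
      · rw [rho_eq_zero R fun h => hDi h.1, rho_eq_zero R fun h => hDi h.1, zero_mul]
    · rw [res_smul_of_ne _ _ _ hK, rho_mul_rho_eq_zero R D _ (by rwa [p1_diag]), zero_smul]
      rfl
  | hconj P Q φ hφ =>
    refine ext_val' fun K D hD => ?_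
    have hφ' : F.IsIso φ := inner_le hH _ _ hφ
    have hi : incl R (inner_le hH) (conj R hφ) = conj R hφ' := incl_conj R (inner_le hH) hφ
    rw [zeta_apply, hi, ← mul_smul, conj_eq_rho]
    have h1 : p1 (swap (gr φ.toMonoidHom)) = Q := by rw [p1_swap, p2_gr_equiv]
    by_cases hK : K.1 = Q
    · obtain ⟨K, hKS⟩ := K
      dsimp only at hK hD
      subst hK
      rw [conj_smul, Fam.conj_apply _ hD, zeta_apply]
      by_cases hDi : (inner H).IsGr D
      · rw [rho_mul_rho' R hDi (isGr_gr (F := inner H) hφ).swap h1 hD.p2_le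
            (by rw [p2_swap, p1_gr]) ((inner H).le_of_mem hφ).1]
      · rw [rho_eq_zero R fun h => hDi h.1, zero_mul, rho_eq_zero]
        -- `φ` comes from `H`, so composing back with it would show that `D` does too.
        rintro ⟨h, -⟩
        refine hDi ?_
        have h2 := h.relComp (isGr_gr (F := inner H) hφ)
        have h3 := relComp_swap_self (isGr_gr (F := inner H) hφ).swap
        rw [swap_swap, h1] at h3
        rwa [relComp_assoc, h3, relComp_diag_right hD.p2_le] at h2
    · rw [conj_smul_of_ne _ _ hK, rho_mul_rho_eq_zero R D _ (by rwa [h1]), zero_smul]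
      rfl
  | halg r =>
    rw [incl_algebraMap, mul_smul, incl_one_smul_zeta, algebraMap_smul,
      IsScalarTower.algebraMap_smul, map_smul]
  | hadd a b ha hb => rw [add_smul, map_add, ha, hb, map_add, add_smul]
  | hmul a b ha hb => rw [mul_smul, ha, hb, map_mul, mul_smul]

/-- The values at the diagonals of different subgroups lie in the images of different orthogonal
idempotents, and `a` sees only one of them. -/
theorem smul_retract {hH : H ≤ F.S} (w : Coind R N hH) {A : Subgroup T} (hA : A ≤ H)
    (a : MackeyAlgebra R (inner H)) (ha : a * iA R (inner H) A A = a) :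
    a • retract hH w = a • (w ⟨A, hA.trans hH⟩).1 (diag A) := by
  have := Fintype.ofFinite {K : Subgroup T // K ≤ H}
  rw [retract_apply, Finset.smul_sum, Finset.sum_eq_single_of_mem ⟨A, hA⟩ (Finset.mem_univ _)]
  intro B _ hB
  rw [← ha, mul_smul, iA_smul_of_ne w B.2 fun h => hB (Subtype.ext h.symm), smul_zero]

theorem retract_eq {hH : H ≤ F.S} (w : Coind R N hH) {A : Subgroup T} (hA : A ≤ H)
    (h : ∀ B : {K : Subgroup T // K ≤ F.S}, B.1 ≠ A → w B = 0) :
    retract hH w = (w ⟨A, hA.trans hH⟩).1 (diag A) := by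
  have := Fintype.ofFinite {K : Subgroup T // K ≤ H}
  rw [retract_apply, Finset.sum_eq_single_of_mem ⟨A, hA⟩ (Finset.mem_univ _)]
  intro B _ hB
  rw [h _ fun h => hB (Subtype.ext h)]
  rfl

theorem incl_one_smul_retract {hH : H ≤ F.S} (w : Coind R N hH) :
    retract hH (incl R (inner_le hH) 1 • w) = retract hH w := by
  have : Fintype {K : Subgroup T // K ≤ (FusionSystem.inner H).S} :=
    Fintype.ofFinite {K : Subgroup T // K ≤ H}
  have : Fintype {K : Subgroup T // K ≤ H} := this
  rw [retract_apply, retract_apply]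
  refine Finset.sum_congr rfl fun A _ => ?_
  rw [incl_one, idem, finsum_eq_sum_of_fintype, Finset.sum_smul, sum_apply,
    Finset.sum_eq_single_of_mem ⟨A.1, A.2⟩ (Finset.mem_univ _)]
  · rw [ind_smul, Fam.ind_self]
  · intro L _ hL
    exact ind_smul_of_ne _ _ _ fun h => hL (Subtype.ext h.symm)

/-- At a diagonal the action of a restriction or a conjugation is the compatibility condition on
families. For an induction only the double coset of 1 occurs. -/
theorem retract_smul {hH : H ≤ F.S} (a : MackeyAlgebra R (inner H)) (w : Coind R N hH) :
    retract hH (incl R (inner_le hH) a • w) = a • retract hH w := by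
  induction a using MackeyAlgebra.induction generalizing w with
  | hind A B h hB =>
    have hB' : B ≤ H := hB
    have hi : incl R (inner_le hH) (ind R h hB) = ind R h (hB'.trans hH) :=
      incl_ind R (inner_le hH) h hB
    rw [hi, retract_eq _ hB' fun K hK => ind_smul_of_ne _ _ _ hK, ind_smul,
      Fam.ind_apply _ (isGrIn_diag hH hB'), smul_retract w (h.trans hB') _
        (by rw [iA_eq R le_rfl (h.trans hB), ind_self_mul]),
      relSum_eq_of_unique (x := 1) (one_mem B)]
    · have : slice (diag B) A 1 = diag A := by
        ext ⟨a, b⟩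
        rw [mem_slice, mem_diag, mem_diag]
        simp only [one_mul, inv_one, mul_one]
        constructor
        · rintro ⟨h1, h2, rfl⟩
          exact ⟨h1, rfl⟩
        · rintro ⟨h1, rfl⟩
          exact ⟨h1, h h1, rfl⟩
      rw [this, p1_diag, p1_diag, iA_eq R h hB]
    · intro y hy hy'
      exact Fam.term_congr _ hH (hB'.trans hH) (isGrIn_diag hH hB') hy hy'
    · intro y hy hy'
      refine absurd ⟨y⁻¹, ?_, 1, one_mem _, by group⟩ hy'
      rw [p2_diag]
      exact inv_mem hy
  | hres A B h hB =>
    have hB' : B ≤ H := hB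
    have hA : A ≤ H := h.trans hB'
    have hi : incl R (inner_le hH) (res R h hB) = res R h (hB'.trans hH) :=
      incl_res R (inner_le hH) h hB
    rw [hi, retract_eq _ hA fun K hK => res_smul_of_ne _ _ _ hK, res_smul,
      Fam.res_apply _ (isGrIn_diag hH hA), smul_retract w hB' _
        (by rw [iA_eq R le_rfl hB, res_mul]), res_eq_rho]
    have h1 := Fam.map_res (w ⟨B, hB'.trans hH⟩) (isGrIn_diag hH hB') (E := diag A) (by
      rintro ⟨a, b⟩ hd
      have := mem_diag.1 hd
      exact mem_diag.2 ⟨h this.1, this.2⟩)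
    rw [p1_diag, p1_diag] at h1
    exact h1.symm
  | hconj P Q φ hφ =>
    have hP : P ≤ H := ((inner H).le_of_mem hφ).1
    have hQ : Q ≤ H := ((inner H).le_of_mem hφ).2
    have h1 : p1 (swap (gr φ.toMonoidHom)) = Q := by rw [p1_swap, p2_gr_equiv]
    have h2 : p2 (swap (gr φ.toMonoidHom)) = P := by rw [p2_swap, p1_gr]
    have hφ' : F.IsIso φ := inner_le hH _ _ hφ
    have hi : incl R (inner_le hH) (conj R hφ) = conj R hφ' := incl_conj R (inner_le hH) hφ
    rw [hi, retract_eq _ hQ fun K hK => conj_smul_of_ne _ _ hK, conj_smul,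
      Fam.conj_apply _ (isGrIn_diag hH hQ), smul_retract w hP _
        (by rw [iA_eq R le_rfl ((inner H).le_of_mem hφ).1, MackeyAlgebra.conj_mul]), conj_eq_rho]
    have h3 := Fam.map_rho (w ⟨P, hP.trans hH⟩) (isGrIn_diag hH hP)
      (E := swap (gr φ.toMonoidHom)) (isGr_gr (F := inner H) hφ).swap (by rw [p1_diag, h2])
    rw [p1_diag, relComp_diag_right h2.le] at h3
    rw [h3]
    refine congrArg _ ?_
    rw [relComp_diag_left]
    refine inf_eq_left.2 fun d hd => ?_
    have := fst_mem_p1 hd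
    rwa [h1] at this
  | halg r =>
    rw [incl_algebraMap, mul_smul, algebraMap_smul, map_smul, incl_one_smul_retract,
      IsScalarTower.algebraMap_smul]
  | hadd a b ha hb => rw [map_add, add_smul, map_add, ha, hb, add_smul]
  | hmul a b ha hb => rw [map_mul, mul_smul, ha, hb, mul_smul]

end Coind

end CoinductionInclusion

/-! ### Induction -/

section InductionLemmas

open MackeyAlgebra

variable {T : Type u} [Group T] [Finite T] {R : Type u} [CommRing R] {E F : FusionSystem T}
  {h : E ≤ F} {N N' : Type u} [AddCommGroup N] [Module (MackeyAlgebra R E) N]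
  [AddCommGroup N'] [Module (MackeyAlgebra R E) N']

namespace Induction

theorem smul_tmul (a y : MackeyAlgebra R F) (n : N) :
    a • tmul R h y n = tmul R h (a * y) n := rfl

theorem tmul_add (y : MackeyAlgebra R F) (n m : N) :
    tmul R h y (n + m) = tmul R h y n + tmul R h y m := by
  rw [tmul, TensorProduct.tmul_add, map_add]
  rfl

theorem add_tmul (y z : MackeyAlgebra R F) (n : N) :
    tmul R h (y + z) n = tmul R h y n + tmul R h z n := by
  rw [tmul, TensorProduct.add_tmul, map_add]
  rfl

theorem tmul_zero (y : MackeyAlgebra R F) : tmul R h y (0 : N) = 0 := by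
  rw [tmul, TensorProduct.tmul_zero, map_zero]
  rfl

theorem zero_tmul (n : N) : tmul R h 0 n = 0 := by
  rw [tmul, TensorProduct.zero_tmul, map_zero]
  rfl

theorem mul_incl_tmul (y : MackeyAlgebra R F) (a : MackeyAlgebra R E) (n : N) :
    tmul R h (y * incl R h a) n = tmul R h y (a • n) :=
  (Submodule.Quotient.eq _).2 (Submodule.subset_span ⟨y, a, n, rfl⟩)

theorem map_tmul (f : N →ₗ[MackeyAlgebra R E] N') (y : MackeyAlgebra R F) (n : N) :
    map R h f (tmul R h y n) = tmul R h y (f n) := rfl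

theorem induction_on {C : Induction R h N → Prop} (htmul : ∀ y n, C (tmul R h y n))
    (hadd : ∀ x y, C x → C y → C (x + y)) (x : Induction R h N) : C x := by
  obtain ⟨x, rfl⟩ := Submodule.mkQ_surjective _ x
  induction x using TensorProduct.induction_on with
  | zero =>
    rw [map_zero]
    have := htmul 0 0
    rwa [zero_tmul] at this
  | tmul y n => exact htmul y n
  | add x y hx hy =>
    rw [map_add]
    exact hadd _ _ hx hy

variable {X : Type*} [AddCommGroup X] [Module (MackeyAlgebra R F) X]

theorem hom_ext {f g : Induction R h N →ₗ[MackeyAlgebra R F] X}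
    (hfg : ∀ n, f (tmul R h 1 n) = g (tmul R h 1 n)) : f = g := by
  refine LinearMap.ext fun x => ?_
  induction x using induction_on with
  | htmul y n => rw [← mul_one y, ← smul_tmul, map_smul, map_smul, hfg]
  | hadd x y hx hy => rw [map_add, map_add, hx, hy]

/-- The universal property of induction. -/
noncomputable def lift (f : N →+ X) (hf : ∀ (a : MackeyAlgebra R E) (n : N),
    f (a • n) = incl R h a • f n) : Induction R h N →ₗ[MackeyAlgebra R F] X :=
  Submodule.liftQ (inductionRel R h N)
    (TensorProduct.AlgebraTensorModule.lift
      (LinearMap.toSpanSingleton (MackeyAlgebra R F) (N →ₗ[ℤ] X) f.toIntLinearMap)) (by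
      rw [inductionRel, Submodule.span_le]
      rintro _ ⟨y, a, n, rfl⟩
      change _ = _
      rw [map_sub, sub_eq_zero]
      change (y * incl R h a) • f n = y • f (a • n)
      rw [mul_smul, hf])

end Induction

end InductionLemmas

/-! ### The action of the elements `lam` on the image of `zeta`. -/

section CoinductionInclusion

open MackeyAlgebra

variable {T : Type u} [Group T] [Finite T] {R : Type u} [CommRing R] {F : FusionSystem T}
  {H : Subgroup T} {K L : Subgroup T} {D E : Subgroup (T × T)}
  {hH : H ≤ F.S} {N : Type u} [AddCommGroup N] [Module (MackeyAlgebra R (inner H)) N]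
  [Module R N] [IsScalarTower R (MackeyAlgebra R (inner H)) N]

namespace Coind

/-- On families, normal forms act by composing the index graph with `D`. -/
theorem rho_smul_apply {A : Subgroup T} (hD : F.IsGr D) (hA : p1 D = A) (hAS : A ≤ F.S)
    (hDK : p2 D ≤ K) (hK : K ≤ F.S) (w : Coind R N hH) (hE : IsGrIn F H A E) :
    ((rho R F D K • w) ⟨A, hAS⟩).1 E = (w ⟨K, hK⟩).1 (relComp E D) := by
  subst hA
  obtain ⟨φ, hφ, e⟩ := hD.exists_iso
  have h1 := rho_gr R hφ hDK hK
  rw [← e] at h1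
  have h2 : relComp E (swap (gr φ.symm.toMonoidHom)) = relComp E D := by
    rw [swap_gr, MulEquiv.symm_symm, ← e]
  have h3 := Fam.isGrIn_relComp_swap_gr (isIso_symm hφ) hE
  rw [h1, mul_smul, conj_smul, Fam.conj_apply _ hE, res_smul, Fam.res_apply _ h3, h2]

theorem rho_swap_smul_apply_slice (hD : F.IsGr D) (hK : K ≤ F.S) (w : Coind R N hH)
    (hE : IsGrIn F H K E) {x : T} (hx : x ∈ K) :
    ((rho R F (swap D) (p1 D) • w) ⟨p2 D, hD.p2_le⟩).1 (slice E (p2 D) x) =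
      (w ⟨p1 D, hD.p1_le⟩).1 (relComp (slice E (p2 D) x) (swap D)) :=
  rho_smul_apply hD.swap (p1_swap D) hD.p2_le (p2_swap D).le hD.p1_le w (hE.slice hK _ hx)

theorem lam_smul_apply (hD : F.IsGr D) (hDK : p2 D ≤ K) (hK : K ≤ F.S) (w : Coind R N hH)
    (hE : IsGrIn F H K E) : ((lam R F D K • w) ⟨K, hK⟩).1 E =
      relSum (cosetRel E (p2 D)) K fun x => iA R (inner H) (p1 (slice E (p2 D) x)) (p1 E) •
        ((rho R F (swap D) (p1 D) • w) ⟨p2 D, hD.p2_le⟩).1 (slice E (p2 D) x) := by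
  rw [lam, mul_smul, iA_eq R hDK hK, ind_smul, Fam.ind_apply _ hE]

theorem lam_smul_apply_of_ne (w : Coind R N hH) {J : {K : Subgroup T // K ≤ F.S}} (hJ : J.1 ≠ K) :
    (lam R F D K • w) J = 0 := by
  rw [lam, mul_smul]
  by_cases h : p2 D ≤ K ∧ K ≤ F.S
  · rw [iA_eq R h.1 h.2, ind_smul_of_ne _ _ _ hJ]
  · rw [iA_eq_zero R h, zero_smul]
    rfl

/-- A term of the action of `lam D K` on an element of `N` which does not vanish. -/
theorem exists_le_conj_of_term_ne_zero
    (hN : ∀ A ≤ H, ¬ F.IsCentric A → ∀ n : N, iA R (inner H) A A • n = 0)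
    {x : T} (n : N)
    (h : rho R (inner H) (relComp (slice E (p2 D) x) (swap D)) L • n ≠ 0) :
    F.IsCentric (p1 (slice E (p2 D) x)) ∧
      ∃ y ∈ H, slice E (p2 D) x ≤ MulAut.conj ((y, 1) : T × T) • D := by
  have hp : p1 (relComp (slice E (p2 D) x) (swap D)) = p1 (slice E (p2 D) x) :=
    p1_relComp (by rw [p1_swap]; exact p2_slice_le _ _ _)
  constructor
  · by_contra hc
    exact h (rho_smul_eq_zero hN (by rwa [hp]) n)
  · have hi : (inner H).IsGr (relComp (slice E (p2 D) x) (swap D)) := by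
      by_contra hi
      exact h (by rw [rho_eq_zero R fun h => hi h.1, zero_smul])
    obtain ⟨P, Q, φ, ⟨-, -, y, hy, e⟩, hφ⟩ := hi
    refine ⟨y⁻¹, inv_mem hy, ?_⟩
    rintro ⟨a, b⟩ hd
    obtain ⟨c, hc⟩ := mem_p2.1 (p2_slice_le _ _ _ (snd_mem_p2 hd) : b ∈ p2 D)
    have h1 : (a, c) ∈ relComp (slice E (p2 D) x) (swap D) := ⟨b, hd, hc⟩
    rw [hφ] at h1
    obtain ⟨z, rfl, rfl⟩ := mem_gr.1 h1
    rw [mem_conj_smul]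
    rw [e] at hc
    convert hc using 1
    refine Prod.ext ?_ ?_
    · simp
    · simp

variable {p : ℕ} [Fact p.Prime]

/-- A nonzero term yields a centric graph contained both in an H-conjugate of `D` and in a
K-conjugate of `E`. Uniqueness of the maximal graph above it would make `D` and `E` conjugate. -/
theorem lam_smul_zeta_of_ne (hT : IsPGroup p T) (hF : F.IsSaturated p)
    (hN : ∀ A ≤ H, ¬ F.IsCentric A → ∀ n : N, iA R (inner H) A A • n = 0)
    {hV : Detects R F H N} (hK : K ≤ F.S) (hD : F.IsMaxGr H K D) (hE : F.IsMaxGr H K E)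
    (hne : ∀ g : T × T, g.1 ∈ H → g.2 ∈ K → E ≠ MulAut.conj g • D) (n : N) :
    ((lam R F D K • zeta hH hV n) ⟨K, hK⟩).1 E = 0 := by
  rw [lam_smul_apply hD.isGr hD.p2_le hK _ ⟨hE.isGr, hE.p1_le, hE.p2_le⟩, relSum_eq_zero]
  intro x hx
  rw [rho_swap_smul_apply_slice hD.isGr hK _ ⟨hE.isGr, hE.p1_le, hE.p2_le⟩ hx, zeta_apply]
  by_contra h
  have h1 : rho R (inner H) (relComp (slice E (p2 D) x) (swap D)) (p1 D) • n ≠ 0 := by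
    intro h'
    exact h (by rw [h', smul_zero])
  obtain ⟨hc, y, hy, hle⟩ := exists_le_conj_of_term_ne_zero hN n h1
  have h2 : slice E (p2 D) x ≤ MulAut.conj ((1, x⁻¹) : T × T) • E := inf_le_left
  have hx' : x⁻¹ ∈ K := inv_mem hx
  obtain ⟨z, hz, e⟩ := hF.exists_conj_of_isMaxGr hT hH hK
    (hD.conj_smul hH hK (g := (y, 1)) hy (one_mem _))
    (hE.conj_smul hH hK (g := (1, x⁻¹)) (one_mem _) hx') hle h2 hc
  refine hne (y, x * z) hy (mul_mem hx (hD.p2_le (p2_slice_le _ _ _ hz.1))) ?_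
  have e2 := congrArg (fun X => MulAut.conj ((1, x) : T × T) • X) e
  rw [conj_smul_smul, conj_smul_smul, conj_smul_smul] at e2
  simpa [conj_one_smul, ← Prod.one_eq_mk] using e2

/-- The double coset of 1 contributes the action of the composite of `D` with its inverse, a
diagonal. If the term at `x` is nonzero, `IsSaturated.mem_of_le_conj` puts `x⁻¹` in the image of
`D`, so `x` is in the double coset of 1. -/
theorem lam_smul_zeta_self (hT : IsPGroup p T) (hF : F.IsSaturated p)
    (hN : ∀ A ≤ H, ¬ F.IsCentric A → ∀ n : N, iA R (inner H) A A • n = 0)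
    {hV : Detects R F H N} (hK : K ≤ F.S) (hD : F.IsMaxGr H K D) (n : N) :
    ((lam R F D K • zeta hH hV n) ⟨K, hK⟩).1 D = iA R (inner H) (p1 D) (p1 D) • n := by
  have hDin : IsGrIn F H K D := ⟨hD.isGr, hD.p1_le, hD.p2_le⟩
  rw [lam_smul_apply hD.isGr hD.p2_le hK _ hDin, relSum_eq_of_unique (x := 1) (one_mem K)]
  · have h1 := rho_swap_smul_apply_slice hD.isGr hK (zeta hH hV n) hDin (one_mem K)
    rw [h1, slice_one le_rfl, zeta_apply, relComp_swap_self hD.isGr,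
      ← iA_self R (F := inner H) hD.p1_le, ← mul_smul, iA_mul_iA R le_rfl le_rfl]
  · exact fun x hx hx' => Fam.term_congr _ hH hK hDin hx hx'
  · intro x hx hx'
    rw [rho_swap_smul_apply_slice hD.isGr hK _ hDin hx, zeta_apply]
    by_contra h
    have h1 : rho R (inner H) (relComp (slice D (p2 D) x) (swap D)) (p1 D) • n ≠ 0 := by
      intro h'
      exact h (by rw [h', smul_zero])
    obtain ⟨hc, y, hy, hle⟩ := exists_le_conj_of_term_ne_zero hN n h1
    have h2 : slice D (p2 D) x ≤ MulAut.conj ((1, x⁻¹) : T × T) • D := inf_le_left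
    have h3 := conj_smul_mono ((y⁻¹, 1) : T × T) hle
    have h4 := conj_smul_mono ((y⁻¹, 1) : T × T) h2
    rw [conj_smul_smul, Prod.mk_mul_mk, inv_mul_cancel, one_mul, ← Prod.one_eq_mk,
      conj_one_smul] at h3
    rw [conj_smul_smul, Prod.mk_mul_mk, mul_one, one_mul] at h4
    have hx1 : x⁻¹ ∈ K := inv_mem hx
    obtain ⟨-, h5⟩ := hF.mem_of_le_conj hT hH hK hD h3 (g := (y⁻¹, x⁻¹)) (inv_mem hy) hx1 h4 (by
      rw [p1_conj_smul]
      exact hc.of_conj ⟨_, isIso_conjIso (inv_mem (hH hy)) hc.1⟩)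
    exact hx' ⟨x⁻¹, h5, 1, one_mem _, by group⟩

end Coind

end CoinductionInclusion

/-! ### Induction and coinduction -/

namespace FusionSystem

variable {T : Type u} [Group T] {F : FusionSystem T} {H K : Subgroup T}
  {D E : Subgroup (T × T)}

/-- Translates the preorder on pairs into inclusion of graphs up to H × K-conjugacy. -/
theorem ProdPair.precedes_iff {P Q : ProdPair F H K} :
    P.Precedes Q ↔ ∃ g : T × T, g.1 ∈ H ∧ g.2 ∈ K ∧ gr P.φ ≤ MulAut.conj g • gr Q.φ := by
  constructor
  · rintro ⟨h, hh, k, hk, e⟩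
    refine ⟨(h, k), hh, hk, ?_⟩
    rintro ⟨a, b⟩ hd
    obtain ⟨x, rfl, rfl⟩ := mem_gr.1 hd
    obtain ⟨y, h1, h2⟩ := e x
    rw [mem_conj_smul, mem_gr]
    refine ⟨y, h1, ?_⟩
    simp only [Prod.snd_mul, Prod.snd_inv, h2]
    group
  · rintro ⟨⟨h, k⟩, hh, hk, hle⟩
    refine ⟨h, hh, k, hk, fun a => ?_⟩
    have h1 := hle (mem_gr.2 ⟨a, rfl, rfl⟩ : ((a : T), (P.φ a : T)) ∈ gr P.φ)
    rw [mem_conj_smul, mem_gr] at h1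
    obtain ⟨b, h2, h3⟩ := h1
    refine ⟨b, h2, ?_⟩
    simp only [Prod.snd_mul, Prod.snd_inv] at h3
    rw [h3]
    group

theorem IsGr.exists_prodPair (hD : F.IsGr D) (h1 : p1 D ≤ H) (h2 : p2 D ≤ K) (hK : K ≤ F.S)
    (hc : F.IsCentric (p1 D)) : ∃ P : ProdPair F H K, gr P.φ = D := by
  obtain ⟨φ, hφ, e⟩ := hD.exists_iso
  refine ⟨⟨p1 D, (Subgroup.inclusion h2).comp φ.toMonoidHom, h1, hc,
    F.comp_mem hφ (F.conj_mem (s := 1) hD.p2_le hK (one_mem _) fun x => by simp)⟩, ?_⟩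
  conv_rhs => rw [e]
  rfl

theorem ProdPair.isGrIn (P : ProdPair F H K) : IsGrIn F H K (gr P.φ) :=
  ⟨isGr_gr P.mem, (p1_gr P.φ).le.trans P.le, (p2_gr P.φ).le.trans (image_le P.φ)⟩

theorem ProdIndex.eq_of_conj {q q' : ProdIndex F H K} {g : T × T} (h1 : g.1 ∈ H) (h2 : g.2 ∈ K)
    (h : gr q'.rep.φ = MulAut.conj g • gr q.rep.φ) : q' = q := by
  refine Quotient.out_equiv_out.1 ⟨ProdPair.precedes_iff.2 ⟨g, h1, h2, h.le⟩,
    ProdPair.precedes_iff.2 ⟨g⁻¹, inv_mem h1, inv_mem h2, ?_⟩⟩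
  change gr q.rep.φ ≤ MulAut.conj g⁻¹ • gr q'.rep.φ
  rw [h, conj_smul_smul, inv_mul_cancel, conj_one_smul]

variable [Finite T]

/-- If a maximal pair is contained in a larger graph, the latter is contained in a conjugate of the
former. The orders agree, and so do the graphs. -/
theorem ProdIndex.isMaxGr (q : ProdIndex F H K) : F.IsMaxGr H K (gr q.rep.φ) := by
  have hq := q.rep.isGrIn
  refine ⟨hq.isGr, hq.p1_le, hq.p2_le, ?_, fun E hE h1 h2 hle => ?_⟩
  · rw [p1_gr]
    exact q.rep.centric
  · obtain ⟨Q, rfl⟩ := hE.exists_prodPair h1 h2 (F.le_of_mem q.rep.mem).2 (by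
      refine IsCentric.mono ?_ (p1_mono hle) hE.p1_le
      rw [p1_gr]
      exact q.rep.centric)
    have h3 := (Quotient.out q).2 Q (ProdPair.precedes_iff.2 ⟨1, one_mem _, one_mem _, by
      rw [conj_one_smul]
      exact hle⟩)
    obtain ⟨g, -, -, h4⟩ := ProdPair.precedes_iff.1 h3
    refine (Subgroup.eq_of_le_of_card_le hle ?_).symm
    rw [← card_conj_smul g (gr q.rep.φ)]
    exact Subgroup.card_le_of_le h4

/-- With `ProdIndex.eq_of_conj` this shows that [H ×_F K] enumerates the maximal graphs up to H ×
K-conjugacy. -/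
theorem IsMaxGr.exists_rep (hH : H ≤ F.S) (hK : K ≤ F.S) (hD : F.IsMaxGr H K D) :
    ∃ (q : ProdIndex F H K) (g : T × T), g.1 ∈ H ∧ g.2 ∈ K ∧
      D = MulAut.conj g • gr q.rep.φ := by
  obtain ⟨P, rfl⟩ := hD.isGr.exists_prodPair hD.p1_le hD.p2_le hK hD.centric
  have hmax : ∀ Q : ProdPair F H K, P.Precedes Q → Q.Precedes P := by
    intro Q hQ
    obtain ⟨g, h1, h2, h3⟩ := ProdPair.precedes_iff.1 hQ
    have hQ' := Q.isGrIn
    have h4 := hD.eq_of_le _ (hQ'.isGr.conj_smul (hH h1) (hK h2))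
      (by rw [p1_conj_smul]; exact conj_smul_le h1 hQ'.p1_le)
      (by rw [p2_conj_smul]; exact conj_smul_le h2 hQ'.p2_le) h3
    refine ProdPair.precedes_iff.2 ⟨g⁻¹, inv_mem h1, inv_mem h2, ?_⟩
    rw [← h4, conj_smul_smul, inv_mul_cancel, conj_one_smul]
  have h1 : (MaxPair.setoid F H K) (Quotient.out (Quotient.mk (MaxPair.setoid F H K) ⟨P, hmax⟩))
    ⟨P, hmax⟩ := Quotient.exact (Quotient.out_eq _)
  obtain ⟨g, hg1, hg2, hg⟩ := ProdPair.precedes_iff.1 h1.2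
  refine ⟨Quotient.mk _ ⟨P, hmax⟩, g, hg1, hg2, ?_⟩
  set q : ProdIndex F H K := Quotient.mk _ ⟨P, hmax⟩
  have hq := q.isMaxGr.conj_smul hH hK hg1 hg2
  exact (hD.eq_of_le _ hq.isGr hq.p1_le hq.p2_le hg).symm

end FusionSystem

/-! ### The isomorphism between induction and coinduction. -/

section CoinductionEquiv

open MackeyAlgebra

variable {T : Type u} [Group T] [Finite T] {R : Type u} [CommRing R] {F : FusionSystem T}
  {H : Subgroup T} {K L : Subgroup T} {D E : Subgroup (T × T)}
  {hH : H ≤ F.S} {N : Type u} [AddCommGroup N] [Module (MackeyAlgebra R (inner H)) N]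

namespace Induction

variable (hH) in
theorem smul_algebraMap_tmul (r : R) (y : MackeyAlgebra R F) (n : N) :
    tmul R (inner_le hH) (r • y) n =
      tmul R (inner_le hH) y (algebraMap R (MackeyAlgebra R (inner H)) r • n) := by
  conv_lhs => rw [← one_smul (MackeyAlgebra R (inner H)) n]
  rw [← mul_incl_tmul, ← mul_incl_tmul, incl_algebraMap, ← mul_assoc, ← Algebra.commutes,
    Algebra.smul_def]

variable (hH) in
theorem lam_mul_iA_tmul (hD : F.IsGr D) (h1 : p1 D ≤ H) (hK : p2 D ≤ K) (h : E ≤ D) (n : N) :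
    tmul R (inner_le hH) (lam R F E K) n =
      tmul R (inner_le hH) (lam R F D K) (iA R (inner H) (p1 E) (p1 D) • n) := by
  rw [← mul_incl_tmul, incl_iA R hH h1, lam_mul_iA R hD hK h]

variable (hH) in
theorem lam_conj_tmul (hD : F.IsGr D) (h1 : p1 D ≤ H) (hK : p2 D ≤ K) (hKS : K ≤ F.S) {g : T × T}
    (hh : g.1 ∈ H) (hk : g.2 ∈ K) (n : N) :
    tmul R (inner_le hH) (lam R F D K) n =
      tmul R (inner_le hH) (lam R F (MulAut.conj g • D) K)
        (cA R (inner H) (p1 D) g.1 • n) := by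
  rw [← mul_incl_tmul, cA, incl_rho R hH (isGr_conjGr (F := inner H) hh h1).swap
    (by rw [p2_swap, p1_conjGr]) h1]
  have := lam_conj R hD hK hKS (hH hh) hk
  rw [cA] at this
  rw [this]

variable (hH) in
/-- Induction on the elements of an induced module. -/
theorem induction_lam
    (hN : ∀ A ≤ H, ¬ F.IsCentric A → ∀ n : N, iA R (inner H) A A • n = 0)
    {C : Induction R (inner_le hH) N → Prop} (hzero : C 0) (hadd : ∀ x y, C x → C y → C (x + y))
    (hlam : ∀ (K : Subgroup T), F.IsCentric K → ∀ (q : ProdIndex F H K) (n : N),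
      C (tmul R (inner_le hH) (lam R F (gr q.rep.φ) K) n)) (x : Induction R (inner_le hH) N) :
    C x := by
  -- A centric graph is enlarged to a maximal one and conjugated to its representative, the changes
  -- being absorbed by `n`. If the source is not centric, the tensor vanishes.
  have key1 : ∀ (K : Subgroup T), K ≤ F.S → ∀ D, F.IsGr D → p1 D ≤ H → p2 D ≤ K → ∀ n : N,
      C (tmul R (inner_le hH) (lam R F D K) n) := by
    intro K hK D hD h1 h2 n
    by_cases hc : F.IsCentric (p1 D)
    · obtain ⟨E, hDE, hE⟩ := hD.exists_isMaxGr h1 h2 hc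
      have hKc : F.IsCentric K := (hc.of_conj hD.conj).mono h2 hK
      obtain ⟨q, g, hg1, hg2, hq⟩ := hE.exists_rep hH hK
      rw [lam_mul_iA_tmul hH hE.isGr hE.p1_le hE.p2_le hDE, lam_conj_tmul hH hE.isGr hE.p1_le hE.p2_le hK
        (g := g⁻¹) (inv_mem hg1) (inv_mem hg2)]
      have h3 : MulAut.conj g⁻¹ • E = gr q.rep.φ := by
        rw [hq, conj_smul_smul, inv_mul_cancel, conj_one_smul]
      rw [h3]
      exact hlam K hKc q _
    · rw [lam_mul_iA_tmul hH hD h1 h2 le_rfl, hN _ h1 hc, tmul_zero]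
      exact hzero
  -- A normal form is split by `lam_swap`, and its restriction is moved across the tensor sign into
  -- `N`.
  have key2 : ∀ (D : Subgroup (T × T)) (B K : Subgroup T) (n : N),
      C (tmul R (inner_le hH) (iA R F (p1 D) B * rho R F D K) n) := by
    intro D B K n
    by_cases hD : F.IsGr D ∧ p2 D ≤ K ∧ K ≤ F.S
    · by_cases hK : K ≤ H
      · by_cases hB : p1 D ≤ B ∧ B ≤ F.S
        · rw [lam_swap R hD.1 hD.2.1 hD.2.2, ← incl_rho R hH
            (isGr_diag (F := inner H) (hD.2.1.trans hK)) (by rw [p2_diag]; exact hD.2.1) hK,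
            mul_incl_tmul]
          exact key1 B hB.2 _ hD.1.swap (by rw [p1_swap]; exact hD.2.1.trans hK)
            (by rw [p2_swap]; exact hB.1) _
        · rw [iA_eq_zero R hB, zero_mul, zero_tmul]
          exact hzero
      -- For `K` not contained in `H` the normal form is orthogonal to 1_H, so the tensor is zero.
      · have : rho R F D K * incl R (inner_le hH) 1 = 0 := by
          have := Fintype.ofFinite {K : Subgroup T // K ≤ (FusionSystem.inner H).S}
          rw [incl_one, idem, finsum_eq_sum_of_fintype, Finset.mul_sum]
          refine Finset.sum_eq_zero fun L _ => ?_
          rw [← iA_eq R le_rfl, rho_mul_iA_eq_zero R]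
          exact fun h => hK (h.le.trans L.2)
        rw [← one_smul (MackeyAlgebra R (inner H)) n, ← mul_incl_tmul, mul_assoc, this, mul_zero,
          zero_tmul]
        exact hzero
    · rw [rho_eq_zero R hD, mul_zero, zero_tmul]
      exact hzero
  induction x using induction_on with
  | hadd x y hx hy => exact hadd x y hx hy
  | htmul y n =>
    have hy : y ∈ Submodule.span R (Set.range fun t : Subgroup (T × T) × Subgroup T × Subgroup T =>
        iA R F (p1 t.1) t.2.1 * rho R F t.1 t.2.2) := by
      rw [span_eq_top]
      trivial
    induction hy using Submodule.span_induction generalizing n with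
    | mem y hy =>
      obtain ⟨⟨D, B, K⟩, rfl⟩ := hy
      exact key2 D B K n
    | zero =>
      rw [zero_tmul]
      exact hzero
    | add y z _ _ hy hz =>
      rw [add_tmul]
      exact hadd _ _ (hy n) (hz n)
    | smul r y _ hy =>
      rw [smul_algebraMap_tmul hH]
      exact hy _

end Induction

namespace Coind

variable [Module R N] [IsScalarTower R (MackeyAlgebra R (inner H)) N]

/-- The morphism from the induced to the coinduced Mackey functor. -/
noncomputable def ofInduction (hV : Detects R F H N) :
    Induction R (inner_le hH) N →ₗ[MackeyAlgebra R F] Coind R N hH :=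
  Induction.lift (zeta hH hV).toAddMonoidHom (zeta_smul (hV := hV))

theorem ofInduction_tmul (hV : Detects R F H N) (y : MackeyAlgebra R F) (n : N) :
    ofInduction hV (Induction.tmul R (inner_le hH) y n) = y • zeta hH hV n := rfl

variable (hH) in
/-- The map from the coinduced to the induced Mackey functor. -/
noncomputable def toInduction (w : Coind R N hH) : Induction R (inner_le hH) N :=
  ∑ᶠ K : {K : Subgroup T // F.IsCentric K}, ∑ᶠ q : ProdIndex F H K.1,
    Induction.tmul R (inner_le hH) (lam R F (gr q.rep.φ) K.1)
      ((w ⟨K.1, K.2.1⟩).1 (gr q.rep.φ))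

theorem toInduction_add (v w : Coind R N hH) :
    toInduction hH (v + w) = toInduction hH v + toInduction hH w := by
  rw [toInduction, toInduction, toInduction, ← finsum_add_distrib (Set.toFinite _) (Set.toFinite _)]
  refine finsum_congr fun K => ?_
  rw [← finsum_add_distrib (Set.toFinite _) (Set.toFinite _)]
  exact finsum_congr fun q => Induction.tmul_add _ _ _

variable {p : ℕ} [Fact p.Prime]

/-- On the generators given by the representatives, the action on `zeta` is an identity matrix, so
exactly one term of the sum survives and it returns the generator. -/
theorem toInduction_ofInduction (hT : IsPGroup p T) (hF : F.IsSaturated p)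
    (hN : ∀ A ≤ H, ¬ F.IsCentric A → ∀ n : N, iA R (inner H) A A • n = 0)
    (hV : Detects R F H N) (x : Induction R (inner_le hH) N) :
    toInduction hH (ofInduction hV x) = x := by
  induction x using Induction.induction_lam hH hN with
  | hzero =>
    have := toInduction_add (0 : Coind R N hH) 0
    rw [add_zero, left_eq_add] at this
    rw [map_zero, this]
  | hadd x y hx hy => rw [map_add, toInduction_add, hx, hy]
  | hlam K hK q n =>
    rw [ofInduction_tmul, toInduction, finsum_eq_single _ ⟨K, hK⟩, finsum_eq_single _ q]
    · rw [lam_smul_zeta_self hT hF hN hK.1 q.isMaxGr,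
        ← Induction.lam_mul_iA_tmul hH q.isMaxGr.isGr q.isMaxGr.p1_le q.isMaxGr.p2_le le_rfl]
    · intro q' hq'
      rw [lam_smul_zeta_of_ne hT hF hN hK.1 q.isMaxGr q'.isMaxGr, Induction.tmul_zero]
      exact fun g h1 h2 h => hq' (ProdIndex.eq_of_conj h1 h2 h)
    · intro K' hK'
      rw [lam_smul_apply_of_ne _ fun h => hK' (Subtype.ext h)]
      exact finsum_eq_zero_of_forall_eq_zero fun q => Induction.tmul_zero _

/-- A compatible family is determined by its values on representatives of the maximal graphs. -/
theorem ext_rep (hN : ∀ A ≤ H, ¬ F.IsCentric A → ∀ n : N, iA R (inner H) A A • n = 0)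
    {v w : Coind R N hH} (h : ∀ (K : Subgroup T) (hK : F.IsCentric K) (q : ProdIndex F H K),
      (v ⟨K, hK.1⟩).1 (gr q.rep.φ) = (w ⟨K, hK.1⟩).1 (gr q.rep.φ)) : v = w := by
  refine ext_val' fun K D hD => ?_
  by_cases hc : F.IsCentric (p1 D)
  · obtain ⟨E, hDE, hE⟩ := hD.isGr.exists_isMaxGr hD.p1_le hD.p2_le hc
    have hKc : F.IsCentric K.1 := (hc.of_conj hD.isGr.conj).mono hD.p2_le K.2
    obtain ⟨q, g, hg1, hg2, rfl⟩ := hE.exists_rep hH K.2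
    have hEin : IsGrIn F H K.1 (MulAut.conj g • gr q.rep.φ) := ⟨hE.isGr, hE.p1_le, hE.p2_le⟩
    rw [← Fam.map_res _ hEin hDE, ← Fam.map_res (w K) hEin hDE,
      Fam.map_conj _ hH q.rep.isGrIn hg1 hg2, Fam.map_conj (w K) hH q.rep.isGrIn hg1 hg2,
      h K.1 hKc q]
  · rw [← Fam.map_self _ hD, ← Fam.map_self (w K) hD, hN _ hD.p1_le hc, hN _ hD.p1_le hc]

/-- By `ext_rep` only the values at the representatives matter, and the same identity matrix
computes them. -/
theorem ofInduction_toInduction (hT : IsPGroup p T) (hF : F.IsSaturated p)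
    (hN : ∀ A ≤ H, ¬ F.IsCentric A → ∀ n : N, iA R (inner H) A A • n = 0)
    (hV : Detects R F H N) (w : Coind R N hH) :
    ofInduction hV (toInduction hH w) = w := by
  have := Fintype.ofFinite {K : Subgroup T // F.IsCentric K}
  have : ∀ K, Fintype (ProdIndex F H K) := fun K => Fintype.ofFinite _
  refine ext_rep hN fun K hK q => ?_
  simp only [toInduction, finsum_eq_sum_of_fintype, map_sum, ofInduction_tmul]
  rw [sum_apply, AddSubmonoidClass.coe_finsetSum, Finset.sum_apply,
    Finset.sum_eq_single_of_mem ⟨K, hK⟩ (Finset.mem_univ _), sum_apply,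
    AddSubmonoidClass.coe_finsetSum, Finset.sum_apply,
    Finset.sum_eq_single_of_mem q (Finset.mem_univ _)]
  · rw [lam_smul_zeta_self hT hF hN hK.1 q.isMaxGr, Fam.map_self _ q.rep.isGrIn]
  · intro q' _ hq'
    rw [lam_smul_zeta_of_ne hT hF hN hK.1 q'.isMaxGr q.isMaxGr]
    exact fun g h1 h2 h => hq' (ProdIndex.eq_of_conj h1 h2 h).symm
  · intro K' _ hK'
    rw [sum_apply, Finset.sum_eq_zero]
    · rfl
    · intro q _
      exact lam_smul_apply_of_ne _ fun h => hK' (Subtype.ext h.symm)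

/-- Induction and coinduction agree on centric Mackey functors. -/
noncomputable def equivInduction (hT : IsPGroup p T) (hF : F.IsSaturated p)
    (hN : ∀ A ≤ H, ¬ F.IsCentric A → ∀ n : N, iA R (inner H) A A • n = 0) :
    Induction R (inner_le hH) N ≃ₗ[MackeyAlgebra R F] Coind R N hH :=
  { ofInduction (detects hT hF hH hN) with
    invFun := toInduction hH
    left_inv := toInduction_ofInduction hT hF hN _
    right_inv := ofInduction_toInduction hT hF hN _ }

end Coind

end CoinductionEquiv

/-! ### The morphism `θ^H` -/

section Theta

open MackeyAlgebra

variable {T : Type u} [Group T] [Finite T] {R : Type u} [CommRing R] {F : FusionSystem T}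
  {H K : Subgroup T} (hH : H ≤ F.S)

section Pairs

variable {M N : Type u} [AddCommGroup M] [Module (MackeyAlgebra R F) M]
  [AddCommGroup N] [Module (MackeyAlgebra R F) N]

theorem FusionSystem.ProdPair.ind_mul_conj_eq_lam (hK : K ≤ F.S) (P : ProdPair F H K) :
    ind R (image_le P.φ) hK * conj R (isIso_imageIso P.mem) = lam R F (gr P.φ) K := by
  rw [lam, p1_gr, p2_gr, iA_eq R (image_le P.φ) hK, conj_eq_rho, gr_imageIso]

theorem val_pairRes (P : ProdPair F H K) (x : M) :
    Restriction.val R (inner_le hH) M (pairRes R hH P x) = rho R F (gr P.φ) K • x := by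
  have := rho_gr R (isIso_imageIso P.mem) (image_le P.φ) (F.le_of_mem P.mem).2
  rw [gr_imageIso] at this
  rw [this]
  rfl

theorem pairRes_ind_smul (hK : K ≤ F.S) (P : ProdPair F H K) (x : M) :
    pairRes R hH P (ind R (F := F) (le_refl K) hK • x) = pairRes R hH P x := by
  refine Coind.restriction_ext R hH ?_
  rw [val_pairRes, val_pairRes, ← mul_smul, ← iA_eq R le_rfl hK, rho_mul_iA_self]

theorem map_pairRes (f : M →ₗ[MackeyAlgebra R F] N) (P : ProdPair F H K) (x : M) :
    Restriction.map R (inner_le hH) f (pairRes R hH P x) = pairRes R hH P (f x) := by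
  refine Coind.restriction_ext R hH ?_
  rw [val_pairRes, ← map_smul, ← val_pairRes hH]
  rfl

theorem thetaUp_eq (x : M) : thetaUp R hH x =
    ∑ᶠ K : {K : Subgroup T // F.IsCentric K}, ∑ᶠ q : ProdIndex F H K.1,
      Induction.tmul R (inner_le hH) (lam R F (gr q.rep.φ) K.1) (pairRes R hH q.rep x) := by
  rw [thetaUp]
  refine finsum_congr fun K => finsum_congr fun q => ?_
  rw [q.rep.ind_mul_conj_eq_lam K.2.1, pairRes_ind_smul]

/-- The conceptual description of θ^H: the component of the unit of coinduction at the graph of `φ`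
is c_φ⁻¹ R x, and `toInduction` reassembles these components. -/
theorem thetaUp_eq_toInduction [Module R (Restriction R (inner_le hH) M)]
    [IsScalarTower R (MackeyAlgebra R (inner H)) (Restriction R (inner_le hH) M)] (x : M) :
    thetaUp R hH x = Coind.toInduction hH (Coind.unit R hH M x) := by
  rw [thetaUp_eq, Coind.toInduction]
  refine finsum_congr fun K => finsum_congr fun q => ?_
  congr 1
  refine Coind.restriction_ext R hH ?_
  rw [val_pairRes]
  exact (Coind.val_unitFun R hH x (K := ⟨K.1, K.2.1⟩) q.rep.isGrIn).symm

/-- The morphism `f↑ ∘ θ^H`, for `f` additive. -/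
theorem map_thetaUp {X : Type u} [AddCommGroup X] [Module (MackeyAlgebra R (inner H)) X]
    (f : Restriction R (inner_le hH) M →ₗ[MackeyAlgebra R (inner H)] X) (x : M) :
    Induction.map R (inner_le hH) f (thetaUp R hH x) =
      ∑ᶠ K : {K : Subgroup T // F.IsCentric K}, ∑ᶠ q : ProdIndex F H K.1,
        Induction.tmul R (inner_le hH) (lam R F (gr q.rep.φ) K.1) (f (pairRes R hH q.rep x)) := by
  have := Fintype.ofFinite {K : Subgroup T // F.IsCentric K}
  have : ∀ K, Fintype (ProdIndex F H K) := fun K => Fintype.ofFinite _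
  simp only [thetaUp_eq, finsum_eq_sum_of_fintype, map_sum, Induction.map_tmul]

/-- Naturality of `θ^H`. -/
theorem map_restriction_thetaUp (f : M →ₗ[MackeyAlgebra R F] N) (x : M) :
    Induction.map R (inner_le hH) (Restriction.map R (inner_le hH) f) (thetaUp R hH x) =
      thetaUp R hH (f x) := by
  rw [map_thetaUp, thetaUp_eq]
  simp only [map_pairRes]

/-- Naturality of `θ_H`. -/
theorem comp_thetaDown (f : M →ₗ[MackeyAlgebra R F] N) :
    f ∘ₗ thetaDown R (inner_le hH) M = thetaDown R (inner_le hH) N ∘ₗ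
      Induction.map R (inner_le hH) (Restriction.map R (inner_le hH) f) := by
  refine Induction.hom_ext fun n => ?_
  rw [LinearMap.comp_apply, LinearMap.comp_apply, Induction.map_tmul, thetaDown_tmul,
    thetaDown_tmul, map_smul]
  rfl

end Pairs

section Scalars

/-- The module structure over the ring of coefficients. -/
@[reducible] noncomputable def scalarModule (R : Type u) [CommRing R] (E : FusionSystem T)
    (N : Type u) [AddCommGroup N] [Module (MackeyAlgebra R E) N] : Module R N :=
  Module.compHom N (algebraMap R (MackeyAlgebra R E))

theorem isScalarTower_scalarModule (E : FusionSystem T) (N : Type u) [AddCommGroup N]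
    [Module (MackeyAlgebra R E) N] :
    letI := scalarModule R E N
    IsScalarTower R (MackeyAlgebra R E) N :=
  letI := scalarModule R E N
  ⟨fun r a n => by
    rw [Algebra.smul_def, mul_smul]
    rfl⟩

end Scalars

section Vanishing

variable {M : Type u} [AddCommGroup M] [Module (MackeyAlgebra R F) M]

theorem iA_smul_restriction_eq_zero
    (hM : ∀ A ≤ F.S, ¬ F.IsCentric A → ∀ x : M, iA R F A A • x = 0)
    (A : Subgroup T) (hA : A ≤ H) (hc : ¬ F.IsCentric A) (x : Restriction R (inner_le hH) M) :
    iA R (inner H) A A • x = 0 := by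
  refine Coind.restriction_ext R hH ?_
  rw [Coind.val_smul R hH, incl_iA R hH hA, hM A (hA.trans hH) hc]
  rfl

variable {p : ℕ} [Fact p.Prime]

/-- Additivity of the formula for θ^H is elementary, but compatibility with the Mackey algebra is
not. It is inherited from the unit and from the inverse of the isomorphism. -/
theorem exists_thetaUp (hT : IsPGroup p T) (hF : F.IsSaturated p)
    (hM : ∀ A ≤ F.S, ¬ F.IsCentric A → ∀ x : M, iA R F A A • x = 0) :
    ∃ θ : M →ₗ[MackeyAlgebra R F] ResInd R hH M, ∀ x, θ x = thetaUp R hH x := by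
  let := scalarModule R (inner H) (Restriction R (inner_le hH) M)
  have := isScalarTower_scalarModule (R := R) (inner H) (Restriction R (inner_le hH) M)
  exact ⟨(Coind.equivInduction hT hF (iA_smul_restriction_eq_zero hH hM)).symm.toLinearMap ∘ₗ
    Coind.unit R hH M, fun x => (thetaUp_eq_toInduction hH x).symm⟩

namespace Coind

variable {N : Type u} [AddCommGroup N] [Module (MackeyAlgebra R (inner H)) N]
  [Module R N] [IsScalarTower R (MackeyAlgebra R (inner H)) N]

/-- The retraction of the unit of induction, obtained from coinduction. -/
noncomputable def retractInduction (hV : Detects R F H N) :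
    Restriction R (inner_le hH) (Induction R (inner_le hH) N) →ₗ[MackeyAlgebra R (inner H)] N where
  toFun x := retract hH (ofInduction hV (Restriction.val R (inner_le hH) _ x))
  map_add' x y := by rw [map_add, map_add, map_add]
  map_smul' a x := by rw [val_smul R hH, map_smul, retract_smul, RingHom.id_apply]

/-- Acting by c_φ⁻¹ R carries the component at the graph of `φ` to the diagonal of its source, where
the retraction reads it off. -/
theorem retractInduction_pairRes (hV : Detects R F H N) (hK : K ≤ F.S) (P : ProdPair F H K)
    (y : Induction R (inner_le hH) N) :
    retractInduction hH hV (pairRes R hH P y) = (ofInduction (hH := hH) hV y ⟨K, hK⟩).1 (gr P.φ) := by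
  change retract hH (ofInduction (hH := hH) hV (Restriction.val R (inner_le hH) _ (pairRes R hH P y))) = _
  have hA : P.A ≤ F.S := P.le.trans hH
  have h0 : rho R F (gr P.φ) K = iA R F P.A P.A * rho R F (gr P.φ) K := by
    have := iA_mul_rho R (gr P.φ) K (F := F)
    rw [p1_gr] at this
    exact this.symm
  have h1 : relComp (diag P.A) (gr P.φ) = gr P.φ := by
    rw [relComp_diag_left]
    refine inf_eq_left.2 fun d hd => ?_
    have := fst_mem_p1 hd
    rwa [p1_gr] at this
  rw [val_pairRes, map_smul, retract_eq _ P.le, rho_smul_apply P.isGrIn.isGr (p1_gr _) hA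
    P.isGrIn.p2_le hK _ (isGrIn_diag hH P.le), h1]
  · intro B hB
    rw [h0, mul_smul, iA_eq R le_rfl hA]
    exact ind_smul_of_ne _ _ _ hB

/-- Retracting the components of θ^H gives back `toInduction` applied to the coinduced element, so
this is the inverse property of the isomorphism. It plays the role of a triangle identity for
coinduction. -/
theorem map_retractInduction_thetaUp (hT : IsPGroup p T) (hF : F.IsSaturated p)
    (hN : ∀ A ≤ H, ¬ F.IsCentric A → ∀ n : N, iA R (inner H) A A • n = 0)
    (hV : Detects R F H N) (y : Induction R (inner_le hH) N) :
    Induction.map R (inner_le hH) (retractInduction hH hV) (thetaUp R hH y) = y := by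
  rw [map_thetaUp]
  conv_rhs => rw [← toInduction_ofInduction (hH := hH) hT hF hN hV y, toInduction]
  refine finsum_congr fun K => finsum_congr fun q => ?_
  rw [retractInduction_pairRes hH hV K.2.1]

/-- The other triangle identity: the diagonal components of the unit are the I_A^A x, and for A ≤ H
they add up to 1_H x = x. -/
theorem retract_unit (x : Restriction R (inner_le hH) M)
    [Module R (Restriction R (inner_le hH) M)]
    [IsScalarTower R (MackeyAlgebra R (inner H)) (Restriction R (inner_le hH) M)] :
    retract hH (unit R hH M (Restriction.val R (inner_le hH) M x)) = x := by
  have := Fintype.ofFinite {K : Subgroup T // K ≤ H}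
  refine restriction_ext R hH ?_
  rw [retract_apply, map_sum]
  have h1 : ∀ A : {A : Subgroup T // A ≤ H}, Restriction.val R (inner_le hH) M
      ((unit R hH M (Restriction.val R (inner_le hH) M x) ⟨A.1, A.2.trans hH⟩).1 (diag A.1)) =
      ind R (F := F) (le_refl A.1) (A.2.trans hH) • Restriction.val R (inner_le hH) M x := by
    intro A
    rw [← iA_eq R le_rfl, iA_self R (A.2.trans hH)]
    exact val_unitFun R hH _ (K := ⟨A.1, A.2.trans hH⟩) (isGrIn_diag hH A.2)
  rw [Finset.sum_congr rfl fun A _ => h1 A, ← Finset.sum_smul]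
  conv_rhs => rw [← incl_one_smul_val R hH x, incl_one, idem]
  congr 1
  exact (finsum_eq_sum_of_fintype (α := {K : Subgroup T // K ≤ H}) _).symm

end Coind

variable (R F) in
/-- The unit of induction. -/
noncomputable def inductionUnit (N : Type u) [AddCommGroup N]
    [Module (MackeyAlgebra R (inner H)) N] :
    N →ₗ[MackeyAlgebra R (inner H)]
      Restriction R (inner_le hH) (Induction R (inner_le hH) N) where
  toFun n := ⟨Induction.tmul R (inner_le hH) 1 n, by
    change incl R (inner_le hH) 1 • Induction.tmul R (inner_le hH) 1 n = _
    rw [Induction.smul_tmul, mul_one, ← one_mul (incl R (inner_le hH) 1), Induction.mul_incl_tmul,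
      one_smul]⟩
  map_add' n m := Subtype.ext (Induction.tmul_add _ _ _)
  map_smul' a n := Subtype.ext (by
    change Induction.tmul R (inner_le hH) 1 (a • n) =
      incl R (inner_le hH) a • Induction.tmul R (inner_le hH) 1 n
    rw [Induction.smul_tmul, mul_one, ← Induction.mul_incl_tmul, one_mul])

section InductionUnit

variable (N : Type u) [AddCommGroup N] [Module (MackeyAlgebra R (inner H)) N]

/-- A triangle identity for induction; with its coinduction counterpart it makes the identity of an
induced functor a transfer. -/
theorem thetaDown_map_inductionUnit (y : Induction R (inner_le hH) N) :
    thetaDown R (inner_le hH) _ (Induction.map R (inner_le hH) (inductionUnit R F hH N) y) = y := by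
  have : thetaDown R (inner_le hH) _ ∘ₗ Induction.map R (inner_le hH) (inductionUnit R F hH N) =
      LinearMap.id := by
    refine Induction.hom_ext fun n => ?_
    rw [LinearMap.comp_apply, Induction.map_tmul, thetaDown_tmul, one_smul]
    rfl
  exact LinearMap.congr_fun this y

/-- The second triangle identity: θ_H splits after restriction. -/
theorem map_thetaDown_comp_inductionUnit :
    Restriction.map R (inner_le hH) (thetaDown R (inner_le hH) M) ∘ₗ
      inductionUnit R F hH (Restriction R (inner_le hH) M) = LinearMap.id := by
  refine LinearMap.ext fun x => Coind.restriction_ext R hH ?_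
  change thetaDown R (inner_le hH) M (Induction.tmul R (inner_le hH) 1 x) = _
  rw [thetaDown_tmul, one_smul]
  rfl

theorem Induction.map_map {N' N'' : Type u} [AddCommGroup N'] [Module (MackeyAlgebra R (inner H)) N']
    [AddCommGroup N''] [Module (MackeyAlgebra R (inner H)) N'']
    (g : N' →ₗ[MackeyAlgebra R (inner H)] N'') (f : N →ₗ[MackeyAlgebra R (inner H)] N')
    (x : Induction R (inner_le hH) N) :
    Induction.map R (inner_le hH) g (Induction.map R (inner_le hH) f x) =
      Induction.map R (inner_le hH) (g ∘ₗ f) x := by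
  have : Induction.map R (inner_le hH) g ∘ₗ Induction.map R (inner_le hH) f =
      Induction.map R (inner_le hH) (g ∘ₗ f) := Induction.hom_ext fun n => rfl
  exact LinearMap.congr_fun this x

variable {N}

/-- The identity of an induced Mackey functor is a transfer. -/
theorem exists_thetaDown_map_thetaUp_eq (hT : IsPGroup p T) (hF : F.IsSaturated p)
    (hN : ∀ A ≤ H, ¬ F.IsCentric A → ∀ n : N, iA R (inner H) A A • n = 0) :
    ∃ f : Module.End (MackeyAlgebra R (inner H))
        (Restriction R (inner_le hH) (Induction R (inner_le hH) N)),
      ∀ y, thetaDown R (inner_le hH) _ (Induction.map R (inner_le hH) f (thetaUp R hH y)) = y := by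
  let := scalarModule R (inner H) N
  have := isScalarTower_scalarModule (R := R) (inner H) N
  -- The endomorphism factors through `N`. Inducing the retraction undoes θ^H, and inducing the unit
  -- is undone by θ_H.
  refine ⟨inductionUnit R F hH N ∘ₗ Coind.retractInduction hH (Coind.detects hT hF hH hN),
    fun y => ?_⟩
  rw [← Induction.map_map hH, Coind.map_retractInduction_thetaUp hH hT hF hN _ y,
    thetaDown_map_inductionUnit hH]

/-- The restriction of `θ^H` is split injective. -/
theorem exists_retraction_thetaUp (hT : IsPGroup p T) (hF : F.IsSaturated p)
    (hM : ∀ A ≤ F.S, ¬ F.IsCentric A → ∀ x : M, iA R F A A • x = 0)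
    {θ : M →ₗ[MackeyAlgebra R F] ResInd R hH M} (hθ : ∀ x, θ x = thetaUp R hH x) :
    ∃ ρ : Restriction R (inner_le hH) (ResInd R hH M) →ₗ[MackeyAlgebra R (inner H)]
        Restriction R (inner_le hH) M,
      ρ ∘ₗ Restriction.map R (inner_le hH) θ = LinearMap.id := by
  let := scalarModule R (inner H) (Restriction R (inner_le hH) M)
  have := isScalarTower_scalarModule (R := R) (inner H) (Restriction R (inner_le hH) M)
  have hN := iA_smul_restriction_eq_zero hH hM
  refine ⟨Coind.retractInduction hH (Coind.detects hT hF hH hN), LinearMap.ext fun x => ?_⟩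
  change Coind.retract hH (Coind.ofInduction (hH := hH) _ (θ (Restriction.val R (inner_le hH) M x))) = x
  rw [hθ, thetaUp_eq_toInduction, Coind.ofInduction_toInduction hT hF hN, Coind.retract_unit]

end InductionUnit

end Vanishing

end Theta

/-! ### Centric Mackey functors -/

section Centric

open MackeyAlgebra

variable {T : Type u} [Group T] [Finite T] {R : Type u} [CommRing R] {F G : FusionSystem T}
  {H : Subgroup T} (hH : H ≤ F.S)

theorem IsCentricMackey.mono {E F G : FusionSystem T} {M : Type u} [AddCommGroup M]
    [Module (MackeyAlgebra R E) M] (hM : IsCentricMackey R G E M) (hE : E.S ≤ F.S) (hFG : F ≤ G) :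
    IsCentricMackey R F E M :=
  ⟨hM.1, fun K hK hc => hM.2 K hK fun hG => hc (hG.of_le hFG (hK.trans hE))⟩

theorem IsCentricMackey.iA_smul_eq_zero {E F : FusionSystem T} {M : Type u} [AddCommGroup M]
    [Module (MackeyAlgebra R E) M] (hM : IsCentricMackey R F E M) (A : Subgroup T) (hA : A ≤ E.S)
    (hc : ¬ F.IsCentric A) (x : M) : iA R E A A • x = 0 := by
  rw [iA_eq R le_rfl hA, hM.2 A hA hc]

/-- Finite generation is passed through `R`: the Mackey algebra is finite over `R`, hence so is `M`,
and 1_H M is an R-linear image of `M`. -/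
theorem IsCentricMackey.restriction {M : Type u} [AddCommGroup M] [Module (MackeyAlgebra R F) M]
    (hM : IsCentricMackey R G F M) :
    IsCentricMackey R G (inner H) (Restriction R (inner_le hH) M) := by
  constructor
  · let := scalarModule R F M
    have := isScalarTower_scalarModule (R := R) F M
    let := scalarModule R (inner H) (Restriction R (inner_le hH) M)
    have := isScalarTower_scalarModule (R := R) (inner H) (Restriction R (inner_le hH) M)
    have := hM.1
    have : Module.Finite R M := Module.Finite.trans (MackeyAlgebra R F) M
    let f : M →ₗ[R] Restriction R (inner_le hH) M :=
      { toFun x := ⟨incl R (inner_le hH) 1 • x, smul_mem_restriction R (inner_le hH) 1 x⟩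
        map_add' x y := Subtype.ext (smul_add _ _ _)
        map_smul' r x := Subtype.ext (by
          change incl R (inner_le hH) 1 • algebraMap R (MackeyAlgebra R F) r • x =
            incl R (inner_le hH) (algebraMap R _ r) • incl R (inner_le hH) 1 • x
          rw [← mul_smul, ← mul_smul, ← map_mul, mul_one, incl_algebraMap, Algebra.commutes]) }
    have hf : Function.Surjective f := fun x => ⟨x.1, Subtype.ext x.2⟩
    have : Module.Finite R (Restriction R (inner_le hH) M) := Module.Finite.of_surjective f hf
    exact Module.Finite.of_restrictScalars_finite R (MackeyAlgebra R (inner H)) _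
  · intro K hK hc x
    refine Coind.restriction_ext R hH ?_
    have hi : incl R (inner_le hH) (ind R (le_refl K) hK) = ind R (le_refl K) (LE.le.trans hK hH) :=
      incl_ind R (inner_le hH) le_rfl hK
    rw [Coind.val_smul R hH, hi, hM.2 K _ hc]
    rfl

/-- The tensors of 1 with generators of `N` generate. The induced module is additively generated by
tensors that live at centric levels, so the other idempotents annihilate it. -/
theorem IsCentricMackey.induction {N : Type u} [AddCommGroup N]
    [Module (MackeyAlgebra R (inner H)) N] (hN : IsCentricMackey R F (inner H) N) :
    IsCentricMackey R F F (Induction R (inner_le hH) N) := by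
  classical
  constructor
  · obtain ⟨s, hs⟩ := hN.1.fg_top
    refine ⟨⟨s.image (Induction.tmul R (inner_le hH) 1), eq_top_iff.2 fun x _ => ?_⟩⟩
    have key : ∀ n : N, Induction.tmul R (inner_le hH) 1 n ∈ Submodule.span (MackeyAlgebra R F)
        ((s.image (Induction.tmul R (inner_le hH) 1) : Finset _) : Set (Induction R _ N)) := by
      intro n
      have hn : n ∈ Submodule.span (MackeyAlgebra R (inner H)) (s : Set N) := by
        rw [hs]
        trivial
      induction hn using Submodule.span_induction with
      | mem n hn => exact Submodule.subset_span (Finset.mem_coe.2 (Finset.mem_image_of_mem _ hn))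
      | zero =>
        rw [Induction.tmul_zero]
        exact zero_mem _
      | add n m _ _ hn hm =>
        rw [Induction.tmul_add]
        exact add_mem hn hm
      | smul a n _ hn =>
        have := Submodule.smul_mem _ (incl R (inner_le hH) a) hn
        rwa [Induction.smul_tmul, mul_one, ← one_mul (incl R _ a), Induction.mul_incl_tmul] at this
    induction x using Induction.induction_on with
    | htmul y n =>
      rw [← mul_one y, ← Induction.smul_tmul]
      exact Submodule.smul_mem _ _ (key n)
    | hadd x y hx hy => exact add_mem (hx trivial) (hy trivial)
  · intro K hK hc x
    induction x using Induction.induction_lam hH hN.iA_smul_eq_zero with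
    | hzero => rw [smul_zero]
    | hadd x y hx hy => rw [smul_add, hx, hy, add_zero]
    | hlam L hL q n =>
      have hne : K ≠ L := fun h => hc (h ▸ hL)
      rw [Induction.smul_tmul, lam, ← iA_mul_self R _ L, ← mul_assoc, ← mul_assoc,
        ← iA_eq R le_rfl hK, iA_self_mul_of_ne R hne, zero_mul, zero_mul, Induction.zero_tmul]

end Centric

/-! ### Direct summands -/

section Summand

variable {A : Type u} [Ring A] {M X : Type u} [AddCommGroup M] [Module A M]
  [AddCommGroup X] [Module A X]

theorem isSummand_iff : IsSummand A M X ↔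
    ∃ (i : M →ₗ[A] X) (π : X →ₗ[A] M), π ∘ₗ i = LinearMap.id := by
  constructor
  · rintro ⟨P, Q, h, ⟨e⟩⟩
    refine ⟨P.subtype ∘ₗ e.toLinearMap, e.symm.toLinearMap ∘ₗ P.projectionOnto Q h,
      LinearMap.ext fun x => ?_⟩
    simp
  · rintro ⟨i, π, h⟩
    have hi : Function.LeftInverse π i := LinearMap.congr_fun h
    refine ⟨LinearMap.range i, LinearMap.ker π, ?_, ⟨LinearEquiv.ofInjective i hi.injective⟩⟩
    have := LinearMap.isCompl_of_proj (p := LinearMap.range i) (f := i.rangeRestrict ∘ₗ π) (by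
      rintro ⟨_, x, rfl⟩
      exact Subtype.ext (congrArg i (hi x)))
    rwa [LinearMap.ker_comp_of_ker_eq_bot _ (by
      rw [LinearMap.ker_rangeRestrict, LinearMap.ker_eq_bot]
      exact hi.injective)] at this

end Summand

/-! ### Higman's criterion: the formal argument. -/

theorem mainTheorem3 {T : Type u} [Group T] [Finite T] (p : ℕ) [Fact p.Prime]
    (hT : IsPGroup p T) (R : Type u) [CommRing R]
    (F G : FusionSystem T) (hF : F.IsSaturated p) (hG : G.IsSaturated p) (hFG : F ≤ G)
    (M : Type u) [AddCommGroup M] [Module (MackeyAlgebra R F) M]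
    (hM : IsCentricMackey R G F M) (hMind : IsIndecomposable (MackeyAlgebra R F) M)
    (H : Subgroup T) (hH : F.IsCentric H) :
    ∃ θ : M →ₗ[MackeyAlgebra R F] ResInd R hH.1 M,
      (∀ x : M, θ x = thetaUp R hH.1 x) ∧
      List.TFAE [
        -- (1)
        ∃ (N : Type u) (_ : AddCommGroup N) (_ : Module (MackeyAlgebra R (inner H)) N),
          IsCentricMackey R G (inner H) N ∧
            IsSummand (MackeyAlgebra R F) M (Induction R (inner_le hH.1) N),
        -- (2)
        ∃ (N : Type u) (_ : AddCommGroup N) (_ : Module (MackeyAlgebra R (inner H)) N),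
          IsCentricMackey R F (inner H) N ∧
            IsSummand (MackeyAlgebra R F) M (Induction R (inner_le hH.1) N),
        -- (3)
        (LinearMap.id : Module.End (MackeyAlgebra R F) M) ∈ Set.range (transfer R hH.1 θ),
        -- (4)
        Set.range (transfer R hH.1 θ) = Set.univ,
        -- (5)
        Function.Surjective (thetaDown R (inner_le hH.1) M) ∧
          ∀ (N L : Type u) [AddCommGroup N] [AddCommGroup L] [Module (MackeyAlgebra R F) N]
            [Module (MackeyAlgebra R F) L], IsCentricMackey R F F N → IsCentricMackey R F F L →
            ∀ (φ : N →ₗ[MackeyAlgebra R F] L) (ψ : M →ₗ[MackeyAlgebra R F] L),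
              Function.Surjective φ →
              (∃ γ : Restriction R (inner_le hH.1) M →ₗ[MackeyAlgebra R (inner H)]
                  Restriction R (inner_le hH.1) N,
                Restriction.map R (inner_le hH.1) φ ∘ₗ γ =
                  Restriction.map R (inner_le hH.1) ψ) →
              ∃ γ' : M →ₗ[MackeyAlgebra R F] N, φ ∘ₗ γ' = ψ,
        -- (6)
        Function.Injective θ ∧
          ∀ (N L : Type u) [AddCommGroup N] [AddCommGroup L] [Module (MackeyAlgebra R F) N]
            [Module (MackeyAlgebra R F) L], IsCentricMackey R F F N → IsCentricMackey R F F L →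
            ∀ (φ : L →ₗ[MackeyAlgebra R F] N) (ψ : L →ₗ[MackeyAlgebra R F] M),
              Function.Injective φ →
              (∃ γ : Restriction R (inner_le hH.1) N →ₗ[MackeyAlgebra R (inner H)]
                  Restriction R (inner_le hH.1) M,
                γ ∘ₗ Restriction.map R (inner_le hH.1) φ =
                  Restriction.map R (inner_le hH.1) ψ) →
              ∃ γ' : N →ₗ[MackeyAlgebra R F] M, γ' ∘ₗ φ = ψ,
        -- (7)
        Function.Surjective (thetaDown R (inner_le hH.1) M) ∧
          ∀ (N : Type u) [AddCommGroup N] [Module (MackeyAlgebra R F) N],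
            IsCentricMackey R F F N →
            ∀ φ : N →ₗ[MackeyAlgebra R F] M, Function.Surjective φ →
              (∃ σ : Restriction R (inner_le hH.1) M →ₗ[MackeyAlgebra R (inner H)]
                  Restriction R (inner_le hH.1) N,
                Restriction.map R (inner_le hH.1) φ ∘ₗ σ = LinearMap.id) →
              ∃ σ : M →ₗ[MackeyAlgebra R F] N, φ ∘ₗ σ = LinearMap.id,
        -- (8)
        Function.Injective θ ∧
          ∀ (N : Type u) [AddCommGroup N] [Module (MackeyAlgebra R F) N],
            IsCentricMackey R F F N →
            ∀ φ : M →ₗ[MackeyAlgebra R F] N, Function.Injective φ →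
              (∃ ρ : Restriction R (inner_le hH.1) N →ₗ[MackeyAlgebra R (inner H)]
                  Restriction R (inner_le hH.1) M,
                ρ ∘ₗ Restriction.map R (inner_le hH.1) φ = LinearMap.id) →
              ∃ ρ : N →ₗ[MackeyAlgebra R F] M, ρ ∘ₗ φ = LinearMap.id,
        -- (9)
        ∃ σ : M →ₗ[MackeyAlgebra R F] ResInd R hH.1 M,
          thetaDown R (inner_le hH.1) M ∘ₗ σ = LinearMap.id,
        -- (10)
        ∃ ρ : ResInd R hH.1 M →ₗ[MackeyAlgebra R F] M, ρ ∘ₗ θ = LinearMap.id,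
        -- (11)
        IsSummand (MackeyAlgebra R F) M (ResInd R hH.1 M)] := by
  have hS := hH.1
  have hMF : IsCentricMackey R F F M := hM.mono le_rfl hFG
  obtain ⟨θ, hθ⟩ := exists_thetaUp hS hT hF hMF.iA_smul_eq_zero
  have hRF : IsCentricMackey R F (inner H) (Restriction R (inner_le hS) M) := hMF.restriction hS
  have hMH : IsCentricMackey R F F (ResInd R hS M) := hRF.induction hS
  refine ⟨θ, hθ, ?_⟩
  -- Transfers form a left ideal: by naturality of θ_H, `g` composed with the transfer of `f` is the
  -- transfer of the composite of `g`↓ with `f`.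
  tfae_have 3 → 4 := by
    rintro ⟨f, hf⟩
    refine Set.eq_univ_of_forall fun g => ⟨Restriction.map R (inner_le hS) g ∘ₗ f, ?_⟩
    refine LinearMap.ext fun x => ?_
    have h1 := LinearMap.congr_fun hf x
    have h2 := LinearMap.congr_fun (comp_thetaDown hS g) (Induction.map R (inner_le hS) f (θ x))
    rw [LinearMap.comp_apply, LinearMap.comp_apply, Induction.map_map hS] at h2
    exact h2.symm.trans (congrArg g h1)
  tfae_have 4 → 3 := fun h => h ▸ Set.mem_univ _
  tfae_have 3 → 5 := by
    rintro ⟨f, hf⟩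
    refine ⟨fun x => ⟨_, LinearMap.congr_fun hf x⟩, ?_⟩
    rintro N L _ _ _ _ - - φ ψ - ⟨γ, hγ⟩
    -- A relative transfer of the composite of `γ` and `f`. Naturality of θ_H with respect to `φ`
    -- and `ψ` replaces `φ`↓ `γ` by `ψ`↓ and leaves `ψ` after the identity.
    refine ⟨thetaDown R (inner_le hS) N ∘ₗ Induction.map R (inner_le hS) (γ ∘ₗ f) ∘ₗ θ,
      LinearMap.ext fun x => ?_⟩
    have h1 := LinearMap.congr_fun hf x
    have h2 := LinearMap.congr_fun (comp_thetaDown hS φ)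
      (Induction.map R (inner_le hS) (γ ∘ₗ f) (θ x))
    have h3 := LinearMap.congr_fun (comp_thetaDown hS ψ) (Induction.map R (inner_le hS) f (θ x))
    rw [LinearMap.comp_apply, LinearMap.comp_apply, Induction.map_map hS] at h2 h3
    rw [← LinearMap.comp_assoc, hγ] at h2
    exact h2.trans (h3.symm.trans (congrArg ψ h1))
  tfae_have 5 → 7 := by
    rintro ⟨h, h'⟩
    exact ⟨h, fun N _ _ hN φ hφ hσ => h' N M hN hMF φ LinearMap.id hφ hσ⟩
  -- The condition is applied to θ_H itself, which splits after restriction by the unit of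
  -- induction.
  tfae_have 7 → 9 := fun h => h.2 _ hMH _ h.1
    ⟨_, map_thetaDown_comp_inductionUnit hS⟩
  tfae_have 9 → 11 := fun ⟨σ, h⟩ => isSummand_iff.2 ⟨σ, _, h⟩
  -- The restriction of `M` serves as `N`; it is G-centric because `M` is.
  tfae_have 11 → 1 := fun h => ⟨_, _, _, hM.restriction hS, h⟩
  tfae_have 1 → 2 := fun ⟨N, i1, i2, hN, h⟩ => ⟨N, i1, i2, hN.mono hS hFG, h⟩
  tfae_have 2 → 3 := by
    rintro ⟨N, _, _, hN, h⟩
    obtain ⟨i, π, h⟩ := isSummand_iff.1 h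
    obtain ⟨f, hf⟩ := exists_thetaDown_map_thetaUp_eq hS hT hF hN.iA_smul_eq_zero
    -- The endomorphism whose transfer is the identity of N↑ is conjugated by the inclusion and
    -- projection of the summand. Naturality of θ^H for `i` and of θ_H for `π` moves them outside
    -- the transfer.
    refine ⟨Restriction.map R (inner_le hS) π ∘ₗ f ∘ₗ Restriction.map R (inner_le hS) i,
      LinearMap.ext fun x => ?_⟩
    have h1 := LinearMap.congr_fun (comp_thetaDown hS π)
      (Induction.map R (inner_le hS) f (thetaUp R hS (i x)))
    rw [LinearMap.comp_apply, hf, ← map_restriction_thetaUp hS, LinearMap.comp_apply,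
      Induction.map_map hS, Induction.map_map hS, ← hθ] at h1
    exact h1.symm.trans (LinearMap.congr_fun h x)
  tfae_have 3 → 6 := by
    rintro ⟨f, hf⟩
    have hinj : Function.Injective θ := by
      refine Function.Injective.of_comp (f := fun y => thetaDown R (inner_le hS) M
        (Induction.map R (inner_le hS) f y)) fun x y hxy => ?_
      exact (LinearMap.congr_fun hf x).symm.trans (Eq.trans hxy (LinearMap.congr_fun hf y))
    refine ⟨hinj, ?_⟩
    rintro N L _ _ _ _ hN - φ ψ - ⟨γ, hγ⟩
    -- Dually to condition 5, the extension starts with the θ^H of `N`, and naturality of θ^H moves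
    -- `φ` and `ψ` past it.
    obtain ⟨θN, hθN⟩ := exists_thetaUp hS hT hF hN.iA_smul_eq_zero
    refine ⟨thetaDown R (inner_le hS) M ∘ₗ Induction.map R (inner_le hS) (f ∘ₗ γ) ∘ₗ θN,
      LinearMap.ext fun x => ?_⟩
    have h1 := LinearMap.congr_fun hf (ψ x)
    change thetaDown R (inner_le hS) M (Induction.map R (inner_le hS) f (θ (ψ x))) = ψ x at h1
    rw [hθ, ← map_restriction_thetaUp hS, ← hγ, Induction.map_map hS] at h1
    rw [LinearMap.comp_apply, LinearMap.comp_apply, LinearMap.comp_apply, hθN,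
      ← map_restriction_thetaUp hS, Induction.map_map hS]
    exact h1
  tfae_have 6 → 8 := by
    rintro ⟨h, h'⟩
    exact ⟨h, fun N _ _ hN φ hφ hρ => h' N M hN hMF φ LinearMap.id hφ hρ⟩
  -- The condition is applied to θ^H itself, which splits after restriction by the retraction from
  -- coinduction.
  tfae_have 8 → 10 := fun h => h.2 _ hMH θ h.1
    (exists_retraction_thetaUp hS hT hF hMF.iA_smul_eq_zero hθ)
  tfae_have 10 → 11 := fun ⟨ρ, h⟩ => isSummand_iff.2 ⟨θ, ρ, h⟩
  tfae_finish
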